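/- A (binary) interactive error correcting code (iECC) is a family $\pi=\{\pi_n\}_{n\in\mathbb N}$ of protocols between Alice and Bob. In $\pi_n$ Alice gets a private input $x\in\{0,1\}^n$; in each of $|\pi_n|$ rounds one party sends one bit to the other, where the number of rounds $|\pi_n|$ and the order of speaking are fixed beforehand and depend only on $n$; each bit is a function of $n$, the round, what the sender has sent and received so far and, for Alice, of $x$; at the end Bob outputs some $\hat x\in\{0,1\}^n$. Over the binary erasure channel, an online adversary, who sees the communication so far and the bit being sent, may replace any sent bit (of either party) by the erasure symbol $\perp$ at the receiver. The iECC is resilient to an $\alpha$ fraction of adversarial erasures if there is $n_0$ such that for all $n>n_0$, all $x\in\{0,1\}^n$ and all online attacks that erase at most $\alpha\cdot|\pi_n|$ of the bits sent by the two parties together, Bob outputs $\hat x=x$. **Theorem.** For every $\epsilon>0$ there exists a (deterministic) iECC $\pi$ over the binary erasure channel that is resilient to a $\frac{6}{11}-\epsilon$ fraction of adversarial erasures, such that the communication complexity satisfies $|\pi_n|=O_\epsilon(n)$ as $n\to\infty$, and such that $\pi$ runs in time $\mathrm{poly}_\epsilon(n)$: there are algorithms, uniform in $n$, and a polynomial $P$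 (all depending only on $\epsilon$) such that, within $P(n)$ steps on a random access machine, they compute the number of rounds and the order of speaking, each bit sent by Alice (from $n$, $x$ and her view), each bit sent by Bob (from $n$ and his view), and Bob's output (from $n$ and his view), respectively. -/

import Mathlib

open Filter Asymptotics

/-! ## A unit-cost random access machine

Time is measured on the usual random access machine over the natural numbers (registers, arrays
with indirect addressing, addition, truncated subtraction and halving but no multiplication, one
step per instruction), with structured control flow.  It is polynomially equivalent to Turing
machines: each step lengthens the largest stored number by at most one bit. -/

namespace RAM

/-- A memory: registers `reg r`, and arrays `arr a` with cells `arr a i`. -/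
structure Memory where
  reg : ℕ → ℕ
  arr : ℕ → ℕ → ℕ

/-- Write `v` into register `r`. -/
def Memory.setReg (s : Memory) (r v : ℕ) : Memory :=
  { s with reg := Function.update s.reg r v }

/-- Write `v` into cell `i` of array `a`. -/
def Memory.setArr (s : Memory) (a i v : ℕ) : Memory :=
  { s with arr := Function.update s.arr a (Function.update (s.arr a) i v) }

/-- Programs. All register and array names and all constants are part of the program text; only
the index of an array access is dynamic. -/
inductive Prog : Type
  /-- `r := c` -/
  | const (r c : ℕ)
  /-- `r := p` -/
  | copy (r p : ℕ)
  /-- `r := p + q` -/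
  | add (r p q : ℕ)
  /-- `r := p - q`, truncated at `0` -/
  | sub (r p q : ℕ)
  /-- `r := ⌊p / 2⌋` -/
  | half (r p : ℕ)
  /-- `r := a[p]` -/
  | load (r a p : ℕ)
  /-- `a[p] := q` -/
  | store (a p q : ℕ)
  /-- run one program, then the other -/
  | seq (c d : Prog)
  /-- run `c` if register `r` is nonzero, and `d` otherwise -/
  | branch (r : ℕ) (c d : Prog)
  /-- run `c` again and again as long as register `r` is nonzero -/
  | loop (r : ℕ) (c : Prog)

/-- `Exec c s t s'`: the program `c`, started in memory `s`, halts after exactly `t` steps in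
memory `s'`. Every instruction and every test of a register is one step. -/
inductive Exec : Prog → Memory → ℕ → Memory → Prop
  | const (r c : ℕ) (s : Memory) : Exec (.const r c) s 1 (s.setReg r c)
  | copy (r p : ℕ) (s : Memory) : Exec (.copy r p) s 1 (s.setReg r (s.reg p))
  | add (r p q : ℕ) (s : Memory) : Exec (.add r p q) s 1 (s.setReg r (s.reg p + s.reg q))
  | sub (r p q : ℕ) (s : Memory) : Exec (.sub r p q) s 1 (s.setReg r (s.reg p - s.reg q))
  | half (r p : ℕ) (s : Memory) : Exec (.half r p) s 1 (s.setReg r (s.reg p / 2))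
  | load (r a p : ℕ) (s : Memory) : Exec (.load r a p) s 1 (s.setReg r (s.arr a (s.reg p)))
  | store (a p q : ℕ) (s : Memory) : Exec (.store a p q) s 1 (s.setArr a (s.reg p) (s.reg q))
  | seq {c d : Prog} {s s' s'' : Memory} {t u : ℕ} :
      Exec c s t s' → Exec d s' u s'' → Exec (.seq c d) s (t + u) s''
  | branch_true {r : ℕ} {c d : Prog} {s s' : Memory} {t : ℕ} :
      s.reg r ≠ 0 → Exec c s t s' → Exec (.branch r c d) s (t + 1) s'
  | branch_false {r : ℕ} {c d : Prog} {s s' : Memory} {t : ℕ} :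
      s.reg r = 0 → Exec d s t s' → Exec (.branch r c d) s (t + 1) s'
  | loop_stop {r : ℕ} {c : Prog} {s : Memory} :
      s.reg r = 0 → Exec (.loop r c) s 1 s
  | loop_step {r : ℕ} {c : Prog} {s s' s'' : Memory} {t u : ℕ} :
      s.reg r ≠ 0 → Exec c s t s' → Exec (.loop r c) s' u s'' →
        Exec (.loop r c) s (t + u + 1) s''

/-- `c` halts from `s` within `T` steps, in a memory that satisfies `Q`. -/
def HaltsWithin (c : Prog) (s : Memory) (T : ℕ) (Q : Memory → Prop) : Prop :=
  ∃ t s', Exec c s t s' ∧ t ≤ T ∧ Q s'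

/-- The start memory: register `0` holds `n`, register `1` the length of `w`, array `0` holds `v`,
array `1` holds `w`, and everything else is `0`. -/
def input (n : ℕ) (v w : List ℕ) : Memory where
  reg r := if r = 0 then n else if r = 1 then w.length else 0
  arr a i := if a = 0 then v.getD i 0 else if a = 1 then w.getD i 0 else 0

end RAM

/-! ## Interactive error correcting codes over the binary erasure channel -/

/-- A received symbol: `some b` is the bit `b`, and `none` is the erasure symbol. -/
abbrev RecvSym := Option Bool

/-- The number that represents a symbol in the memory of a machine. -/
def RecvSym.code : RecvSym → ℕ
  | some b => b.toNat
  | none => 2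

/-- A family, indexed by the input length `n`, of deterministic non-adaptive interactive protocols:
in each round one party sends one bit, and the number of rounds and the order of speaking are fixed
beforehand. Alice has an input in `{0,1}^n`, and Bob outputs an element of `{0,1}^n`.

The view of a party before round `i` is a list of length `i`. Its entry `j` is the bit that the
party sent in round `j` if it was the speaker, and the symbol that it received otherwise. -/
structure IECC where
  /-- number of rounds -/
  rounds : ℕ → ℕ
  /-- whether Alice is the speaker of round `i` (rounds are numbered from `0`); otherwise Bob is -/
  aliceSpeaks (n i : ℕ) : Bool
  /-- Alice's next bit, given her input and her view -/
  aliceMsg (n : ℕ) (x : Fin n → Bool) (view : List RecvSym) : Bool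
  /-- Bob's next bit, given his view -/
  bobMsg (n : ℕ) (view : List RecvSym) : Bool
  /-- Bob's output, given his view of the whole execution -/
  bobOut (n : ℕ) (view : List RecvSym) : Fin n → Bool

namespace IECC

/-- A transcript lists, for each round, the bit that was sent and whether it was erased. -/
abbrev Transcript := List (Bool × Bool)

/-- An online erasure attack: from what happened so far and the bit that is being sent, the
adversary decides whether to erase this bit. -/
abbrev Attack := Transcript → Bool → Bool

/-- The number of erasures in a transcript. -/
def erasures (T : Transcript) : ℕ := T.countP (fun e => e.2)

/-- The view, in transcript `T`, of the party that speaks in the rounds `i` with `own i`. -/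
def partyView (own : ℕ → Bool) (T : Transcript) : List RecvSym :=
  T.mapIdx fun i e => if own i || !e.2 then some e.1 else none

variable (π : IECC) {n : ℕ}

/-- Alice's view. -/
def aliceView (n : ℕ) (T : Transcript) : List RecvSym :=
  partyView (fun i => π.aliceSpeaks n i) T

/-- Bob's view. -/
def bobView (n : ℕ) (T : Transcript) : List RecvSym :=
  partyView (fun i => !π.aliceSpeaks n i) T

/-- The transcript of the first `i` rounds on input `x` under the attack `att`. -/
def transcript (x : Fin n → Bool) (att : Attack) : ℕ → Transcript
  | 0 => []
  | i + 1 =>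
    let T := transcript x att i
    let b := if π.aliceSpeaks n i then π.aliceMsg n x (π.aliceView n T)
      else π.bobMsg n (π.bobView n T)
    T ++ [(b, att T b)]

/-- `π` is resilient to an `α` fraction of adversarial erasures: for all large `n`, all inputs `x`
and all online attacks that erase at most `α * |π_n|` of the bits sent by the two parties together,
Bob outputs `x`. -/
def ErasureResilient (α : ℝ) : Prop :=
  ∃ n₀ : ℕ, ∀ n > n₀, ∀ (x : Fin n → Bool) (att : Attack),
    (erasures (π.transcript x att (π.rounds n)) : ℝ) ≤ α * π.rounds n →
      π.bobOut n (π.bobView n (π.transcript x att (π.rounds n))) = x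

/-- The communication complexity `|π_n|` is `O(n)`. -/
def LinearCommunication : Prop :=
  (fun n : ℕ => (π.rounds n : ℝ)) =O[atTop] (fun n : ℕ => (n : ℝ))

/-- `π` runs in time polynomial in `n`: four programs, the same for all `n`, compute the number of
rounds and the order of speaking, each bit of Alice, each bit of Bob, and Bob's output, each of them
within `P n` steps for one polynomial `P`. -/
def PolyTime : Prop :=
  ∃ (schedule alice bob output : RAM.Prog) (P : Polynomial ℕ), ∀ n : ℕ,
    RAM.HaltsWithin schedule (RAM.input n [] []) (P.eval n) (fun s =>
      s.reg 0 = π.rounds n ∧ ∀ i < π.rounds n, s.arr 0 i = (π.aliceSpeaks n i).toNat) ∧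
    (∀ (x : Fin n → Bool) (v : List RecvSym), v.length < π.rounds n →
      RAM.HaltsWithin alice (RAM.input n (List.ofFn fun k => (x k).toNat) (v.map RecvSym.code))
        (P.eval n) (fun s => s.reg 0 = (π.aliceMsg n x v).toNat)) ∧
    (∀ v : List RecvSym, v.length < π.rounds n →
      RAM.HaltsWithin bob (RAM.input n [] (v.map RecvSym.code))
        (P.eval n) (fun s => s.reg 0 = (π.bobMsg n v).toNat)) ∧
    (∀ v : List RecvSym, v.length = π.rounds n →
      RAM.HaltsWithin output (RAM.input n [] (v.map RecvSym.code))
        (P.eval n) (fun s => ∀ k : Fin n, s.arr 0 k = (π.bobOut n v k).toNat))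

end IECC

/-! The protocol runs in blocks of `3 * u` bits of Bob followed by `8 * u` bits of Alice, with `u` a
large constant. An adversary who fools Bob must erase `6 * u` of the `11 * u` bits in almost every
block; this is where `6 / 11` comes from.

Alice's chunk is the value table of a linear form with coefficients `1`, the parity of a counter,
and the bits of one symbol of a codeword of her input. Two distinct chunks agree on half of the
positions, three distinct chunks agree simultaneously on a quarter, and a chunk agrees with each
constant word on half. So `4 * u` erasures are needed to keep two chunks possible and `6 * u` to
keep three. Bob repeats one of the four words of the simplex code of length three; he is
misunderstood never, and not understood only after `2 * u` erasures.

The code is repeated `K` times. While Alice's counter is `0`, each bit that reaches Bob is an affine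
equation on her input. If a repetition leaves an affine space of dimension at least two, it leaves
three distinct inputs, and since distinct codewords differ in almost every symbol the adversary paid
`6 * u` in almost every block (`cost_of_not_narrow`). Otherwise only two candidates remain, and Bob
knows an index `idx` where they differ. He cannot simply send it, so he drives Alice's counter up to
`idx` in unary: his symbol `0` or `1` is the parity that the counter should have. If it arrives she
counts, and her next chunk shows the new parity. In a block whose symbols distinguish the
candidates, if both candidates stay possible then Alice's chunk cost `4 * u`; so either Bob's symbol
cost `2 * u` more, or Alice moved. After a move, either Bob learns something or a third chunk is
possible, which costs `6 * u`. What he can learn is the input, that both possible counters moved, or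
that exactly one did. In the last case the two parities differ, and he asks for the parity (symbol
`3`) in place of the input bit at `idx` (symbol `2`). Alice answers by sending one constant bit for
ever, of which a single received bit suffices. Hence each block with distinguishing symbols costs `6
* u` or raises a progress measure bounded by `2 * n + 4` (`sync_step`).

Summing up (`Run.cost_of_out_ne`), the loss against `6 * u` per block is one repetition, `2 * n + 4`
blocks, and the blocks where codewords coincide. That is at most `8 * len` of the `K * len` blocks,
so a large `K` suffices.

The code needs constant rate, constant alphabet, relative distance close to `1` and an explicit
description. It is a Reed–Muller code over the field with `2 ^ m` elements, concatenated in the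
manner of Justesen: the value `f` at the point `(ξ ^ a₀, ξ ^ a₁, ...)` is sent as `f * ξ ^ a₀, f * ξ
^ a₁, ..., f`, read as `m` symbols of `v + 1` bits (`card_zero_symbols_le`). With `v` variables `2 ^
m` is polynomial in `n`, so a primitive polynomial for the field is found by brute force.

For the running time, expressions with folds of a common length `N` are compiled once and for all to
machine programs whose time is polynomial in `N` (`compile_correct`). Every function of the protocol
is then shown to be the value of such an expression, with `N` a cube of a linear function of `n`. -/

/-! ## A verified compiler for bounded-recursion expressions -/

namespace RAM

/-- What an expression may read: the input length, the length of the view, the loop bound and the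
two input arrays. -/
structure Inp where
  n : ℕ
  len : ℕ
  N : ℕ
  v : ℕ → ℕ
  w : ℕ → ℕ

/-- The input that a memory represents; register `2` holds the loop bound. -/
def Memory.inp (s : Memory) : Inp := ⟨s.reg 0, s.reg 1, s.reg 2, s.arr 0, s.arr 1⟩

/-- Extend an environment by a new innermost variable. -/
def push (a : ℕ) (ρ : ℕ → ℕ) : ℕ → ℕ
  | 0 => a
  | i + 1 => ρ i

/-- Expressions with de Bruijn variables. `fold a b` iterates `b` for `N` rounds starting from `a`;
in `b` variable `0` is the accumulator and variable `1` the loop counter. -/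
inductive Ex : Type
  | var (i : ℕ)
  | lit (c : ℕ)
  | glob (g : Fin 3)
  | add (a b : Ex)
  | sub (a b : Ex)
  | half (a : Ex)
  | load (g : Fin 2) (a : Ex)
  | ite (c a b : Ex)
  | fold (a b : Ex)

namespace Ex

def eval (I : Inp) : Ex → (ℕ → ℕ) → ℕ
  | var i, ρ => ρ i
  | lit c, _ => c
  | glob g, _ => ![I.n, I.len, I.N] g
  | add a b, ρ => a.eval I ρ + b.eval I ρ
  | sub a b, ρ => a.eval I ρ - b.eval I ρ
  | half a, ρ => a.eval I ρ / 2
  | load g a, ρ => ![I.v, I.w] g (a.eval I ρ)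
  | ite c a b, ρ => if c.eval I ρ ≠ 0 then a.eval I ρ else b.eval I ρ
  | fold a b, ρ => Nat.rec (a.eval I ρ) (fun i r => b.eval I (push r (push i ρ))) I.N

/-- Lift a renaming of variables under a binder. -/
def liftRen (ξ : ℕ → ℕ) : ℕ → ℕ
  | 0 => 0
  | i + 1 => ξ i + 1

def rename : Ex → (ℕ → ℕ) → Ex
  | var i, ξ => var (ξ i)
  | lit c, _ => lit c
  | glob g, _ => glob g
  | add a b, ξ => add (a.rename ξ) (b.rename ξ)
  | sub a b, ξ => sub (a.rename ξ) (b.rename ξ)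
  | half a, ξ => half (a.rename ξ)
  | load g a, ξ => load g (a.rename ξ)
  | ite c a b, ξ => ite (c.rename ξ) (a.rename ξ) (b.rename ξ)
  | fold a b, ξ => fold (a.rename ξ) (b.rename (liftRen (liftRen ξ)))

theorem push_liftRen (a : ℕ) (ρ ξ : ℕ → ℕ) :
    (fun i => push a ρ (liftRen ξ i)) = push a (fun i => ρ (ξ i)) := by
  funext i; cases i <;> rfl

theorem eval_rename (I : Inp) (e : Ex) : ∀ (ξ ρ : ℕ → ℕ),
    (e.rename ξ).eval I ρ = e.eval I (fun i => ρ (ξ i)) := by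
  induction e with
  | fold a b iha ihb =>
    intro ξ ρ
    simp only [rename, eval, iha, ihb, push_liftRen]
  | _ => intros; simp_all [rename, eval]

/-- Compile an expression to a program that leaves its value in register `d`, overwrites only
registers from `d` on, and finds its variables in the registers `vm`. -/
def compile : Ex → List ℕ → ℕ → Prog
  | var i, vm, d => match vm[i]? with
    | some r => .copy d r
    | none => .const d 0
  | lit c, _, d => .const d c
  | glob g, _, d => .copy d g
  | add a b, vm, d => .seq (a.compile vm d) (.seq (b.compile vm (d + 1)) (.add d d (d + 1)))
  | sub a b, vm, d => .seq (a.compile vm d) (.seq (b.compile vm (d + 1)) (.sub d d (d + 1)))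
  | half a, vm, d => .seq (a.compile vm d) (.half d d)
  | load g a, vm, d => .seq (a.compile vm d) (.load d g d)
  | ite c a b, vm, d => .seq (c.compile vm d) (.branch d (a.compile vm d) (b.compile vm d))
  | fold a b, vm, d =>
    .seq (a.compile vm d) (.seq (.const (d + 1) 0) (.seq (.copy (d + 2) 2) (.seq (.const (d + 3) 1)
      (.loop (d + 2) (.seq (b.compile (d :: (d + 1) :: vm) (d + 4)) (.seq (.copy d (d + 4))
        (.seq (.add (d + 1) (d + 1) (d + 3)) (.sub (d + 2) (d + 2) (d + 3)))))))))

/-- A bound for the running time of a compiled expression, in terms of the loop bound. -/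
noncomputable def cost : Ex → Polynomial ℕ
  | var _ => 1
  | lit _ => 1
  | glob _ => 1
  | add a b => a.cost + b.cost + 1
  | sub a b => a.cost + b.cost + 1
  | half a => a.cost + 1
  | load _ a => a.cost + 1
  | ite c a b => c.cost + a.cost + b.cost + 1
  | fold a b => a.cost + 4 + Polynomial.X * (b.cost + 4)

/-- The environment stored in the registers `vm`. -/
def envOf (s : Memory) (vm : List ℕ) (i : ℕ) : ℕ := (vm[i]?).elim 0 s.reg

theorem envOf_cons (s : Memory) (r : ℕ) (vm : List ℕ) :
    envOf s (r :: vm) = push (s.reg r) (envOf s vm) := by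
  funext i; cases i <;> simp [envOf, push]

theorem envOf_congr {s s' : Memory} {vm : List ℕ} {d : ℕ} (hvm : ∀ r ∈ vm, r < d)
    (h : ∀ r < d, s'.reg r = s.reg r) : envOf s' vm = envOf s vm := by
  funext i
  unfold envOf
  rcases hi : vm[i]? with _ | r
  · rfl
  · exact h r (hvm r (List.mem_of_getElem? hi))

/-- `s'` agrees with `s` on the arrays and on the registers below `d`. -/
def Frame (d : ℕ) (s s' : Memory) : Prop := (∀ r < d, s'.reg r = s.reg r) ∧ s'.arr = s.arr

theorem Frame.refl (d : ℕ) (s : Memory) : Frame d s s := ⟨fun _ _ => rfl, rfl⟩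

theorem Frame.trans {d : ℕ} {s s' s'' : Memory} (h : Frame d s s') (h' : Frame d s' s'') :
    Frame d s s'' := ⟨fun r hr => (h'.1 r hr).trans (h.1 r hr), h'.2.trans h.2⟩

theorem Frame.mono {d e : ℕ} {s s' : Memory} (h : Frame e s s') (hde : d ≤ e) : Frame d s s' :=
  ⟨fun r hr => h.1 r (by omega), h.2⟩

theorem Frame.setReg {d r : ℕ} {s s' : Memory} (h : Frame d s s') (hr : d ≤ r) (v : ℕ) :
    Frame d s (s'.setReg r v) := by
  refine ⟨fun q hq => ?_, h.2⟩
  simp only [Memory.setReg]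
  rw [Function.update_of_ne (by omega), h.1 q hq]

theorem Frame.inp {d : ℕ} {s s' : Memory} (h : Frame d s s') (hd : 3 ≤ d) : s'.inp = s.inp := by
  simp [Memory.inp, h.1 0 (by omega), h.1 1 (by omega), h.1 2 (by omega), h.2]

theorem reg_setReg_self (s : Memory) (r v : ℕ) : (s.setReg r v).reg r = v := by
  simp [Memory.setReg]

theorem reg_setReg_ne (s : Memory) {r q : ℕ} (v : ℕ) (h : q ≠ r) :
    (s.setReg r v).reg q = s.reg q := by
  simp [Memory.setReg, h]

/-- A counting-down loop whose body needs at most `T` steps preserves an invariant. -/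
theorem loop_count {c : Prog} {r T : ℕ} (Q : ℕ → Memory → Prop) (M : ℕ)
    (step : ∀ i < M, ∀ s, Q i s → s.reg r = M - i →
      ∃ t s', Exec c s t s' ∧ t ≤ T ∧ Q (i + 1) s' ∧ s'.reg r = M - (i + 1)) :
    ∀ k i s, i + k = M → Q i s → s.reg r = k →
      ∃ t s', Exec (.loop r c) s t s' ∧ t ≤ k * (T + 1) + 1 ∧ Q M s' ∧ s'.reg r = 0 := by
  intro k
  induction k with
  | zero =>
    intro i s hi hQ hr
    obtain rfl : i = M := by omega
    exact ⟨1, s, Exec.loop_stop hr, by omega, hQ, hr⟩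
  | succ k ih =>
    intro i s hi hQ hr
    obtain ⟨t, s', he, ht, hQ', hr'⟩ := step i (by omega) s hQ (by omega)
    obtain ⟨t', s'', he', ht', hQ'', hr''⟩ := ih (i + 1) s' (by omega) hQ' (by omega)
    refine ⟨t + t' + 1, s'', .loop_step (by omega) he he', ?_, hQ'', hr''⟩
    rw [Nat.succ_mul]; omega

/-- The number `d` acts as a stack pointer: code compiled at `d` leaves all registers below it
alone, so a first operand stored at `d` and the variables in `vm` survive the evaluation of what is
compiled above `d`. -/
theorem compile_correct (e : Ex) : ∀ (vm : List ℕ) (d : ℕ) (s : Memory), (∀ r ∈ vm, r < d) → 3 ≤ d →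
    ∃ t s', Exec (e.compile vm d) s t s' ∧ t ≤ e.cost.eval (s.reg 2) ∧
      s'.reg d = e.eval s.inp (envOf s vm) ∧ Frame d s s' := by
  induction e with
  | var i =>
    intro vm d s hvm hd
    rcases hi : vm[i]? with _ | r
    · refine ⟨1, _, by simp only [compile, hi]; exact .const _ _ _, by simp [cost], ?_,
        (Frame.refl d s).setReg le_rfl _⟩
      simp [eval, envOf, hi, reg_setReg_self]
    · refine ⟨1, _, by simp only [compile, hi]; exact .copy _ _ _, by simp [cost], ?_,
        (Frame.refl d s).setReg le_rfl _⟩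
      simp [eval, envOf, hi, reg_setReg_self]
  | lit c =>
    intro vm d s hvm hd
    exact ⟨1, _, .const _ _ _, by simp [cost], by simp [eval, reg_setReg_self],
      (Frame.refl d s).setReg le_rfl _⟩
  | glob g =>
    intro vm d s hvm hd
    refine ⟨1, _, .copy _ _ _, by simp [cost], ?_, (Frame.refl d s).setReg le_rfl _⟩
    fin_cases g <;> simp [eval, reg_setReg_self, Memory.inp]
  | add a b iha ihb =>
    intro vm d s hvm hd
    obtain ⟨t₁, s₁, he₁, ht₁, hv₁, hf₁⟩ := iha vm d s hvm hd
    obtain ⟨t₂, s₂, he₂, ht₂, hv₂, hf₂⟩ :=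
      ihb vm (d + 1) s₁ (fun r hr => (hvm r hr).trans (by omega)) (by omega)
    refine ⟨_, _, .seq he₁ (.seq he₂ (.add _ _ _ _)), ?_, ?_,
      (hf₁.trans (hf₂.mono (by omega))).setReg le_rfl _⟩
    · rw [hf₁.1 2 (by omega)] at ht₂
      simp only [cost, Polynomial.eval_add, Polynomial.eval_one]; omega
    · rw [reg_setReg_self, hv₂, hf₂.1 d (by omega), hv₁, hf₁.inp hd, envOf_congr hvm hf₁.1]; rfl
  | sub a b iha ihb =>
    intro vm d s hvm hd
    obtain ⟨t₁, s₁, he₁, ht₁, hv₁, hf₁⟩ := iha vm d s hvm hd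
    obtain ⟨t₂, s₂, he₂, ht₂, hv₂, hf₂⟩ :=
      ihb vm (d + 1) s₁ (fun r hr => (hvm r hr).trans (by omega)) (by omega)
    refine ⟨_, _, .seq he₁ (.seq he₂ (.sub _ _ _ _)), ?_, ?_,
      (hf₁.trans (hf₂.mono (by omega))).setReg le_rfl _⟩
    · rw [hf₁.1 2 (by omega)] at ht₂
      simp only [cost, Polynomial.eval_add, Polynomial.eval_one]; omega
    · rw [reg_setReg_self, hv₂, hf₂.1 d (by omega), hv₁, hf₁.inp hd, envOf_congr hvm hf₁.1]; rfl
  | half a iha =>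
    intro vm d s hvm hd
    obtain ⟨t₁, s₁, he₁, ht₁, hv₁, hf₁⟩ := iha vm d s hvm hd
    refine ⟨_, _, .seq he₁ (.half _ _ _), ?_, ?_, hf₁.setReg le_rfl _⟩
    · simp only [cost, Polynomial.eval_add, Polynomial.eval_one]; omega
    · rw [reg_setReg_self, hv₁]; rfl
  | load g a iha =>
    intro vm d s hvm hd
    obtain ⟨t₁, s₁, he₁, ht₁, hv₁, hf₁⟩ := iha vm d s hvm hd
    refine ⟨_, _, .seq he₁ (.load _ _ _ _), ?_, ?_, hf₁.setReg le_rfl _⟩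
    · simp only [cost, Polynomial.eval_add, Polynomial.eval_one]; omega
    · rw [reg_setReg_self, hv₁, hf₁.2]; fin_cases g <;> rfl
  | ite c a b ihc iha ihb =>
    intro vm d s hvm hd
    obtain ⟨t₁, s₁, he₁, ht₁, hv₁, hf₁⟩ := ihc vm d s hvm hd
    by_cases h0 : s₁.reg d = 0
    · obtain ⟨t₂, s₂, he₂, ht₂, hv₂, hf₂⟩ := ihb vm d s₁ hvm hd
      refine ⟨_, _, .seq he₁ (.branch_false h0 he₂), ?_, ?_, hf₁.trans hf₂⟩
      · rw [hf₁.1 2 (by omega)] at ht₂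
        simp only [cost, Polynomial.eval_add, Polynomial.eval_one]; omega
      · rw [hv₂, hf₁.inp hd, envOf_congr hvm hf₁.1]
        rw [hv₁] at h0
        simp [eval, h0]
    · obtain ⟨t₂, s₂, he₂, ht₂, hv₂, hf₂⟩ := iha vm d s₁ hvm hd
      refine ⟨_, _, .seq he₁ (.branch_true h0 he₂), ?_, ?_, hf₁.trans hf₂⟩
      · rw [hf₁.1 2 (by omega)] at ht₂
        simp only [cost, Polynomial.eval_add, Polynomial.eval_one]; omega
      · rw [hv₂, hf₁.inp hd, envOf_congr hvm hf₁.1]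
        rw [hv₁] at h0
        simp [eval, h0]
  | fold a b iha ihb =>
    intro vm d s hvm hd
    obtain ⟨t₁, s₁, he₁, ht₁, hv₁, hf₁⟩ := iha vm d s hvm hd
    set acc : ℕ → ℕ := fun j => Nat.rec (a.eval s.inp (envOf s vm))
      (fun i r => b.eval s.inp (push r (push i (envOf s vm)))) j with hacc
    -- Layout of a fold: the accumulator is at `d`, the loop counter at `d + 1`, the remaining
    -- rounds at `d + 2`, the constant one at `d + 3`, and the body works from `d + 4` on.
    let Q : ℕ → Memory → Prop := fun i s' =>
      Frame d s s' ∧ s'.reg d = acc i ∧ s'.reg (d + 1) = i ∧ s'.reg (d + 3) = 1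
    have hstep : ∀ i < s.reg 2, ∀ s', Q i s' → s'.reg (d + 2) = s.reg 2 - i →
        ∃ t s'', Exec (.seq (b.compile (d :: (d + 1) :: vm) (d + 4)) (.seq (.copy d (d + 4))
          (.seq (.add (d + 1) (d + 1) (d + 3)) (.sub (d + 2) (d + 2) (d + 3))))) s' t s'' ∧
          t ≤ b.cost.eval (s.reg 2) + 3 ∧ Q (i + 1) s'' ∧ s''.reg (d + 2) = s.reg 2 - (i + 1) := by
      intro i hi s' ⟨hf, ha, hc, h1⟩ hr
      obtain ⟨t, s'', he, ht, hv, hf''⟩ := ihb (d :: (d + 1) :: vm) (d + 4) s' (by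
        intro r hr
        simp only [List.mem_cons] at hr
        rcases hr with rfl | rfl | hr
        · omega
        · omega
        · exact (hvm r hr).trans (by omega)) (by omega)
      refine ⟨_, _, .seq he (.seq (.copy _ _ _) (.seq (.add _ _ _ _) (.sub _ _ _ _))), ?_,
        ⟨?_, ?_, ?_, ?_⟩, ?_⟩
      · rw [hf.1 2 (by omega)] at ht; omega
      · exact (((hf.trans (hf''.mono (by omega))).setReg le_rfl _).setReg (by omega) _).setReg
          (by omega) _
      · rw [reg_setReg_ne _ _ (by omega), reg_setReg_ne _ _ (by omega), reg_setReg_self, hv,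
          envOf_cons, envOf_cons, hf.inp hd, envOf_congr hvm hf.1, ha, hc]
      · rw [reg_setReg_ne _ _ (by omega), reg_setReg_self, reg_setReg_ne _ _ (by omega),
          reg_setReg_ne _ _ (by omega), hf''.1 _ (by omega), hf''.1 _ (by omega), hc, h1]
      · rw [reg_setReg_ne _ _ (by omega), reg_setReg_ne _ _ (by omega),
          reg_setReg_ne _ _ (by omega), hf''.1 _ (by omega), h1]
      · rw [reg_setReg_self, reg_setReg_ne _ _ (by omega), reg_setReg_ne _ _ (by omega),
          reg_setReg_ne _ _ (by omega), reg_setReg_ne _ _ (by omega), hf''.1 _ (by omega),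
          hf''.1 _ (by omega), hr, h1]
        omega
    obtain ⟨t, s', he, ht, ⟨hf, ha, -, -⟩, -⟩ := loop_count Q (s.reg 2) hstep (s.reg 2) 0
      (((s₁.setReg (d + 1) 0).setReg (d + 2) (s.reg 2)).setReg (d + 3) 1) (by omega)
      ⟨((hf₁.setReg (by omega) _).setReg (by omega) _).setReg (by omega) _, by
        rw [reg_setReg_ne _ _ (by omega), reg_setReg_ne _ _ (by omega),
          reg_setReg_ne _ _ (by omega)]
        exact hv₁, by
        rw [reg_setReg_ne _ _ (by omega), reg_setReg_ne _ _ (by omega), reg_setReg_self],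
        reg_setReg_self _ _ _⟩
      (by rw [reg_setReg_ne _ _ (by omega), reg_setReg_self])
    have h2 : (s₁.setReg (d + 1) 0).reg 2 = s.reg 2 := by
      rw [reg_setReg_ne _ _ (by omega), hf₁.1 2 (by omega)]
    refine ⟨_, s', .seq he₁ (.seq (.const _ _ _) (.seq (.copy _ _ _) (.seq (.const _ _ _)
      (by rw [h2]; exact he)))), ?_, ?_, hf⟩
    · simp only [cost, Polynomial.eval_add, Polynomial.eval_mul, Polynomial.eval_X,
        Polynomial.eval_ofNat]
      have : s.reg 2 * (Polynomial.eval (s.reg 2) b.cost + 3 + 1) =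
        s.reg 2 * (Polynomial.eval (s.reg 2) b.cost + 4) := by ring
      omega
    · rw [ha]; rfl

end Ex

/-- Register `2` becomes `(n + c) ^ k`, where register `0` holds `n`. -/
def powProg (c : ℕ) : ℕ → Prog
  | 0 => .const 2 1
  | k + 1 => .seq (powProg c k) (.seq (.const 5 c) (.seq (.add 3 0 5) (.seq (.const 4 0)
      (.seq (.const 5 1) (.seq (.loop 3 (.seq (.add 4 4 2) (.sub 3 3 5))) (.copy 2 4))))))

noncomputable def powCost (c : ℕ) : ℕ → Polynomial ℕ
  | 0 => 1
  | k + 1 => powCost c k + 6 + 3 * (Polynomial.X + Polynomial.C c)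

/-- `s'` agrees with `s` on the arrays and on registers `0` and `1`. -/
theorem powProg_correct (c k : ℕ) (s : Memory) :
    ∃ t s', Exec (powProg c k) s t s' ∧ t ≤ (powCost c k).eval (s.reg 0) ∧
      s'.reg 2 = (s.reg 0 + c) ^ k ∧ Ex.Frame 2 s s' := by
  induction k with
  | zero =>
    exact ⟨1, _, .const _ _ _, by simp [powCost], by simp [Ex.reg_setReg_self],
      (Ex.Frame.refl 2 s).setReg le_rfl _⟩
  | succ k ih =>
    obtain ⟨t, s₁, he, ht, hv, hf⟩ := ih
    -- Multiplication by repeated addition: after `i` rounds register `4` holds `i` copies of the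
    -- previous power, while register `3` counts down from `n + c`.
    let Q : ℕ → Memory → Prop := fun i s' =>
      Ex.Frame 2 s s' ∧ s'.reg 2 = s₁.reg 2 ∧ s'.reg 4 = i * s₁.reg 2 ∧ s'.reg 5 = 1
    obtain ⟨t', s', he', ht', ⟨hf', -, ha, -⟩, -⟩ := Ex.loop_count (T := 2)
      (c := .seq (.add 4 4 2) (.sub 3 3 5)) (r := 3) Q (s.reg 0 + c)
      (by
        intro i hi s' ⟨hf', h2, h4, h5⟩ h3
        refine ⟨_, _, .seq (.add _ _ _ _) (.sub _ _ _ _), le_rfl, ⟨?_, ?_, ?_, ?_⟩, ?_⟩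
        · exact (hf'.setReg (by omega) _).setReg (by omega) _
        · simp [Memory.setReg, h2]
        · simp [Memory.setReg, h2, h4, Nat.succ_mul]
        · simp [Memory.setReg, h5]
        · simp [Memory.setReg, h5, h3]; omega)
      (s.reg 0 + c) 0
      ((((s₁.setReg 5 c).setReg 3 (s.reg 0 + c)).setReg 4 0).setReg 5 1) (by omega)
      ⟨(((hf.setReg (by omega) _).setReg (by omega) _).setReg (by omega) _).setReg (by omega) _,
        by simp [Memory.setReg], by simp [Memory.setReg], by simp [Memory.setReg]⟩
      (by simp [Memory.setReg])
    have h0 : s.reg 0 + c = (s₁.setReg 5 c).reg 0 + (s₁.setReg 5 c).reg 5 := by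
      simp [Memory.setReg, hf.1 0]
    refine ⟨_, _, .seq he (.seq (.const _ _ _) (.seq (.add _ _ _ _) (.seq (.const _ _ _)
      (.seq (.const _ _ _) (.seq (by rw [← h0]; exact he') (.copy _ _ _)))))), ?_, ?_,
      hf'.setReg le_rfl _⟩
    · simp only [powCost, Polynomial.eval_add, Polynomial.eval_mul, Polynomial.eval_X,
        Polynomial.eval_ofNat, Polynomial.eval_C]
      omega
    · rw [Ex.reg_setReg_self, ha, hv, pow_succ]; ring

/-- Compute the loop bound `(n + c) ^ k` and then the value of `e`. -/
def evalProg (c k : ℕ) (e : Ex) : Prog := .seq (powProg c k) (.seq (e.compile [] 3) (.copy 0 3))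

noncomputable def evalCost (c k : ℕ) (e : Ex) : Polynomial ℕ :=
  powCost c k + e.cost.comp ((Polynomial.X + Polynomial.C c) ^ k) + 1

/-- The input of the expressions in a start memory, with loop bound `N`. -/
def inpOf (n N : ℕ) (v w : List ℕ) : Inp := ⟨n, w.length, N, fun i => v.getD i 0, fun i => w.getD i 0⟩

theorem evalProg_correct (c k : ℕ) (e : Ex) (n : ℕ) (v w : List ℕ) :
    HaltsWithin (evalProg c k e) (input n v w) ((evalCost c k e).eval n)
      (fun s => s.reg 0 = e.eval (inpOf n ((n + c) ^ k) v w) (fun _ => 0)) := by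
  obtain ⟨t, s, he, ht, hv, hf⟩ := powProg_correct c k (input n v w)
  obtain ⟨t', s', he', ht', hv', hf'⟩ := Ex.compile_correct e [] 3 s (by simp) le_rfl
  have hn : (input n v w).reg 0 = n := rfl
  have hinp : s.inp = inpOf n ((n + c) ^ k) v w := by
    simp only [Memory.inp, hv, hf.2, hf.1 0 (by omega), hf.1 1 (by omega), hn]
    rfl
  refine ⟨_, _, .seq he (.seq he' (.copy _ _ _)), ?_, ?_⟩
  · rw [hn] at ht
    rw [hv, hn] at ht'
    simp only [evalCost, Polynomial.eval_add, Polynomial.eval_comp, Polynomial.eval_pow,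
      Polynomial.eval_X, Polynomial.eval_C, Polynomial.eval_one]
    omega
  · beta_reduce
    rw [Ex.reg_setReg_self, hv', hinp]; rfl

/-- Compute the loop bound, the value `B` of `b`, and the values of `e` for its variable below `B`
into array `0`; register `0` becomes `B`. -/
def tableProg (c k : ℕ) (b e : Ex) : Prog :=
  .seq (powProg c k) (.seq (b.compile [] 3) (.seq (.const 4 0) (.seq (.const 5 1) (.seq (.copy 6 3)
    (.seq (.loop 6 (.seq (e.compile [4] 7) (.seq (.store 0 4 7) (.seq (.add 4 4 5) (.sub 6 6 5)))))
      (.copy 0 3))))))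

noncomputable def tableCost (c k : ℕ) (b e : Ex) (B : Polynomial ℕ) : Polynomial ℕ :=
  powCost c k + b.cost.comp ((Polynomial.X + Polynomial.C c) ^ k) + 5 +
    B * (e.cost.comp ((Polynomial.X + Polynomial.C c) ^ k) + 4)

/-- The table overwrites array `0`, from which the expression may read, while it is still being
computed. Therefore `hf` asks for the right value whatever that array contains. -/
theorem tableProg_correct (c k : ℕ) (b e : Ex) (n : ℕ) (w : List ℕ) (B : Polynomial ℕ)
    (hB : b.eval (inpOf n ((n + c) ^ k) [] w) (fun _ => 0) ≤ B.eval n) (f : ℕ → ℕ)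
    (hf : ∀ v, ∀ i < b.eval (inpOf n ((n + c) ^ k) [] w) (fun _ => 0),
      e.eval { inpOf n ((n + c) ^ k) [] w with v := v } (push i fun _ => 0) = f i) :
    HaltsWithin (tableProg c k b e) (input n [] w) ((tableCost c k b e B).eval n)
      (fun s => s.reg 0 = b.eval (inpOf n ((n + c) ^ k) [] w) (fun _ => 0) ∧
        ∀ i < b.eval (inpOf n ((n + c) ^ k) [] w) (fun _ => 0), s.arr 0 i = f i) := by
  set I := inpOf n ((n + c) ^ k) [] w with hI
  set M := b.eval I (fun _ => 0) with hM
  obtain ⟨t, s, he, ht, hv, hfr⟩ := powProg_correct c k (input n [] w)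
  obtain ⟨t', s', he', ht', hv', hfr'⟩ := Ex.compile_correct b [] 3 s (by simp) le_rfl
  have hn : (input n [] w).reg 0 = n := rfl
  have hinp : s.inp = I := by
    simp only [Memory.inp, hv, hfr.2, hfr.1 0 (by omega), hfr.1 1 (by omega), hn]
    rfl
  have hM' : s'.reg 3 = M := by rw [hv', hinp]; rfl
  let Q : ℕ → Memory → Prop := fun i q =>
    (∀ r < 3, q.reg r = s.reg r) ∧ q.arr 1 = s.arr 1 ∧ (∀ j < i, q.arr 0 j = f j) ∧
      q.reg 3 = M ∧ q.reg 4 = i ∧ q.reg 5 = 1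
  obtain ⟨t'', s'', he'', ht'', ⟨hr, -, ha, hM'', -, -⟩, -⟩ := Ex.loop_count
    (T := e.cost.eval ((n + c) ^ k) + 3)
    (c := .seq (e.compile [4] 7) (.seq (.store 0 4 7) (.seq (.add 4 4 5) (.sub 6 6 5)))) (r := 6)
    Q M
    (by
      intro i hi q ⟨hr, hw, ha, h3, h4, h5⟩ h6
      obtain ⟨τ, q', hq, hτ, hqv, hqf⟩ := Ex.compile_correct e [4] 7 q (by simp) (by omega)
      have hqi : q.inp = { I with v := q.arr 0 } := by
        rw [← hinp]
        simp only [Memory.inp, hr 0 (by omega), hr 1 (by omega), hr 2 (by omega), hw]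
      have hval : q'.reg 7 = f i := by
        rw [hqv, hqi, Ex.envOf_cons, h4]
        exact hf _ i hi
      refine ⟨_, _, .seq hq (.seq (.store _ _ _ _) (.seq (.add _ _ _ _) (.sub _ _ _ _))), ?_,
        ⟨?_, ?_, ?_, ?_, ?_, ?_⟩, ?_⟩
      · rw [hr 2 (by omega), hv, hn] at hτ
        omega
      · intro r hr3
        have : q'.reg r = s.reg r := by rw [hqf.1 r (by omega), hr r hr3]
        simp only [Memory.setReg, Memory.setArr]
        rw [Function.update_of_ne (by omega), Function.update_of_ne (by omega), this]
      · simp [Memory.setReg, Memory.setArr, hqf.2, hw]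
      · intro j hj
        have h4' : q'.reg 4 = i := by rw [hqf.1 4 (by omega), h4]
        simp only [Memory.setReg, Memory.setArr, Function.update_self, h4', hqf.2, hval]
        rcases Nat.lt_succ_iff_lt_or_eq.mp hj with hj | rfl
        · rw [Function.update_of_ne (by omega), ha j hj]
        · simp
      · simp [Memory.setReg, Memory.setArr, hqf.1, h3]
      · simp [Memory.setReg, Memory.setArr, hqf.1, h4, h5]
      · simp [Memory.setReg, Memory.setArr, hqf.1, h5]
      · simp [Memory.setReg, Memory.setArr, hqf.1, h5, h6]; omega)
    M 0 (((s'.setReg 4 0).setReg 5 1).setReg 6 M) (by omega)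
    ⟨fun r hr => by
        simp only [Memory.setReg]
        rw [Function.update_of_ne (by omega), Function.update_of_ne (by omega),
          Function.update_of_ne (by omega), hfr'.1 r (by omega)],
      by simp [Memory.setReg, hfr'.2], by simp, by simp [Memory.setReg, hM'],
      by simp [Memory.setReg], by simp [Memory.setReg]⟩
    (by simp [Memory.setReg])
  have h3 : M = ((s'.setReg 4 0).setReg 5 1).reg 3 := by simp [Memory.setReg, hM']
  refine ⟨_, _, .seq he (.seq he' (.seq (.const _ _ _) (.seq (.const _ _ _) (.seq (.copy _ _ _)
    (.seq (by rw [← h3]; exact he'') (.copy _ _ _)))))), ?_, ?_, ?_⟩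
  · rw [hn] at ht
    rw [hv, hn] at ht'
    simp only [tableCost, Polynomial.eval_add, Polynomial.eval_mul, Polynomial.eval_comp,
      Polynomial.eval_pow, Polynomial.eval_X, Polynomial.eval_C, Polynomial.eval_ofNat]
    have := Nat.mul_le_mul_right (e.cost.eval ((n + c) ^ k) + 4) hB
    have h' : M * (e.cost.eval ((n + c) ^ k) + 3 + 1) = M * (e.cost.eval ((n + c) ^ k) + 4) := by
      ring
    omega
  · rw [Ex.reg_setReg_self, hM'']
  · intro i hi
    exact ha i hi

end RAM

/-! ## Functions that expressions compute -/

namespace RAM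

/-- The environment without its innermost variable. -/
abbrev tl (ρ : ℕ → ℕ) : ℕ → ℕ := fun i => ρ (i + 1)

/-- The function `f` is the value of an expression on the domain `D`. -/
def PT (D : Inp → (ℕ → ℕ) → Prop) (f : Inp → (ℕ → ℕ) → ℕ) : Prop :=
  ∃ e : Ex, ∀ I ρ, D I ρ → e.eval I ρ = f I ρ

/-- The predicate `p` is decided by an expression on the domain `D`. -/
def PTp (D : Inp → (ℕ → ℕ) → Prop) (p : Inp → (ℕ → ℕ) → Prop) : Prop :=
  ∃ e : Ex, ∀ I ρ, D I ρ → (e.eval I ρ ≠ 0 ↔ p I ρ)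

/-- Iterate a function that also sees the number of the iteration. -/
def iter (g : ℕ → ℕ → ℕ) (x : ℕ) : ℕ → ℕ
  | 0 => x
  | k + 1 => g k (iter g x k)

theorem iter_congr {g g' : ℕ → ℕ → ℕ} {x : ℕ} : ∀ {k : ℕ}, (∀ i < k, ∀ r, g i r = g' i r) →
    iter g x k = iter g' x k
  | 0, _ => rfl
  | k + 1, h => by
    rw [iter, iter, iter_congr (k := k) fun i hi r => h i (by omega) r, h k (by omega)]

/-- The last index below `b` that satisfies `p`, and `0` if there is none. -/
def search (p : ℕ → Prop) [DecidablePred p] (b : ℕ) : ℕ := iter (fun i r => if p i then i else r) 0 b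

theorem search_spec {p : ℕ → Prop} [DecidablePred p] {b : ℕ} (h : ∃ i < b, p i) :
    search p b < b ∧ p (search p b) := by
  induction b with
  | zero => obtain ⟨i, hi, -⟩ := h; omega
  | succ b ih =>
    by_cases hb : p b
    · have : search p (b + 1) = b := by simp [search, iter, hb]
      rw [this]; exact ⟨by omega, hb⟩
    · have : search p (b + 1) = search p b := by simp [search, iter, hb]
      obtain ⟨i, hi, hp⟩ := h
      have hi' : i < b := by
        rcases Nat.lt_succ_iff_lt_or_eq.mp hi with h | rfl
        · exact h
        · exact absurd hp hb
      rw [this]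
      have := ih ⟨i, hi', hp⟩
      exact ⟨by omega, this.2⟩

theorem search_le (p : ℕ → Prop) [DecidablePred p] (b : ℕ) : search p b ≤ b := by
  induction b with
  | zero => exact le_rfl
  | succ b ih =>
    change (if p b then b else search p b) ≤ b + 1
    split_ifs <;> omega

theorem search_congr {p q : ℕ → Prop} [DecidablePred p] [DecidablePred q] {b : ℕ}
    (h : ∀ i < b, (p i ↔ q i)) : search p b = search q b :=
  iter_congr fun i hi r => by simp only [h i hi]

/-! ### Closure properties of the functions that expressions compute. -/

variable {D : Inp → (ℕ → ℕ) → Prop} {a b f : Inp → (ℕ → ℕ) → ℕ} {p q : Inp → (ℕ → ℕ) → Prop}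

theorem PT.mono {D' : Inp → (ℕ → ℕ) → Prop} (h : PT D f) (hD : ∀ I ρ, D' I ρ → D I ρ) : PT D' f := by
  obtain ⟨e, he⟩ := h
  exact ⟨e, fun I ρ h => he I ρ (hD I ρ h)⟩

theorem PT.congr (h : PT D f) (hab : ∀ I ρ, D I ρ → f I ρ = a I ρ) : PT D a := by
  obtain ⟨e, he⟩ := h
  exact ⟨e, fun I ρ h => (he I ρ h).trans (hab I ρ h)⟩

theorem PTp.congr (h : PTp D p) (hab : ∀ I ρ, D I ρ → (p I ρ ↔ q I ρ)) : PTp D q := by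
  obtain ⟨e, he⟩ := h
  exact ⟨e, fun I ρ h => (he I ρ h).trans (hab I ρ h)⟩

/-- Weakening by one variable. -/
theorem PT.wk {D' : Inp → (ℕ → ℕ) → Prop} (h : PT D f) (hD : ∀ I ρ, D' I ρ → D I (tl ρ)) :
    PT D' (fun I ρ => f I (tl ρ)) := by
  obtain ⟨e, he⟩ := h
  exact ⟨e.rename (· + 1), fun I ρ h => by rw [Ex.eval_rename]; exact he I _ (hD I ρ h)⟩

theorem PTp.wk {D' : Inp → (ℕ → ℕ) → Prop} (h : PTp D p) (hD : ∀ I ρ, D' I ρ → D I (tl ρ)) :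
    PTp D' (fun I ρ => p I (tl ρ)) := by
  obtain ⟨e, he⟩ := h
  exact ⟨e.rename (· + 1), fun I ρ h => by rw [Ex.eval_rename]; exact he I _ (hD I ρ h)⟩

theorem PT.var (i : ℕ) : PT D (fun _ ρ => ρ i) := ⟨.var i, fun _ _ _ => rfl⟩

theorem PT.lit (c : ℕ) : PT D (fun _ _ => c) := ⟨.lit c, fun _ _ _ => rfl⟩

theorem PT.n : PT D (fun I _ => I.n) := ⟨.glob 0, fun _ _ _ => rfl⟩

theorem PT.len : PT D (fun I _ => I.len) := ⟨.glob 1, fun _ _ _ => rfl⟩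

theorem PT.N : PT D (fun I _ => I.N) := ⟨.glob 2, fun _ _ _ => rfl⟩

theorem PT.add (ha : PT D a) (hb : PT D b) : PT D (fun I ρ => a I ρ + b I ρ) := by
  obtain ⟨e, he⟩ := ha
  obtain ⟨e', he'⟩ := hb
  exact ⟨.add e e', fun I ρ h => by simp [Ex.eval, he I ρ h, he' I ρ h]⟩

theorem PT.sub (ha : PT D a) (hb : PT D b) : PT D (fun I ρ => a I ρ - b I ρ) := by
  obtain ⟨e, he⟩ := ha
  obtain ⟨e', he'⟩ := hb
  exact ⟨.sub e e', fun I ρ h => by simp [Ex.eval, he I ρ h, he' I ρ h]⟩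

theorem PT.half (ha : PT D a) : PT D (fun I ρ => a I ρ / 2) := by
  obtain ⟨e, he⟩ := ha
  exact ⟨.half e, fun I ρ h => by simp [Ex.eval, he I ρ h]⟩

theorem PT.loadv (ha : PT D a) : PT D (fun I ρ => I.v (a I ρ)) := by
  obtain ⟨e, he⟩ := ha
  exact ⟨.load 0 e, fun I ρ h => by simp [Ex.eval, he I ρ h]⟩

theorem PT.loadw (ha : PT D a) : PT D (fun I ρ => I.w (a I ρ)) := by
  obtain ⟨e, he⟩ := ha
  exact ⟨.load 1 e, fun I ρ h => by simp [Ex.eval, he I ρ h]⟩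

/-- Each branch has to be correct only where it is taken. This is how size bounds that depend on a
test become available inside a branch. -/
theorem PT.ite [∀ I ρ, Decidable (p I ρ)] (hp : PTp D p) (ha : PT (fun I ρ => D I ρ ∧ p I ρ) a)
    (hb : PT (fun I ρ => D I ρ ∧ ¬ p I ρ) b) :
    PT D (fun I ρ => if p I ρ then a I ρ else b I ρ) := by
  obtain ⟨c, hc⟩ := hp
  obtain ⟨e, he⟩ := ha
  obtain ⟨e', he'⟩ := hb
  refine ⟨.ite c e e', fun I ρ h => ?_⟩
  by_cases hp : p I ρ
  · simp [Ex.eval, (hc I ρ h).mpr hp, hp, he I ρ ⟨h, hp⟩]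
  · have := mt (hc I ρ h).mp hp
    simp only [ne_eq, not_not] at this
    simp [Ex.eval, this, hp, he' I ρ ⟨h, hp⟩]

theorem PTp.ne_zero (ha : PT D a) : PTp D (fun I ρ => a I ρ ≠ 0) := by
  obtain ⟨e, he⟩ := ha
  exact ⟨e, fun I ρ h => by rw [he I ρ h]⟩

theorem PTp.not (hp : PTp D p) : PTp D (fun I ρ => ¬ p I ρ) := by
  obtain ⟨c, hc⟩ := hp
  refine ⟨.sub (.lit 1) c, fun I ρ h => ?_⟩
  beta_reduce
  rw [← hc I ρ h]
  simp only [Ex.eval]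
  omega

theorem PTp.and (hp : PTp D p) (hq : PTp D q) : PTp D (fun I ρ => p I ρ ∧ q I ρ) := by
  obtain ⟨c, hc⟩ := hp
  obtain ⟨d, hd⟩ := hq
  refine ⟨.ite c d (.lit 0), fun I ρ h => ?_⟩
  beta_reduce
  rw [← hc I ρ h, ← hd I ρ h]
  simp only [Ex.eval]
  split_ifs <;> simp_all

theorem PTp.or (hp : PTp D p) (hq : PTp D q) : PTp D (fun I ρ => p I ρ ∨ q I ρ) := by
  obtain ⟨c, hc⟩ := hp
  obtain ⟨d, hd⟩ := hq
  refine ⟨.add c d, fun I ρ h => ?_⟩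
  beta_reduce
  rw [← hc I ρ h, ← hd I ρ h]
  simp only [Ex.eval]
  omega

theorem PTp.le (ha : PT D a) (hb : PT D b) : PTp D (fun I ρ => a I ρ ≤ b I ρ) :=
  (PTp.ne_zero (ha.sub hb)).not.congr fun I ρ _ => by omega

theorem PTp.lt (ha : PT D a) (hb : PT D b) : PTp D (fun I ρ => a I ρ < b I ρ) :=
  (PTp.ne_zero (hb.sub ha)).congr fun I ρ _ => by omega

theorem PTp.eq (ha : PT D a) (hb : PT D b) : PTp D (fun I ρ => a I ρ = b I ρ) :=
  ((PTp.le ha hb).and (PTp.le hb ha)).congr fun I ρ _ => by omega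

/-- A fold always runs `N` rounds, so a guard makes it idle after round `b`. The domain of the body
records that the accumulator is a genuine iterate; bounds proved for the iterates can then be used
when the body itself is shown to be computable. -/
theorem PT.iter {g : Inp → (ℕ → ℕ) → ℕ → ℕ → ℕ} (hb : PT D b) (hN : ∀ I ρ, D I ρ → b I ρ ≤ I.N)
    (hf : PT D f)
    (hg : PT (fun I ρ => D I (tl (tl ρ)) ∧ ρ 1 < b I (tl (tl ρ)) ∧
      ρ 0 = iter (g I (tl (tl ρ))) (f I (tl (tl ρ))) (ρ 1)) (fun I ρ => g I (tl (tl ρ)) (ρ 1) (ρ 0))) :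
    PT D (fun I ρ => iter (fun i r => g I ρ i r) (f I ρ) (b I ρ)) := by
  have hb' := PT.wk (D' := fun I ρ => D I (tl (tl ρ))) (PT.wk (D' := fun I ρ => D I (tl ρ)) hb
    fun _ _ h => h) fun _ _ h => h
  obtain ⟨eb, heb⟩ := PTp.lt (PT.var 1) hb'
  obtain ⟨ef, hef⟩ := hf
  obtain ⟨eg, heg⟩ := hg
  refine ⟨.fold ef (.ite eb eg (.var 0)), fun I ρ h => ?_⟩
  simp only [Ex.eval]
  have key : ∀ k, (Nat.rec (ef.eval I ρ) (fun i r => if eb.eval I (push r (push i ρ)) ≠ 0 then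
      eg.eval I (push r (push i ρ)) else push r (push i ρ) 0) k : ℕ) =
      RAM.iter (g I ρ) (f I ρ) (min k (b I ρ)) := by
    intro k
    induction k with
    | zero => simp [RAM.iter, hef I ρ h]
    | succ k ih =>
      simp only [ih]
      have hlt := heb I (push (RAM.iter (g I ρ) (f I ρ) (min k (b I ρ))) (push k ρ)) h
      by_cases hk : k < b I ρ
      · rw [if_pos (hlt.mpr hk), show min k (b I ρ) = k by omega,
          show min (k + 1) (b I ρ) = k + 1 by omega]
        exact heg I _ ⟨h, hk, rfl⟩
      · rw [if_neg (mt hlt.mp hk), show min k (b I ρ) = b I ρ by omega,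
          show min (k + 1) (b I ρ) = b I ρ by omega]
        rfl
  rw [key, min_eq_right (hN I ρ h)]

theorem sum_range_eq_iter (g : ℕ → ℕ) (b : ℕ) :
    ∑ i ∈ Finset.range b, g i = iter (fun i r => r + g i) 0 b := by
  induction b with
  | zero => rfl
  | succ b ih => rw [Finset.sum_range_succ, ih]; rfl

theorem PT.sum {g : Inp → (ℕ → ℕ) → ℕ → ℕ} (hb : PT D b) (hN : ∀ I ρ, D I ρ → b I ρ ≤ I.N)
    (hg : PT (fun I ρ => D I (tl ρ) ∧ ρ 0 < b I (tl ρ)) (fun I ρ => g I (tl ρ) (ρ 0))) :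
    PT D (fun I ρ => ∑ i ∈ Finset.range (b I ρ), g I ρ i) := by
  refine (PT.iter (g := fun I ρ i r => r + g I ρ i) hb hN (PT.lit 0) ?_).congr
    fun I ρ _ => (sum_range_eq_iter _ _).symm
  exact (PT.var 0).add (hg.wk fun I ρ h => ⟨h.1, h.2.1⟩)

theorem PTp.ball {P : Inp → (ℕ → ℕ) → ℕ → Prop} (hb : PT D b) (hN : ∀ I ρ, D I ρ → b I ρ ≤ I.N)
    (hP : PTp (fun I ρ => D I (tl ρ) ∧ ρ 0 < b I (tl ρ)) (fun I ρ => P I (tl ρ) (ρ 0))) :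
    PTp D (fun I ρ => ∀ i < b I ρ, P I ρ i) := by
  classical
  have := (PTp.ne_zero (PT.sum (g := fun I ρ i => if P I ρ i then 0 else 1) hb hN
    (PT.ite hP (PT.lit 0) (PT.lit 1)))).not
  refine this.congr fun I ρ _ => ?_
  simp

theorem PTp.bex {P : Inp → (ℕ → ℕ) → ℕ → Prop} (hb : PT D b) (hN : ∀ I ρ, D I ρ → b I ρ ≤ I.N)
    (hP : PTp (fun I ρ => D I (tl ρ) ∧ ρ 0 < b I (tl ρ)) (fun I ρ => P I (tl ρ) (ρ 0))) :
    PTp D (fun I ρ => ∃ i < b I ρ, P I ρ i) :=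
  (PTp.ball (P := fun I ρ i => ¬ P I ρ i) hb hN hP.not).not.congr fun I ρ _ => by push Not; rfl

theorem PT.search {P : Inp → (ℕ → ℕ) → ℕ → Prop} [∀ I ρ, DecidablePred (P I ρ)] (hb : PT D b)
    (hN : ∀ I ρ, D I ρ → b I ρ ≤ I.N)
    (hP : PTp (fun I ρ => D I (tl ρ) ∧ ρ 0 < b I (tl ρ)) (fun I ρ => P I (tl ρ) (ρ 0))) :
    PT D (fun I ρ => search (P I ρ) (b I ρ)) :=
  PT.iter (g := fun I ρ i r => if P I ρ i then i else r) hb hN (PT.lit 0)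
    (PT.ite (hP.wk fun _ _ h => ⟨h.1, h.2.1⟩) (PT.var 1) (PT.var 0))

/-- The machine cannot multiply; the product is a sum of `a` copies of `b`, and only `a` has to be
at most `N`. -/
theorem PT.mul (ha : PT D a) (hb : PT D b) (hN : ∀ I ρ, D I ρ → a I ρ ≤ I.N) :
    PT D (fun I ρ => a I ρ * b I ρ) :=
  (PT.sum (g := fun I ρ _ => b I ρ) ha hN (hb.wk fun _ _ h => h.1)).congr fun I ρ _ => by simp

theorem PT.two_pow (ha : PT D a) (hN : ∀ I ρ, D I ρ → a I ρ ≤ I.N) :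
    PT D (fun I ρ => 2 ^ a I ρ) := by
  refine (PT.iter (g := fun _ _ _ r => r + r) ha hN (PT.lit 1)
    ((PT.var 0).add (PT.var 0))).congr fun I ρ _ => ?_
  generalize a I ρ = k
  induction k with
  | zero => rfl
  | succ k ih => rw [RAM.iter, ih, pow_succ]; ring

theorem PT.shr (ha : PT D a) (hb : PT D b) (hN : ∀ I ρ, D I ρ → b I ρ ≤ I.N) :
    PT D (fun I ρ => a I ρ / 2 ^ b I ρ) := by
  refine (PT.iter (g := fun _ _ _ r => r / 2) hb hN ha (PT.var 0).half).congr fun I ρ _ => ?_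
  generalize b I ρ = k
  induction k with
  | zero => simp [RAM.iter]
  | succ k ih => rw [RAM.iter, ih, pow_succ, Nat.div_div_eq_div_mul]

theorem PT.mod_two (ha : PT D a) : PT D (fun I ρ => a I ρ % 2) :=
  (ha.sub (ha.half.add ha.half)).congr fun I ρ _ => by omega

/-- Binary digits. -/
def bit (x i : ℕ) : ℕ := x / 2 ^ i % 2

theorem PT.bit (ha : PT D a) (hb : PT D b) (hN : ∀ I ρ, D I ρ → b I ρ ≤ I.N) :
    PT D (fun I ρ => bit (a I ρ) (b I ρ)) := (ha.shr hb hN).mod_two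

/-- The quotient counts the positive multiples of `y` up to `x`; there is no division instruction
except halving. -/
theorem div_eq_sum {x y : ℕ} (hy : 0 < y) :
    x / y = ∑ i ∈ Finset.range x, if (i + 1) * y ≤ x then 1 else 0 := by
  rw [← Finset.sum_filter, Finset.sum_const, smul_eq_mul, mul_one]
  have : Finset.filter (fun i => (i + 1) * y ≤ x) (Finset.range x) = Finset.range (x / y) := by
    ext i
    simp only [Finset.mem_filter, Finset.mem_range]
    rw [← Nat.le_div_iff_mul_le hy]
    have := Nat.div_le_self x y
    omega
  rw [this, Finset.card_range]

theorem PT.div (ha : PT D a) (hb : PT D b) (hN : ∀ I ρ, D I ρ → a I ρ ≤ I.N)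
    (h0 : ∀ I ρ, D I ρ → 0 < b I ρ) : PT D (fun I ρ => a I ρ / b I ρ) := by
  refine (PT.sum (g := fun I ρ i => if (i + 1) * b I ρ ≤ a I ρ then 1 else 0) ha hN
    (PT.ite (PTp.le (PT.mul ((PT.var 0).add (PT.lit 1)) (hb.wk fun _ _ h => h.1) ?_)
      (ha.wk fun _ _ h => h.1)) (PT.lit 1) (PT.lit 0))).congr fun I ρ h => (div_eq_sum (h0 I ρ h)).symm
  intro I ρ h
  have := hN I _ h.1
  omega

theorem PT.mod (ha : PT D a) (hb : PT D b) (hN : ∀ I ρ, D I ρ → a I ρ ≤ I.N)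
    (h0 : ∀ I ρ, D I ρ → 0 < b I ρ) : PT D (fun I ρ => a I ρ % b I ρ) := by
  refine (ha.sub (PT.mul (ha.div hb hN h0) hb fun I ρ h => ?_)).congr fun I ρ _ => ?_
  · exact (Nat.div_le_self _ _).trans (hN I ρ h)
  · have := Nat.div_add_mod' (a I ρ) (b I ρ)
    omega

/-! ### Numbers as vectors over the two-element field. -/

theorem bit_lt_two (x i : ℕ) : bit x i < 2 := Nat.mod_lt _ (by norm_num)

theorem bit_eq_testBit (x i : ℕ) : bit x i = (x.testBit i).toNat := by
  rw [Nat.testBit_eq_decide_div_mod_eq, bit]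
  rcases Nat.mod_two_eq_zero_or_one (x / 2 ^ i) with h | h <;> simp [h]

theorem bit_xor (x y i : ℕ) : bit (x ^^^ y) i = (bit x i + bit y i) % 2 := by
  rw [bit_eq_testBit, bit_eq_testBit, bit_eq_testBit, Nat.testBit_xor]
  cases x.testBit i <;> cases y.testBit i <;> rfl

theorem bit_of_lt {x i n : ℕ} (hx : x < 2 ^ n) (hi : n ≤ i) : bit x i = 0 := by
  rw [bit, Nat.div_eq_of_lt (hx.trans_le (Nat.pow_le_pow_right (by norm_num) hi))]

theorem eq_of_bit {x y n : ℕ} (hx : x < 2 ^ n) (hy : y < 2 ^ n) (h : ∀ i < n, bit x i = bit y i) :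
    x = y := by
  refine Nat.eq_of_testBit_eq fun i => ?_
  have hi : bit x i = bit y i := by
    by_cases hi : i < n
    · exact h i hi
    · rw [bit_of_lt hx (by omega), bit_of_lt hy (by omega)]
  rw [bit_eq_testBit, bit_eq_testBit] at hi
  cases hx : x.testBit i <;> cases hy : y.testBit i <;> simp_all

/-- The number with the binary digits `g`. -/
def ofBits (g : ℕ → ℕ) (n : ℕ) : ℕ := ∑ i ∈ Finset.range n, if g i % 2 = 1 then 2 ^ i else 0

theorem ofBits_succ (g : ℕ → ℕ) (n : ℕ) :
    ofBits g (n + 1) = ofBits g n + (g n % 2) * 2 ^ n := by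
  rw [ofBits, Finset.sum_range_succ, ← ofBits]
  rcases Nat.mod_two_eq_zero_or_one (g n) with h | h <;> simp [h]

theorem ofBits_lt (g : ℕ → ℕ) (n : ℕ) : ofBits g n < 2 ^ n := by
  induction n with
  | zero => simp [ofBits]
  | succ n ih =>
    rw [ofBits_succ, pow_succ]
    have := Nat.mul_le_mul_right (2 ^ n) (show g n % 2 ≤ 1 by omega)
    omega

theorem bit_ofBits (g : ℕ → ℕ) {n i : ℕ} (hi : i < n) : bit (ofBits g n) i = g i % 2 := by
  induction n with
  | zero => omega
  | succ n ih =>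
    rw [ofBits_succ]
    rcases Nat.lt_succ_iff_lt_or_eq.mp hi with h | rfl
    · rw [← ih h, bit, bit]
      obtain ⟨k, rfl⟩ : ∃ k, n = i + 1 + k := ⟨n - i - 1, by omega⟩
      have : g (i + 1 + k) % 2 * 2 ^ (i + 1 + k) = 2 ^ i * (2 * (g (i + 1 + k) % 2 * 2 ^ k)) := by
        ring
      rw [this, Nat.add_mul_div_left _ _ (by positivity)]
      omega
    · rw [bit, Nat.add_mul_div_right _ _ (by positivity), Nat.div_eq_of_lt (ofBits_lt g i)]
      omega

theorem PT.ofBits {g : Inp → (ℕ → ℕ) → ℕ → ℕ} (hb : PT D b) (hN : ∀ I ρ, D I ρ → b I ρ ≤ I.N)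
    (hg : PT (fun I ρ => D I (tl ρ) ∧ ρ 0 < b I (tl ρ)) (fun I ρ => g I (tl ρ) (ρ 0))) :
    PT D (fun I ρ => ofBits (g I ρ) (b I ρ)) :=
  PT.sum hb hN (PT.ite (PTp.eq hg.mod_two (PT.lit 1)) (PT.two_pow (PT.var 0)
    fun I _ h => h.1.2.le.trans (hN I _ h.1.1)) (PT.lit 0))

/-- The result is rebuilt from its binary digits. The operands may be exponential in `N`, as they
are for Alice's input and for Bob's vectors. -/
theorem PT.xor (ha : PT D a) (hb : PT D b) (hN : ∀ I ρ, D I ρ → a I ρ < 2 ^ I.N ∧ b I ρ < 2 ^ I.N) :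
    PT D (fun I ρ => a I ρ ^^^ b I ρ) := by
  refine (PT.ofBits (g := fun I ρ i => RAM.bit (a I ρ) i + RAM.bit (b I ρ) i) PT.N
    (fun _ _ _ => le_rfl) (PT.add
      (PT.bit (ha.wk fun _ _ h => h.1) (PT.var 0) fun _ _ h => h.2.le)
      (PT.bit (hb.wk fun _ _ h => h.1) (PT.var 0) fun _ _ h => h.2.le))).congr fun I ρ h => ?_
  refine eq_of_bit (ofBits_lt _ _) (Nat.xor_lt_two_pow (hN I ρ h).1 (hN I ρ h).2) fun i hi => ?_
  rw [bit_ofBits _ hi, bit_xor]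

end RAM

/-! ## Binary fields from primitive polynomials -/

namespace RAM

/-- Multiplication by the class of `X` modulo the polynomial of degree `m` with the binary digits of
`P`, on residues that are given by their binary digits. -/
def lstep (m P W : ℕ) : ℕ := if 2 ^ m ≤ 2 * W then (2 * W) ^^^ P else 2 * W

/-- The power `X ^ E` modulo `P`. -/
def lfsr (m P E : ℕ) : ℕ := iter (fun _ W => lstep m P W) 1 E

/-- `P` has degree `m` and the class of `X` has order `2 ^ m - 1` modulo `P`. -/
def IsPrimitive (m P : ℕ) : Prop :=
  2 ^ m ≤ P ∧ lfsr m P (2 ^ m - 1) = 1 ∧ ∀ E < 2 ^ m - 1, 0 < E → lfsr m P E ≠ 1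

instance (m : ℕ) : DecidablePred (IsPrimitive m) := fun P => by
  unfold IsPrimitive; infer_instance

/-- A primitive polynomial of degree `m`. -/
def primPoly (m : ℕ) : ℕ := search (IsPrimitive m) (2 ^ (m + 1))

section

variable {R : Type*} [CommRing R]

/-- The element with coordinates the binary digits of `W`. -/
def val (m : ℕ) (ξ : R) (W : ℕ) : R := ∑ r ∈ Finset.range m, (bit W r : R) * ξ ^ r

/-- The first `m` powers of `ξ` are independent over the two-element field. -/
def PowIndep (m : ℕ) (ξ : R) : Prop :=
  ∀ c : ℕ → ℕ, ∑ r ∈ Finset.range m, (c r : R) * ξ ^ r = 0 → ∀ r < m, c r % 2 = 0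

theorem cast_mod_two [CharP R 2] (k : ℕ) : ((k % 2 : ℕ) : R) = k :=
  (CharP.cast_eq_mod R 2 k).symm

theorem val_xor [CharP R 2] (m : ℕ) (ξ : R) (W W' : ℕ) :
    val m ξ (W ^^^ W') = val m ξ W + val m ξ W' := by
  simp only [val, ← Finset.sum_add_distrib, bit_xor, cast_mod_two, Nat.cast_add, add_mul]

theorem val_injOn [CharP R 2] {m : ℕ} {ξ : R} (h : PowIndep m ξ) {W W' : ℕ} (hW : W < 2 ^ m)
    (hW' : W' < 2 ^ m) (hv : val m ξ W = val m ξ W') : W = W' := by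
  refine eq_of_bit hW hW' fun i hi => ?_
  have := h (fun r => bit (W ^^^ W') r) (by
    have := val_xor m ξ W W'
    rw [hv, CharTwo.add_self_eq_zero] at this
    exact this) i hi
  simp only [bit_xor] at this
  have h1 := bit_lt_two W i
  have h2 := bit_lt_two W' i
  omega

theorem bit_two_mul_zero (W : ℕ) : bit (2 * W) 0 = 0 := by simp [bit]

theorem bit_two_mul_succ (W i : ℕ) : bit (2 * W) (i + 1) = bit W i := by
  rw [bit, bit, pow_succ', Nat.mul_div_mul_left _ _ (by norm_num)]

theorem bit_top {P m : ℕ} (h : 2 ^ m ≤ P) (h' : P < 2 ^ (m + 1)) : bit P m = 1 := by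
  have : P / 2 ^ m = 1 := by
    rw [Nat.div_eq_iff (by positivity)]
    rw [pow_succ] at h'
    omega
  rw [bit, this]

theorem lt_of_bit_top {P m : ℕ} (h : bit P m = 0) (h' : P < 2 ^ (m + 1)) : P < 2 ^ m := by
  by_contra hP
  rw [bit_top (by omega) h'] at h
  omega

theorem lstep_lt {m P W : ℕ} (hW : W < 2 ^ m) (hP : 2 ^ m ≤ P) (hP' : P < 2 ^ (m + 1)) :
    lstep m P W < 2 ^ m := by
  unfold lstep
  split_ifs with h
  · have h2 : 2 * W < 2 ^ (m + 1) := by rw [pow_succ]; omega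
    refine lt_of_bit_top ?_ (Nat.xor_lt_two_pow h2 hP')
    rw [bit_xor, bit_top h h2, bit_top hP hP']
  · omega

theorem lfsr_lt {m P : ℕ} (hm : 0 < m) (hP : 2 ^ m ≤ P) (hP' : P < 2 ^ (m + 1)) (E : ℕ) :
    lfsr m P E < 2 ^ m := by
  induction E with
  | zero => exact Nat.one_lt_two_pow (by omega)
  | succ E ih => exact lstep_lt ih hP hP'

/-- A shift multiplies by `ξ`. The bit that overflows into position `m` stands for `ξ ^ m`, which
the relation replaces by the lower digits of `P`; `val` ignores position `m`. -/
theorem val_lstep [CharP R 2] {m P W : ℕ} {ξ : R} (hW : W < 2 ^ m) (hrel : ξ ^ m = val m ξ P) :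
    val m ξ (lstep m P W) = ξ * val m ξ W := by
  have key : ξ * val m ξ W = val m ξ (2 * W) + (bit (2 * W) m : R) * ξ ^ m := by
    have : val m ξ (2 * W) + (bit (2 * W) m : R) * ξ ^ m = val (m + 1) ξ (2 * W) := by
      rw [val, val, Finset.sum_range_succ]
    rw [this, val, val, Finset.sum_range_succ', bit_two_mul_zero, Finset.mul_sum]
    simp only [bit_two_mul_succ, Nat.cast_zero, zero_mul, add_zero]
    exact Finset.sum_congr rfl fun r _ => by rw [pow_succ]; ring
  unfold lstep
  split_ifs with h
  · have h2 : 2 * W < 2 ^ (m + 1) := by rw [pow_succ]; omega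
    rw [key, bit_top h h2, val_xor, hrel]
    simp
  · rw [key, bit_of_lt (by omega) le_rfl]
    simp

theorem val_one {m : ℕ} (hm : 0 < m) (ξ : R) : val m ξ 1 = 1 := by
  rw [val, Finset.sum_eq_single_of_mem 0 (by simpa using hm)]
  · simp [bit]
  · intro r _ hr
    rw [bit, Nat.div_eq_of_lt (Nat.one_lt_two_pow hr)]
    simp

theorem val_lfsr [CharP R 2] {m P : ℕ} (hm : 0 < m) {ξ : R} (hP : 2 ^ m ≤ P)
    (hP' : P < 2 ^ (m + 1)) (hrel : ξ ^ m = val m ξ P) (E : ℕ) : val m ξ (lfsr m P E) = ξ ^ E := by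
  induction E with
  | zero => rw [pow_zero]; exact val_one hm ξ
  | succ E ih =>
    have : lfsr m P (E + 1) = lstep m P (lfsr m P E) := rfl
    rw [this, val_lstep (lfsr_lt hm hP hP' E) hrel, ih, pow_succ']

end

open Polynomial in
theorem powIndep_of_degree {F : Type*} [Field F] [Algebra (ZMod 2) F] {m : ℕ} {ξ : F}
    (h : (minpoly (ZMod 2) ξ).natDegree = m) : PowIndep m ξ := by
  intro c hc r hr
  have hli := linearIndependent_pow (K := ZMod 2) ξ
  rw [h, Fintype.linearIndependent_iff] at hli
  have := hli (fun i => (c i : ZMod 2)) (by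
    rw [← hc, Finset.sum_range]
    refine Finset.sum_congr rfl fun i _ => ?_
    rw [Algebra.smul_def, map_natCast]) ⟨r, hr⟩
  simpa [ZMod.natCast_eq_zero_iff, Nat.dvd_iff_mod_eq_zero] using this

/-- The minimal polynomial of a generator `ξ` of the multiplicative group of the field with `2 ^ m`
elements will do: the register computes the powers of `ξ`, and coordinates are unique, so the order
can be read off. -/
theorem exists_isPrimitive {m : ℕ} (hm : 0 < m) : ∃ P < 2 ^ (m + 1), IsPrimitive m P := by
  classical
  let F := GaloisField 2 m
  have : Finite F := inferInstance
  have := Fintype.ofFinite F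
  have : CharP F 2 := inferInstance
  obtain ⟨g, hg⟩ := IsCyclic.exists_generator (α := Fˣ)
  set ξ : F := (g : F) with hξ
  have hcard : Nat.card F = 2 ^ m := GaloisField.card 2 m (by omega)
  have hord : orderOf ξ = 2 ^ m - 1 := by
    rw [hξ, orderOf_units, orderOf_eq_card_of_forall_mem_zpowers hg, Nat.card_units, hcard]
  have hdeg : (minpoly (ZMod 2) ξ).natDegree = m := by
    -- All nonzero elements are powers of `ξ`, so `ξ` generates the whole field and its degree is
    -- `m`.
    have htop : IntermediateField.adjoin (ZMod 2) {ξ} = ⊤ := by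
      rw [eq_top_iff]
      intro x _
      by_cases hx : x = 0
      · rw [hx]; exact zero_mem _
      · obtain ⟨k, hk⟩ := hg (Units.mk0 x hx)
        have : x = ξ ^ k := by
          rw [hξ, ← Units.val_zpow_eq_zpow_val]
          simpa using (congrArg Units.val hk).symm
        rw [this]
        exact zpow_mem (IntermediateField.mem_adjoin_simple_self _ _) k
    rw [← IntermediateField.adjoin.finrank (IsIntegral.of_finite (ZMod 2) ξ), htop,
      IntermediateField.finrank_top', GaloisField.finrank 2 (by omega)]
  have hind : PowIndep m ξ := powIndep_of_degree hdeg
  set p := minpoly (ZMod 2) ξ with hp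
  have hmonic : p.Monic := minpoly.monic (IsIntegral.of_finite (ZMod 2) ξ)
  set P := ofBits (fun r => (p.coeff r).val) m + 2 ^ m with hPdef
  have hlt := ofBits_lt (fun r => (p.coeff r).val) m
  have hP' : P < 2 ^ (m + 1) := by rw [pow_succ]; omega
  have hrel : ξ ^ m = val m ξ P := by
    have h0 := minpoly.aeval (ZMod 2) ξ
    rw [← hp, Polynomial.aeval_eq_sum_range, hdeg, Finset.sum_range_succ] at h0
    have h1 : p.coeff m = 1 := by rw [← hdeg]; exact hmonic
    rw [h1, one_smul, add_comm, CharTwo.add_eq_zero] at h0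
    rw [h0, val]
    refine Finset.sum_congr rfl fun r hr => ?_
    have hr : r < m := Finset.mem_range.mp hr
    have hb : bit P r = (p.coeff r).val := by
      have h2 : bit P r = bit (ofBits (fun r => (p.coeff r).val) m) r := by
        rw [hPdef, bit, bit]
        obtain ⟨k, rfl⟩ : ∃ k, m = r + 1 + k := ⟨m - r - 1, by omega⟩
        rw [show 2 ^ (r + 1 + k) = 2 ^ r * (2 * 2 ^ k) by ring,
          Nat.add_mul_div_left _ _ (by positivity)]
        omega
      rw [h2, bit_ofBits _ hr]
      exact Nat.mod_eq_of_lt (ZMod.val_lt (p.coeff r))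
    rw [hb, Algebra.smul_def]
    congr 1
    conv_lhs => rw [← ZMod.natCast_zmod_val (p.coeff r)]
    rw [map_natCast]
  have hval := val_lfsr hm (by omega) hP' hrel
  have hone : (1 : ℕ) < 2 ^ m := Nat.one_lt_two_pow (by omega)
  refine ⟨P, hP', by omega, ?_, ?_⟩
  · refine val_injOn hind (lfsr_lt hm (by omega) hP' _) hone ?_
    rw [hval, val_one hm, ← hord, pow_orderOf_eq_one]
  · intro E hE hE0 h1
    have h2 : ξ ^ E = 1 := by rw [← hval, h1, val_one hm]
    have := Nat.le_of_dvd hE0 (orderOf_dvd_of_pow_eq_one h2)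
    omega

theorem primPoly_spec {m : ℕ} (hm : 0 < m) :
    primPoly m < 2 ^ (m + 1) ∧ IsPrimitive m (primPoly m) :=
  search_spec (exists_isPrimitive hm)

/-- A primitive polynomial gives a field in which the class of `X` generates the nonzero elements. -/
theorem exists_field_of_isPrimitive {m P : ℕ} (hm : 0 < m) (hP' : P < 2 ^ (m + 1))
    (h : IsPrimitive m P) : ∃ (F : Type) (_ : Field F) (_ : CharP F 2) (ξ : F), PowIndep m ξ ∧
      (∀ E, val m ξ (lfsr m P E) = ξ ^ E) ∧ ξ ≠ 0 ∧
      ∀ i < 2 ^ m - 1, ∀ j < 2 ^ m - 1, ξ ^ i = ξ ^ j → i = j := by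
  classical
  obtain ⟨hP, hQ, hne⟩ := h
  -- The top digit of `P` becomes the monic leading term, the remaining digits become `low`.
  let low : Polynomial (ZMod 2) :=
    ∑ r ∈ Finset.range m, Polynomial.C (bit P r : ZMod 2) * Polynomial.X ^ r
  have hlow : low.degree < m := by
    rw [Polynomial.degree_lt_iff_coeff_zero]
    intro k hk
    simp only [low, Polynomial.finsetSum_coeff, Polynomial.coeff_C_mul, Polynomial.coeff_X_pow]
    refine Finset.sum_eq_zero fun r hr => ?_
    rw [if_neg (by have := Finset.mem_range.mp hr; omega), mul_zero]
  set p : Polynomial (ZMod 2) := Polynomial.X ^ m + low with hp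
  have hmonic : p.Monic := Polynomial.monic_X_pow_add hlow
  have hdeg : p.natDegree = m := by
    rw [hp, Polynomial.natDegree_add_eq_left_of_degree_lt (by rwa [Polynomial.degree_X_pow]),
      Polynomial.natDegree_X_pow]
  let R := AdjoinRoot p
  let pb := AdjoinRoot.powerBasis' hmonic
  have hdim : pb.dim = m := hdeg
  have : Module.Finite (ZMod 2) R := pb.finite
  have : Finite R := Module.finite_of_finite (ZMod 2)
  have := Fintype.ofFinite R
  have hcard : Nat.card R = 2 ^ m := by
    rw [Module.natCard_eq_pow_finrank (K := ZMod 2), pb.finrank, hdim, Nat.card_zmod]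
  have : Nontrivial R := by
    rw [← Finite.one_lt_card_iff_nontrivial, hcard]
    exact Nat.one_lt_two_pow (by omega)
  have : CharP R 2 := charP_of_injective_algebraMap (algebraMap (ZMod 2) R).injective 2
  set ξ : R := AdjoinRoot.root p with hξ
  have hgen : pb.gen = ξ := rfl
  have hind : PowIndep m ξ := by
    intro c hc r hr
    have hli := pb.basis.linearIndependent
    rw [Fintype.linearIndependent_iff] at hli
    have := hli (fun i => (c i : ZMod 2)) (by
      rw [← hc, ← hdim, Finset.sum_range]
      refine Finset.sum_congr rfl fun i _ => ?_
      rw [pb.basis_eq_pow, hgen, Algebra.smul_def, map_natCast]) ⟨r, by omega⟩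
    simpa [ZMod.natCast_eq_zero_iff, Nat.dvd_iff_mod_eq_zero] using this
  have hrel : ξ ^ m = val m ξ P := by
    have h0 : Polynomial.aeval ξ p = 0 := by
      rw [hξ, Polynomial.aeval_def, AdjoinRoot.algebraMap_eq, AdjoinRoot.eval₂_root]
    have h1 : ∀ q, q = Polynomial.X ^ m + low →
        Polynomial.aeval ξ q = ξ ^ m + Polynomial.aeval ξ low := by
      rintro _ rfl
      rw [map_add, map_pow, Polynomial.aeval_X]
    rw [h1 p hp, CharTwo.add_eq_zero] at h0
    rw [h0]
    simp only [low, map_sum, map_mul, map_pow, Polynomial.aeval_X, val, map_natCast]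
  have hval := val_lfsr hm hP hP' hrel
  have hone : (1 : ℕ) < 2 ^ m := Nat.one_lt_two_pow (by omega)
  have hpow : ξ ^ (2 ^ m - 1) = 1 := by rw [← hval, hQ, val_one hm]
  have hu : IsUnit ξ := IsUnit.of_pow_eq_one hpow (by omega)
  have hinj : ∀ i < 2 ^ m - 1, ∀ j < 2 ^ m - 1, ξ ^ i = ξ ^ j → i = j := by
    have aux : ∀ i j, j < 2 ^ m - 1 → i < j → ξ ^ i ≠ ξ ^ j := by
      intro i j hj hij he
      have h1 : ξ ^ (j - i) = 1 := by
        have h2 : ξ ^ i * ξ ^ (j - i) = ξ ^ i * 1 := by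
          rw [← pow_add, mul_one, he]; congr 1; omega
        exact (hu.pow i).mul_left_cancel h2
      refine hne (j - i) (by omega) (by omega) (val_injOn hind (lfsr_lt hm hP hP' _) hone ?_)
      rw [hval, h1, val_one hm]
    intro i hi j hj he
    rcases lt_trichotomy i j with h | h | h
    · exact absurd he (aux i j hj h)
    · exact h
    · exact absurd he.symm (aux j i hi h)
  -- Irreducibility is never tested. The ring has `2 ^ m` elements, and the `2 ^ m - 1` distinct
  -- powers of the unit `ξ` already exhaust the nonzero ones.
  have hfield : IsField R := by
    refine ⟨exists_pair_ne R, mul_comm, fun {a} ha => ?_⟩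
    have himg : (Finset.range (2 ^ m - 1)).image (fun i => ξ ^ i) = Finset.univ.erase 0 := by
      refine Finset.eq_of_subset_of_card_le ?_ ?_
      · intro x hx
        obtain ⟨i, -, rfl⟩ := Finset.mem_image.mp hx
        exact Finset.mem_erase.mpr ⟨(hu.pow i).ne_zero, Finset.mem_univ _⟩
      · rw [Finset.card_image_of_injOn, Finset.card_range, Finset.card_erase_of_mem
          (Finset.mem_univ _), Finset.card_univ, ← Nat.card_eq_fintype_card, hcard]
        intro i hi j hj
        exact hinj i (by simpa using hi) j (by simpa using hj)
    have : a ∈ (Finset.range (2 ^ m - 1)).image (fun i => ξ ^ i) := by rw [himg]; simpa using ha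
    obtain ⟨i, -, rfl⟩ := Finset.mem_image.mp this
    obtain ⟨b, hb⟩ := (hu.pow i).exists_right_inv
    exact ⟨b, hb⟩
  exact ⟨R, hfield.toField, ‹CharP R 2›, ξ, hind, hval, hu.ne_zero, hinj⟩

end RAM

/-! ## A linear code of constant rate and large distance over a constant alphabet -/

namespace RAM

/-- Digits in base `2 ^ k`. -/
def dig (k a l : ℕ) : ℕ := a / 2 ^ (k * l) % 2 ^ k

/-- The exponent in the entry of the generator matrix for message bit `b`, evaluation point `a` and
component `i`. -/
def expo (v s m b a i : ℕ) : ℕ :=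
  b % m + ∑ l ∈ Finset.range v, dig (m - 1) a l * dig (m - s) (b / m) l +
    if i < v then dig (m - 1) a i else 0

/-- The generator matrix: a Reed–Muller code in `v` variables, concatenated with inner codes that
vary with the evaluation point. -/
def gen (v s m P b j i : ℕ) : ℕ := bit (lfsr m P (expo v s m b (j / m) i)) (j % m)

/-- Component `i` of symbol `j` of the codeword of the message `X` of `n` bits. -/
def sym (n v s m P X j i : ℕ) : ℕ := (∑ b ∈ Finset.range n, bit X b * gen v s m P b j i) % 2

theorem sum_range_mul {M : Type*} [AddCommMonoid M] (g : ℕ → M) (k m : ℕ) :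
    ∑ b ∈ Finset.range (k * m), g b =
      ∑ e ∈ Finset.range k, ∑ r ∈ Finset.range m, g (e * m + r) := by
  induction k with
  | zero => simp
  | succ k ih => rw [Nat.succ_mul, Finset.sum_range_add, ih, Finset.sum_range_succ]

theorem bit_div_mod {x A k r : ℕ} (hr : r < k) : bit (x / 2 ^ A % 2 ^ k) r = bit x (A + r) := by
  rw [bit_eq_testBit, bit_eq_testBit, Nat.testBit_mod_two_pow, Nat.testBit_div_two_pow]
  simp [hr, add_comm]

theorem dig_lt (k a l : ℕ) : dig k a l < 2 ^ k := Nat.mod_lt _ (by positivity)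

theorem eq_of_dig {k v a a' : ℕ} (ha : a < 2 ^ (k * v)) (ha' : a' < 2 ^ (k * v))
    (h : ∀ l < v, dig k a l = dig k a' l) : a = a' := by
  refine eq_of_bit ha ha' fun i hi => ?_
  have hk : 0 < k := Nat.pos_of_ne_zero fun h0 => by simp [h0] at hi
  have hl : i / k < v := (Nat.div_lt_iff_lt_mul hk).mpr (by rwa [mul_comm])
  have hr : i % k < k := Nat.mod_lt _ hk
  have := congrArg (fun x => bit x (i % k)) (h _ hl)
  simpa only [dig, bit_div_mod hr, Nat.div_add_mod] using this

section

variable {F : Type} [Field F]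

/-- The value of the message polynomial at the evaluation point `a`. -/
def rmEval (n v s m X : ℕ) (ξ : F) (a : ℕ) : F :=
  ∑ b ∈ Finset.range n, (bit X b : F) *
    ξ ^ (b % m + ∑ l ∈ Finset.range v, dig (m - 1) a l * dig (m - s) (b / m) l)

/-- The `m` symbols at one evaluation point, read component by component, are the coordinates of the
field elements `f * ξ ^ a₀, ..., f * ξ ^ aᵥ₋₁, f`, where `f` is the value of the message polynomial
and the `aᵢ` are the digits of the point. -/
theorem sum_sym [CharP F 2] {n v s m P X : ℕ} {ξ : F} (hval : ∀ E, val m ξ (lfsr m P E) = ξ ^ E)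
    (a i : ℕ) : ∑ t ∈ Finset.range m, (sym n v s m P X (a * m + t) i : F) * ξ ^ t =
      rmEval n v s m X ξ a * ξ ^ (if i < v then dig (m - 1) a i else 0) := by
  have h : ∀ t ∈ Finset.range m, (sym n v s m P X (a * m + t) i : F) * ξ ^ t =
      ∑ b ∈ Finset.range n, (bit X b : F) * ((bit (lfsr m P (expo v s m b a i)) t : F) * ξ ^ t) := by
    intro t ht
    have ht : t < m := Finset.mem_range.mp ht
    have h1 : (a * m + t) / m = a := by
      rw [mul_comm, Nat.mul_add_div (by omega), Nat.div_eq_of_lt ht, add_zero]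
    have h2 : (a * m + t) % m = t := by
      rw [mul_comm, Nat.mul_add_mod, Nat.mod_eq_of_lt ht]
    rw [sym, cast_mod_two, Nat.cast_sum, Finset.sum_mul]
    refine Finset.sum_congr rfl fun b _ => ?_
    rw [gen, h1, h2, Nat.cast_mul, mul_assoc]
  rw [Finset.sum_congr rfl h, Finset.sum_comm, rmEval, Finset.sum_mul]
  refine Finset.sum_congr rfl fun b _ => ?_
  rw [← Finset.mul_sum, mul_assoc, ← pow_add]
  exact congrArg _ (hval _)

open MvPolynomial in
-- Schwartz–Zippel: the individual degrees are below `2 ^ (m - s)` and each coordinate ranges over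
-- `2 ^ (m - 1)` powers of `ξ`, so the fraction of zeros is at most `v / 2 ^ (s - 1)`. The rate of
-- this outer code depends only on `s` and `v`.
theorem card_rmEval_zero_le [DecidableEq F] {n v s m X : ℕ} {ξ : F} (hs : 1 ≤ s) (hsm : s ≤ m)
    (hn : n ≤ 2 ^ ((m - s) * v) * m) (hX : X < 2 ^ n) (hX0 : X ≠ 0) (hind : PowIndep m ξ)
    (hinj : ∀ i < 2 ^ m - 1, ∀ j < 2 ^ m - 1, ξ ^ i = ξ ^ j → i = j) :
    2 ^ (s - 1) * ({a ∈ Finset.range (2 ^ ((m - 1) * v)) | rmEval n v s m X ξ a = 0} : Finset ℕ).card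
      ≤ v * 2 ^ ((m - 1) * v) := by
  classical
  set d := 2 ^ (m - s) with hd
  set H := 2 ^ (m - 1) with hH
  have hHm : H ≤ 2 ^ m - 1 := by
    have : 2 ^ m = 2 * H := by rw [hH, ← pow_succ']; congr 1; omega
    have : 0 < H := by positivity
    omega
  -- A group of `m` message bits is one coefficient, in the basis of the powers of `ξ`; the number
  -- of the group, written in base `2 ^ (m - s)`, is the exponent vector.
  let c : ℕ → F := fun e => ∑ r ∈ Finset.range m, (bit X (e * m + r) : F) * ξ ^ r
  let ex : ℕ → (Fin v →₀ ℕ) := fun e => Finsupp.equivFunOnFinite.symm fun l => dig (m - s) e l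
  let p : MvPolynomial (Fin v) F := ∑ e ∈ Finset.range (2 ^ ((m - s) * v)), monomial (ex e) (c e)
  have hexinj : ∀ e < 2 ^ ((m - s) * v), ∀ e' < 2 ^ ((m - s) * v), ex e = ex e' → e = e' := by
    intro e he e' he' h
    refine eq_of_dig he he' fun l hl => ?_
    exact DFunLike.congr_fun h (⟨l, hl⟩ : Fin v)
  have hcoeff : ∀ e < 2 ^ ((m - s) * v), p.coeff (ex e) = c e := by
    intro e he
    simp only [p, coeff_sum, coeff_monomial]
    rw [Finset.sum_eq_single_of_mem e (Finset.mem_range.mpr he), if_pos rfl]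
    intro e' he' hne
    rw [if_neg fun h => hne (hexinj e' (Finset.mem_range.mp he') e he h)]
  have hp : p ≠ 0 := by
    obtain ⟨i, hi⟩ : ∃ i, bit X i ≠ 0 := by
      by_contra hcon
      push Not at hcon
      exact hX0 (eq_of_bit hX (by positivity) fun i _ => by rw [hcon i]; simp [bit])
    have hin : i < n := by
      by_contra h
      exact hi (bit_of_lt hX (by omega))
    have hm : 0 < m := by omega
    have he : i / m < 2 ^ ((m - s) * v) := (Nat.div_lt_iff_lt_mul hm).mpr (by omega)
    intro h0
    have hc : c (i / m) = 0 := by rw [← hcoeff _ he, h0, coeff_zero]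
    have := hind (fun r => bit X (i / m * m + r)) hc (i % m) (Nat.mod_lt _ hm)
    simp only [Nat.div_add_mod'] at this
    have := bit_lt_two X i
    omega
  have hdeg : ∀ l, p.degreeOf l ≤ d := by
    intro l
    rw [degreeOf_le_iff]
    intro mon hmon
    obtain ⟨e, -, he⟩ := Finset.mem_biUnion.mp (support_sum hmon)
    have := support_monomial_subset he
    rw [Finset.mem_singleton] at this
    rw [this]
    exact (dig_lt (m - s) e l).le
  have heval : ∀ a, eval (fun l : Fin v => ξ ^ dig (m - 1) a l) p = rmEval n v s m X ξ a := by
    intro a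
    have hext : rmEval n v s m X ξ a = rmEval (2 ^ ((m - s) * v) * m) v s m X ξ a := by
      refine Finset.sum_subset (Finset.range_mono hn) fun b _ hb => ?_
      rw [bit_of_lt hX (by simpa using hb)]
      simp
    rw [hext, rmEval, sum_range_mul, map_sum]
    refine Finset.sum_congr rfl fun e _ => ?_
    rw [eval_monomial, Finset.sum_mul]
    refine Finset.sum_congr rfl fun r hr => ?_
    have hr : r < m := Finset.mem_range.mp hr
    have h1 : (e * m + r) / m = e := by
      rw [mul_comm, Nat.mul_add_div (by omega), Nat.div_eq_of_lt hr, add_zero]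
    have h2 : (e * m + r) % m = r := by
      rw [mul_comm, Nat.mul_add_mod, Nat.mod_eq_of_lt hr]
    rw [h1, h2, pow_add, mul_assoc, Finset.sum_range, ← Finset.prod_pow_eq_pow_sum,
      Finsupp.prod_fintype _ _ (fun _ => pow_zero _)]
    congr 2
    exact Finset.prod_congr rfl fun l _ => (pow_mul _ _ _).symm
  let S : Fin v → Finset F := fun _ => (Finset.range H).image fun i => ξ ^ i
  have hS : ∀ l, (S l).card = H := by
    intro l
    rw [Finset.card_image_of_injOn, Finset.card_range]
    intro i hi j hj
    exact hinj i (by have := Finset.mem_range.mp hi; omega) j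
      (by have := Finset.mem_range.mp hj; omega)
  have hsz := schwartz_zippel_sum_degreeOf hp S
  set Z := {x ∈ Fintype.piFinset S | eval x p = 0}.card with hZ
  have hle : ({a ∈ Finset.range (2 ^ ((m - 1) * v)) | rmEval n v s m X ξ a = 0} : Finset ℕ).card
      ≤ Z := by
    refine Finset.card_le_card_of_injOn (fun a l => ξ ^ dig (m - 1) a l) ?_ ?_
    · intro a ha
      have ha := (Finset.mem_filter.mp ha).2
      refine Finset.mem_coe.mpr (Finset.mem_filter.mpr ⟨?_, by rw [heval, ha]⟩)
      rw [Fintype.mem_piFinset]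
      intro l
      exact Finset.mem_image.mpr ⟨_, Finset.mem_range.mpr (dig_lt _ _ _), rfl⟩
    · intro a ha a' ha' h
      have ha := Finset.mem_range.mp (Finset.mem_filter.mp ha).1
      have ha' := Finset.mem_range.mp (Finset.mem_filter.mp ha').1
      refine eq_of_dig ha ha' fun l hl => ?_
      have h1 := dig_lt (m - 1) a l
      have h2 := dig_lt (m - 1) a' l
      exact hinj _ (by omega) _ (by omega) (congrFun h ⟨l, hl⟩)
  simp only [hS, Finset.prod_const, Finset.card_univ, Fintype.card_fin] at hsz
  have hH0 : (0 : ℚ≥0) < H := by rw [hH]; positivity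
  have hsum : ∑ l : Fin v, ((p.degreeOf l : ℚ≥0) / H) ≤ v * (d / H) := by
    calc ∑ l : Fin v, ((p.degreeOf l : ℚ≥0) / H) ≤ ∑ _l : Fin v, ((d : ℚ≥0) / H) := by
          gcongr with l
          exact_mod_cast hdeg l
      _ = v * (d / H) := by simp
  have h3 : (Z : ℚ≥0) ≤ v * (d / H) * H ^ v := by
    rw [← div_le_iff₀ (by positivity)]
    exact hsz.trans hsum
  have hHd : H = 2 ^ (s - 1) * d := by rw [hH, hd, ← pow_add]; congr 1; omega
  have hd0 : (0 : ℚ≥0) < d := by rw [hd]; positivity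
  have h4 : (2 ^ (s - 1) * Z : ℚ≥0) ≤ v * H ^ v := by
    calc (2 ^ (s - 1) * Z : ℚ≥0) ≤ 2 ^ (s - 1) * (v * (d / H) * H ^ v) := by gcongr
      _ = v * H ^ v := by
        have : (H : ℚ≥0) = 2 ^ (s - 1) * d := by rw [hHd]; push_cast; rfl
        have h5 : (2 : ℚ≥0) ^ (s - 1) * (d / H) = 1 := by
          rw [this]; field_simp
        calc (2 : ℚ≥0) ^ (s - 1) * (v * (d / H) * H ^ v)
            = v * H ^ v * (2 ^ (s - 1) * (d / H)) := by ring
          _ = v * H ^ v := by rw [h5, mul_one]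
  have h6 : 2 ^ (s - 1) * Z ≤ v * H ^ v := by exact_mod_cast h4
  calc _ ≤ 2 ^ (s - 1) * Z := Nat.mul_le_mul_left _ hle
    _ ≤ v * H ^ v := h6
    _ = v * 2 ^ ((m - 1) * v) := by rw [hH, ← pow_mul]

/-- The number of vanishing symbols at the evaluation point `a`. -/
def zeros (n v s m P X a : ℕ) : ℕ :=
  ({t ∈ Finset.range m | ∀ i < v + 1, sym n v s m P X (a * m + t) i = 0} : Finset ℕ).card

/-- Justesen's argument. Where `f` does not vanish, the transmitted elements determine `f` and all
`ξ ^ aᵢ`, hence the point; so different points give different `m × (v + 1)` matrices, and few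
matrices have `3 * m / (v + 1)` zero rows or more. -/
theorem card_many_zeros_le [CharP F 2] [DecidableEq F] {n v s m P X : ℕ} {ξ : F} (hm : 0 < m)
    (hval : ∀ E, val m ξ (lfsr m P E) = ξ ^ E)
    (hinj : ∀ i < 2 ^ m - 1, ∀ j < 2 ^ m - 1, ξ ^ i = ξ ^ j → i = j) :
    2 ^ m * ({a ∈ Finset.range (2 ^ ((m - 1) * v)) | rmEval n v s m X ξ a ≠ 0 ∧
      3 * m ≤ (v + 1) * zeros n v s m P X a} : Finset ℕ).card ≤ 2 ^ v * 2 ^ ((m - 1) * v) := by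
  classical
  set B := ({a ∈ Finset.range (2 ^ ((m - 1) * v)) | rmEval n v s m X ξ a ≠ 0 ∧
      3 * m ≤ (v + 1) * zeros n v s m P X a} : Finset ℕ) with hB
  have hHm : 2 ^ (m - 1) ≤ 2 ^ m - 1 := by
    have : 2 ^ m = 2 * 2 ^ (m - 1) := by rw [← pow_succ']; congr 1; omega
    have : 0 < 2 ^ (m - 1) := by positivity
    omega
  let M : ℕ → Fin m → Fin (v + 1) → Fin 2 := fun a t i =>
    ⟨sym n v s m P X (a * m + t) i, Nat.mod_lt _ (by norm_num)⟩
  -- Exponential weights for a Markov bound: a zero row counts `2 ^ (v + 1)`. The total weight of a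
  -- row is below `2 ^ (v + 2)`, whereas a bad matrix has weight at least `2 ^ (3 * m)`.
  let g : (Fin (v + 1) → Fin 2) → ℕ := fun x => if x = 0 then 2 ^ (v + 1) else 1
  have hMinj : Set.InjOn M B := by
    intro a ha a' ha' h
    obtain ⟨ha, hfa, -⟩ := Finset.mem_filter.mp ha
    obtain ⟨ha', -, -⟩ := Finset.mem_filter.mp ha'
    have hsym : ∀ t < m, ∀ i < v + 1,
        sym n v s m P X (a * m + t) i = sym n v s m P X (a' * m + t) i := fun t ht i hi =>
      congrArg Fin.val (congrFun (congrFun h ⟨t, ht⟩) ⟨i, hi⟩)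
    have hy : ∀ i < v + 1, rmEval n v s m X ξ a * ξ ^ (if i < v then dig (m - 1) a i else 0) =
        rmEval n v s m X ξ a' * ξ ^ (if i < v then dig (m - 1) a' i else 0) := by
      intro i hi
      rw [← sum_sym hval, ← sum_sym hval]
      exact Finset.sum_congr rfl fun t ht => by rw [hsym t (Finset.mem_range.mp ht) i hi]
    have hf : rmEval n v s m X ξ a = rmEval n v s m X ξ a' := by
      simpa using hy v (by omega)
    refine eq_of_dig (Finset.mem_range.mp ha) (Finset.mem_range.mp ha') fun l hl => ?_
    have h1 := hy l (by omega)
    rw [if_pos hl, if_pos hl, ← hf] at h1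
    have h2 := dig_lt (m - 1) a l
    have h3 := dig_lt (m - 1) a' l
    exact hinj _ (by omega) _ (by omega) (mul_left_cancel₀ hfa h1)
  have hprod : ∀ a ∈ B, 2 ^ (3 * m) ≤ ∏ t, g (M a t) := by
    intro a ha
    obtain ⟨-, -, hz⟩ := Finset.mem_filter.mp ha
    have : ∏ t, g (M a t) = (2 ^ (v + 1)) ^ zeros n v s m P X a := by
      simp only [g, Finset.prod_ite, Finset.prod_const, one_pow, mul_one]
      congr 1
      rw [zeros]
      refine Finset.card_bij (fun t _ => (t : ℕ)) ?_ ?_ ?_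
      · intro t ht
        have ht := (Finset.mem_filter.mp ht).2
        refine Finset.mem_filter.mpr ⟨Finset.mem_range.mpr t.2, fun i hi => ?_⟩
        exact congrArg Fin.val (congrFun ht ⟨i, hi⟩)
      · intro t _ t' _ h
        exact Fin.ext h
      · intro t ht
        obtain ⟨ht, hz⟩ := Finset.mem_filter.mp ht
        refine ⟨⟨t, Finset.mem_range.mp ht⟩, Finset.mem_filter.mpr ⟨Finset.mem_univ _, ?_⟩, rfl⟩
        funext i
        exact Fin.ext (hz i i.2)
    rw [this, ← pow_mul]
    exact Nat.pow_le_pow_right (by norm_num) hz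
  have hsumg : ∑ x, g x ≤ 2 ^ (v + 2) := by
    calc ∑ x, g x ≤ ∑ x : Fin (v + 1) → Fin 2, ((if x = 0 then 2 ^ (v + 1) else 0) + 1) := by
          refine Finset.sum_le_sum fun x _ => ?_
          simp only [g]; split_ifs <;> omega
      _ = 2 ^ (v + 2) := by
        rw [Finset.sum_add_distrib, Finset.sum_ite_eq' Finset.univ (0 : Fin (v + 1) → Fin 2)]
        simp
        ring
  have hall : ∑ x : Fin m → Fin (v + 1) → Fin 2, ∏ t, g (x t) = (∑ x, g x) ^ m := by
    rw [Fintype.sum_pow]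
  have hcount : B.card * 2 ^ (3 * m) ≤ 2 ^ ((v + 2) * m) := by
    calc B.card * 2 ^ (3 * m) ≤ ∑ a ∈ B, ∏ t, g (M a t) := by
          rw [← smul_eq_mul]
          exact Finset.card_nsmul_le_sum _ _ _ hprod
      _ = ∑ x ∈ B.image M, ∏ t, g (x t) := by
          rw [Finset.sum_image (f := fun x => ∏ t, g (x t)) hMinj]
      _ ≤ ∑ x : Fin m → Fin (v + 1) → Fin 2, ∏ t, g (x t) :=
          Finset.sum_le_sum_of_subset (Finset.subset_univ _)
      _ = (∑ x, g x) ^ m := hall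
      _ ≤ (2 ^ (v + 2)) ^ m := Nat.pow_le_pow_left hsumg m
      _ = 2 ^ ((v + 2) * m) := (pow_mul _ _ _).symm
  refine Nat.le_of_mul_le_mul_right ?_ (show 0 < 2 ^ (2 * m) by positivity)
  have e1 : 2 ^ m * B.card * 2 ^ (2 * m) = B.card * 2 ^ (3 * m) := by
    rw [show 3 * m = m + 2 * m by ring, pow_add]; ring
  have e2 : 2 ^ v * 2 ^ ((m - 1) * v) * 2 ^ (2 * m) = 2 ^ ((v + 2) * m) := by
    rw [← pow_add, ← pow_add]
    congr 1
    obtain ⟨k, rfl⟩ : ∃ k, m = k + 1 := ⟨m - 1, by omega⟩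
    simp only [Nat.add_sub_cancel]
    ring
  rw [e1, e2]
  exact hcount

end

/-- A nonzero codeword has few vanishing symbols. -/
theorem card_zero_symbols_le {D n v s m P X : ℕ} (hD : 0 < D) (hv : 9 * D ≤ v) (hs1 : 1 ≤ s)
    (hs : 3 * D * v ≤ 2 ^ (s - 1)) (hsm : s ≤ m) (hmv : 3 * D * 2 ^ v ≤ 2 ^ m)
    (hP' : P < 2 ^ (m + 1)) (hP : IsPrimitive m P)
    (hn : n ≤ 2 ^ ((m - s) * v) * m) (hX : X < 2 ^ n) (hX0 : X ≠ 0) :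
    D * ({j ∈ Finset.range (2 ^ ((m - 1) * v) * m) | ∀ i < v + 1, sym n v s m P X j i = 0} :
      Finset ℕ).card ≤ 2 ^ ((m - 1) * v) * m := by
  classical
  have hm : 0 < m := by omega
  obtain ⟨F, _, hchar, ξ, hind, hval, -, hinj⟩ := exists_field_of_isPrimitive hm hP' hP
  set Q := 2 ^ ((m - 1) * v) with hQ
  have hA := card_rmEval_zero_le hs1 hsm hn hX hX0 hind hinj
  have hB := card_many_zeros_le (n := n) (v := v) (s := s) (X := X) hm hval hinj
  rw [← hQ] at hA hB
  set A := ({a ∈ Finset.range Q | rmEval n v s m X ξ a = 0} : Finset ℕ) with hAdef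
  set B := ({a ∈ Finset.range Q | rmEval n v s m X ξ a ≠ 0 ∧
      3 * m ≤ (v + 1) * zeros n v s m P X a} : Finset ℕ) with hBdef
  have hcard : ({j ∈ Finset.range (Q * m) | ∀ i < v + 1, sym n v s m P X j i = 0} : Finset ℕ).card
      = ∑ a ∈ Finset.range Q, zeros n v s m P X a := by
    simp only [zeros, Finset.card_filter]
    rw [sum_range_mul]
  rw [hcard]
  set Z := ∑ a ∈ Finset.range Q, zeros n v s m P X a with hZ
  -- Points where `f` vanishes and points with an exceptional inner word are charged all `m`
  -- symbols, every other point at most `3 * m / (v + 1)`. By the choice of the constants each of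
  -- the three contributions is at most a `1 / (3 * D)` fraction.
  have hz : ∀ a ∈ Finset.range Q, (v + 1) * zeros n v s m P X a ≤
      3 * m + (v + 1) * m * ((if rmEval n v s m X ξ a = 0 then 1 else 0) +
        (if rmEval n v s m X ξ a ≠ 0 ∧ 3 * m ≤ (v + 1) * zeros n v s m P X a then 1 else 0)) := by
    intro a _
    have hzm : zeros n v s m P X a ≤ m := by
      refine (Finset.card_filter_le _ _).trans ?_
      simp
    have := Nat.mul_le_mul_left (v + 1) hzm
    by_cases h1 : rmEval n v s m X ξ a = 0
    · simp [h1]; omega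
    · by_cases h2 : 3 * m ≤ (v + 1) * zeros n v s m P X a
      · simp [h1, h2]; omega
      · simp [h1, h2]; omega
  have hsum : (v + 1) * Z ≤ Q * (3 * m) + (v + 1) * m * (A.card + B.card) := by
    rw [hZ, Finset.mul_sum]
    refine (Finset.sum_le_sum hz).trans ?_
    rw [Finset.sum_add_distrib, ← Finset.mul_sum (Finset.range Q) _ ((v + 1) * m),
      Finset.sum_add_distrib, ← Finset.card_filter, ← Finset.card_filter, Finset.sum_const,
      Finset.card_range, smul_eq_mul]
  have hA' : 3 * D * A.card ≤ Q := by
    refine Nat.le_of_mul_le_mul_left ?_ (show 0 < v by omega)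
    calc v * (3 * D * A.card) = 3 * D * v * A.card := by ring
      _ ≤ 2 ^ (s - 1) * A.card := Nat.mul_le_mul_right _ hs
      _ ≤ v * Q := hA
  have hB' : 3 * D * B.card ≤ Q := by
    refine Nat.le_of_mul_le_mul_left ?_ (show 0 < 2 ^ v by positivity)
    calc 2 ^ v * (3 * D * B.card) = 3 * D * 2 ^ v * B.card := by ring
      _ ≤ 2 ^ m * B.card := Nat.mul_le_mul_right _ hmv
      _ ≤ 2 ^ v * Q := hB
  refine Nat.le_of_mul_le_mul_left ?_ (show 0 < 3 * (v + 1) by omega)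
  calc 3 * (v + 1) * (D * Z) = 3 * D * ((v + 1) * Z) := by ring
    _ ≤ 3 * D * (Q * (3 * m) + (v + 1) * m * (A.card + B.card)) := Nat.mul_le_mul_left _ hsum
    _ = 9 * D * (Q * m) + (v + 1) * m * (3 * D * A.card + 3 * D * B.card) := by ring
    _ ≤ (v + 1) * (Q * m) + (v + 1) * m * (Q + Q) := by gcongr; omega
    _ = 3 * (v + 1) * (Q * m) := by ring

end RAM

/-! ## The protocol -/

namespace RAM

/-- The parameters of the protocol for one input length: the input length `n`, the number `v + 1` of
bits of a code symbol, the number `K` of repetitions of the code, its length and its encoder, where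
`sy X j i` is bit `i` of symbol `j` of the codeword of `X`. -/
structure Scheme where
  n : ℕ
  v : ℕ
  K : ℕ
  len : ℕ
  sy : ℕ → ℕ → ℕ → ℕ

/-- Symbol `y` of the codeword of `z` in the simplex code of dimension two. -/
def had (y z : ℕ) : ℕ := (bit y 0 * bit z 0 + bit y 1 * bit z 1) % 2

namespace Scheme

variable (c : Scheme)

/-- The unit of the chunk lengths: a block of the protocol consists of `3 * u` bits of Bob and
`8 * u` bits of Alice. -/
def u : ℕ := 2 ^ c.v

/-- The number of blocks. -/
def blocks : ℕ := c.K * c.len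

/-- The linear part of the Hadamard codeword of the symbol of `X` for block `j`. -/
def lin (X j a : ℕ) : ℕ := (∑ i ∈ Finset.range (c.v + 1), bit a (i + 2) * c.sy X (j % c.len) i) % 2

/-- Alice's chunk in block `j` while she has input `X` and a counter of parity `p`. -/
def wb (X p j a : ℕ) : ℕ := (bit a 0 + bit a 1 * p + c.lin X j a) % 2

/-- What Alice sees in block `j` is consistent with Bob's symbol `z`. -/
def bobFits (w : ℕ → ℕ) (j z : ℕ) : Prop :=
  ∀ y < 3 * c.u, w (j * (11 * c.u) + y) = 2 ∨ w (j * (11 * c.u) + y) = had (y % 3 + 1) z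

/-- What Bob sees in block `j` is consistent with the chunk `f`. -/
def fits (w : ℕ → ℕ) (j : ℕ) (f : ℕ → ℕ) : Prop :=
  ∀ a < 8 * c.u, w (j * (11 * c.u) + 3 * c.u + a) = 2 ∨ w (j * (11 * c.u) + 3 * c.u + a) = f a

instance (w : ℕ → ℕ) (j : ℕ) : DecidablePred (c.bobFits w j) := fun z => by
  unfold bobFits; infer_instance

instance (w : ℕ → ℕ) (j : ℕ) (f : ℕ → ℕ) : Decidable (c.fits w j f) := by
  unfold fits; infer_instance

/-- The symbol that Alice decodes in block `j`, if it is unique. -/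
def decode (w : ℕ → ℕ) (j : ℕ) : ℕ := search (c.bobFits w j) 4

def Unique (w : ℕ → ℕ) (j : ℕ) : Prop := ∀ z < 4, c.bobFits w j z → z = c.decode w j

instance (w : ℕ → ℕ) (j : ℕ) : Decidable (c.Unique w j) := by
  unfold Unique; infer_instance

end Scheme

/-- Alice's reaction to Bob's symbol `z`. Her state is `4 * t` while her counter is `t`, and
`4 * t + 2 + β` after she has settled for the bit `β`. -/
def react (X z S : ℕ) : ℕ :=
  if z = 2 then 4 * (S / 4) + 2 + bit X (S / 4)
  else if z = 3 then 4 * (S / 4) + 2 + S / 4 % 2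
  else if S / 4 % 2 ≠ z then S + 4 else S

namespace Scheme

variable (c : Scheme)

/-- Once the flag for having settled is set, the state never changes again; an ambiguous reception
is ignored. -/
def aStep (X : ℕ) (w : ℕ → ℕ) (j S : ℕ) : ℕ :=
  if S / 2 % 2 = 0 ∧ c.Unique w j then react X (c.decode w j) S else S

/-- Alice's state before block `J`. -/
def aSt (X : ℕ) (w : ℕ → ℕ) (J : ℕ) : ℕ := iter (c.aStep X w) 0 J

/-- The chunk that Alice sends in block `j` in state `S`. -/
def aWord (X S j a : ℕ) : ℕ := if S / 2 % 2 = 1 then S % 2 else c.wb X (S / 4 % 2) j a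

/-- The vector number `i` of the list of vectors of `n` bits that is stored in `B`. -/
def vec (B i : ℕ) : ℕ := B / 2 ^ (c.n * i) % 2 ^ c.n

/-- Store a list of `n + 1` vectors. -/
def pack (g : ℕ → ℕ) : ℕ := ∑ i ∈ Finset.range (c.n + 1), g i * 2 ^ (c.n * i)

/-- A vector of the list that violates the homogeneous equation. -/
def pivot (B j a : ℕ) : ℕ := search (fun i => c.lin (c.vec B i) j a = 1) c.n

/-- Intersect an affine space, given by generators of its direction and by a point, with a
hyperplane. -/
def newVec (B j a r i : ℕ) : ℕ :=
  if (i < c.n ∧ c.lin (c.vec B i) j a = 1) ∨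
      (¬ i < c.n ∧ c.lin (c.vec B i) j a ≠ (r + bit a 0) % 2) then
    c.vec B i ^^^ c.vec B (c.pivot B j a)
  else c.vec B i

/-- While Alice's counter is `0`, a received bit `r` at position `a` says that `lin X j a` is `r +
bit a 0` modulo two. An erasure gives no equation. -/
def basStep (w : ℕ → ℕ) (ι τ B : ℕ) : ℕ :=
  if w ((ι * c.len + τ / (8 * c.u)) * (11 * c.u) + 3 * c.u + τ % (8 * c.u)) = 2 then B
  else c.pack (c.newVec B (ι * c.len + τ / (8 * c.u)) (τ % (8 * c.u))
    (w ((ι * c.len + τ / (8 * c.u)) * (11 * c.u) + 3 * c.u + τ % (8 * c.u))))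

/-- The affine space of the inputs that are consistent with repetition `ι` of the code. -/
def bas (w : ℕ → ℕ) (ι : ℕ) : ℕ :=
  iter (c.basStep w ι) (c.pack fun i => if i < c.n then 2 ^ i else 0) (c.len * (8 * c.u))

/-- Repetition `ι` of the code leaves at most two possible inputs. -/
def Narrow (w : ℕ → ℕ) (ι : ℕ) : Prop :=
  ∑ i ∈ Finset.range c.n, (if c.vec (c.bas w ι) i ≠ 0 then 1 else 0) ≤ 1

instance (w : ℕ → ℕ) (ι : ℕ) : Decidable (c.Narrow w ι) := by
  unfold Narrow; infer_instance

/-- The two possible inputs after repetition `ι`. -/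
def cand (w : ℕ → ℕ) (ι k : ℕ) : ℕ :=
  if k = 0 then c.vec (c.bas w ι) c.n
  else c.vec (c.bas w ι) c.n ^^^ c.vec (c.bas w ι) (search (fun i => c.vec (c.bas w ι) i ≠ 0) c.n)

/-- A position where the two possible inputs differ. -/
def idx (w : ℕ → ℕ) (ι : ℕ) : ℕ := search (fun i => bit (c.cand w ι 0) i ≠ bit (c.cand w ι 1) i) c.n

/-- Bob's state is `16 * t + g` while both possible counters of Alice are known to have reached `t`,
`16 * t + 4 + 2 * p + g` once they are known to differ, with parities `p` and `1 - p`, and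
`16 * t + 8 + 2 * k` once the input is known to be candidate `k`. Here `g` is the last bit that
arrived since Bob asked for a bit. `par` is the parity of the counter of candidate `k`. -/
def par (S k : ℕ) : ℕ :=
  if S / 4 % 4 = 1 then (if k = 0 then S / 2 % 2 else 1 - S / 2 % 2) else S / 16 % 2

/-- Bob is asking for a bit. -/
def Asks (w : ℕ → ℕ) (ι S : ℕ) : Prop := S / 4 % 4 = 1 ∨ S / 16 = c.idx w ι

instance (w : ℕ → ℕ) (ι S : ℕ) : Decidable (c.Asks w ι S) := by
  unfold Asks; infer_instance

/-- The bit that Alice with candidate `k` settles for when Bob asks in state `S`. -/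
def answer (w : ℕ → ℕ) (ι S k : ℕ) : ℕ :=
  if S / 4 % 4 = 1 then par S k else bit (c.cand w ι k) (c.idx w ι)

/-- The chunk of Alice with candidate `k` if she has not reacted to Bob's symbol in state `S`. -/
def wordU (w : ℕ → ℕ) (ι S j k a : ℕ) : ℕ := c.wb (c.cand w ι k) (par S k) j a

/-- The chunk of Alice with candidate `k` if she has reacted to Bob's symbol in state `S`. -/
def wordM (w : ℕ → ℕ) (ι S j k a : ℕ) : ℕ :=
  if c.Asks w ι S then c.answer w ι S k else c.wb (c.cand w ι k) ((S / 16 + 1) % 2) j a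

/-- The last bit that arrived up to block `j`, given the last one before. -/
def lastBit (w : ℕ → ℕ) (j g : ℕ) : ℕ :=
  iter (fun a r => if w (j * (11 * c.u) + 3 * c.u + a) = 2 then r
    else w (j * (11 * c.u) + 3 * c.u + a)) g (8 * c.u)

/-- Bob's state after block `j` in terms of the candidates that are consistent. -/
def bNext (w : ℕ → ℕ) (ι j S : ℕ) (U M : ℕ → Prop) [DecidablePred U] [DecidablePred M] : ℕ :=
  if S / 4 % 4 = 2 then S
  else if (U 0 ∨ M 0) ∧ ¬ (U 1 ∨ M 1) then 16 * (S / 16) + 8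
  else if (U 1 ∨ M 1) ∧ ¬ (U 0 ∨ M 0) then 16 * (S / 16) + 10
  else if c.Asks w ι S then S - S % 2 + c.lastBit w j (S % 2)
  else if (M 0 ∧ M 1) ∧ ¬ (U 0 ∨ U 1) then 16 * (S / 16 + 1)
  else if (U 0 ∧ M 1) ∧ ¬ (M 0 ∨ U 1) then 16 * (S / 16) + 4 + 2 * (S / 16 % 2)
  else if (M 0 ∧ U 1) ∧ ¬ (U 0 ∨ M 1) then 16 * (S / 16) + 4 + 2 * ((S / 16 + 1) % 2)
  else S

def bStep (w : ℕ → ℕ) (ι j S : ℕ) : ℕ :=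
  c.bNext w ι j S (fun k => c.fits w j (c.wordU w ι S j k)) (fun k => c.fits w j (c.wordM w ι S j k))

/-- Bob's state before block `J`, if repetition `ι` of the code has left two possible inputs. -/
def bSt (w : ℕ → ℕ) (ι J : ℕ) : ℕ :=
  iter (fun j S => if (ι + 1) * c.len ≤ j then c.bStep w ι j S else S) 0 J

/-- Bob's symbol in state `S`. -/
def bSym (w : ℕ → ℕ) (ι S : ℕ) : ℕ :=
  if S / 4 % 4 = 1 then 3 else if S / 4 % 4 = 2 then 0
  else if S / 16 = c.idx w ι then 2 else (S / 16 + 1) % 2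

/-- The first repetition below `b` that leaves at most two possible inputs. -/
def sel (w : ℕ → ℕ) (b : ℕ) : ℕ := search (fun ι => c.Narrow w ι ∧ ∀ ι' < ι, ¬ c.Narrow w ι') b

/-- Bob's symbol in block `j`. -/
def bobSym (w : ℕ → ℕ) (j : ℕ) : ℕ :=
  if ∃ ι < j / c.len, c.Narrow w ι then
    c.bSym w (c.sel w (j / c.len)) (c.bSt w (c.sel w (j / c.len)) j)
  else 0

/-- The candidate that Bob believes in at the end. -/
def verdict (w : ℕ → ℕ) (ι S : ℕ) : ℕ :=
  if S / 4 % 4 = 2 then S / 2 % 2 else if c.answer w ι S 0 = S % 2 then 0 else 1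

/-- Bob's output. -/
def out (w : ℕ → ℕ) : ℕ :=
  if ∃ ι < c.K, c.Narrow w ι then
    c.cand w (c.sel w c.K) (c.verdict w (c.sel w c.K) (c.bSt w (c.sel w c.K) c.blocks))
  else 0

end Scheme

/-! ## Hadamard codes -/

/-- The value at `a` of the linear form with coefficients `d`. -/
def dot (L : ℕ) (d : ℕ → ℕ) (a : ℕ) : ℕ := (∑ q ∈ Finset.range L, bit a q * d q) % 2

theorem bit_two_pow (q i : ℕ) : bit (2 ^ q) i = if i = q then 1 else 0 := by
  rw [bit_eq_testBit, Nat.testBit_two_pow]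
  by_cases h : i = q
  · simp [h]
  · simp [h, Ne.symm h]

theorem dot_xor {L : ℕ} (d : ℕ → ℕ) (a a' : ℕ) :
    dot L d (a ^^^ a') = (dot L d a + dot L d a') % 2 := by
  unfold dot
  induction L with
  | zero => simp
  | succ L ih =>
    rw [Finset.sum_range_succ, Finset.sum_range_succ, Finset.sum_range_succ, bit_xor]
    have h1 := bit_lt_two a L
    have h2 := bit_lt_two a' L
    generalize bit a L = x at *
    generalize bit a' L = y at *
    interval_cases x <;> interval_cases y <;> simp <;> omega

theorem dot_two_pow {L q : ℕ} (d : ℕ → ℕ) (hq : q < L) : dot L d (2 ^ q) = d q % 2 := by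
  unfold dot
  rw [Finset.sum_eq_single_of_mem q (Finset.mem_range.mpr hq)]
  · simp [bit_two_pow]
  · intro i _ hi
    simp [bit_two_pow, hi]

theorem dot_add {L : ℕ} (d d' : ℕ → ℕ) (a : ℕ) :
    dot L (fun q => d q + d' q) a = (dot L d a + dot L d' a) % 2 := by
  unfold dot
  simp only [mul_add, Finset.sum_add_distrib]
  omega

theorem dot_lt_two (L : ℕ) (d : ℕ → ℕ) (a : ℕ) : dot L d a < 2 := Nat.mod_lt _ (by norm_num)

/-- Flipping a bit whose coefficient is odd is an involution that exchanges the two values of the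
form. -/
theorem card_dot_eq {L : ℕ} {d : ℕ → ℕ} (hd : ∃ q < L, d q % 2 = 1) {β : ℕ} (hβ : β < 2) :
    2 * ({a ∈ Finset.range (2 ^ L) | dot L d a = β} : Finset ℕ).card = 2 ^ L := by
  obtain ⟨q, hq, hdq⟩ := hd
  have hlt : ∀ a < 2 ^ L, a ^^^ 2 ^ q < 2 ^ L := fun a ha =>
    Nat.xor_lt_two_pow ha (Nat.pow_lt_pow_right (by norm_num) hq)
  have hflip : ∀ a, dot L d (a ^^^ 2 ^ q) = (dot L d a + 1) % 2 := fun a => by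
    rw [dot_xor, dot_two_pow d hq, hdq]
  have heq : ({a ∈ Finset.range (2 ^ L) | dot L d a = β} : Finset ℕ).card =
      ({a ∈ Finset.range (2 ^ L) | ¬ dot L d a = β} : Finset ℕ).card := by
    refine Finset.card_bij' (fun a _ => a ^^^ 2 ^ q) (fun a _ => a ^^^ 2 ^ q) ?_ ?_ ?_ ?_
    · intro a ha
      simp only [Finset.mem_filter, Finset.mem_range] at ha ⊢
      refine ⟨hlt a ha.1, ?_⟩
      rw [hflip]; omega
    · intro a ha
      simp only [Finset.mem_filter, Finset.mem_range] at ha ⊢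
      refine ⟨hlt a ha.1, ?_⟩
      have := dot_lt_two L d a
      rw [hflip]; omega
    · intro a _; simp
    · intro a _; simp
  have := Finset.card_filter_add_card_filter_not (s := Finset.range (2 ^ L)) (fun a => dot L d a = β)
  rw [Finset.card_range] at this
  omega

theorem card_dot_eq_dot {L : ℕ} {d d' : ℕ → ℕ} (hd : ∃ q < L, d q % 2 ≠ d' q % 2) :
    2 * ({a ∈ Finset.range (2 ^ L) | dot L d a = dot L d' a} : Finset ℕ).card = 2 ^ L := by
  have h := card_dot_eq (L := L) (d := fun q => d q + d' q) (β := 0)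
    (by obtain ⟨q, hq, h⟩ := hd; exact ⟨q, hq, by omega⟩) (by norm_num)
  rw [Finset.filter_congr (q := fun a => dot L (fun q => d q + d' q) a = 0)]
  · exact h
  intro a _
  have := dot_lt_two L d a
  have := dot_lt_two L d' a
  rw [dot_add]; omega

/-- Of three bits, either exactly one pair or all three pairs agree. Summed over all positions this
expresses the number of triple agreements through the three pairwise ones, each of which is one
half. -/
theorem card_dot_eq_dot_eq_dot {L : ℕ} {d d' d'' : ℕ → ℕ} (h1 : ∃ q < L, d q % 2 ≠ d' q % 2)
    (h2 : ∃ q < L, d q % 2 ≠ d'' q % 2) (h3 : ∃ q < L, d' q % 2 ≠ d'' q % 2) :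
    4 * ({a ∈ Finset.range (2 ^ L) | dot L d a = dot L d' a ∧ dot L d a = dot L d'' a} :
      Finset ℕ).card = 2 ^ L := by
  have e1 := card_dot_eq_dot h1
  have e2 := card_dot_eq_dot h2
  have e3 := card_dot_eq_dot h3
  have key : ({a ∈ Finset.range (2 ^ L) | dot L d a = dot L d' a} : Finset ℕ).card +
      ({a ∈ Finset.range (2 ^ L) | dot L d a = dot L d'' a} : Finset ℕ).card +
      ({a ∈ Finset.range (2 ^ L) | dot L d' a = dot L d'' a} : Finset ℕ).card =
      2 ^ L + 2 * ({a ∈ Finset.range (2 ^ L) | dot L d a = dot L d' a ∧ dot L d a = dot L d'' a} :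
      Finset ℕ).card := by
    have h4 : 2 ^ L = ∑ a ∈ Finset.range (2 ^ L), 1 := by simp
    conv_rhs => lhs; rw [h4]
    simp only [Finset.card_filter, ← Finset.sum_add_distrib, Finset.mul_sum]
    refine Finset.sum_congr rfl fun a _ => ?_
    have := dot_lt_two L d a
    have := dot_lt_two L d' a
    have := dot_lt_two L d'' a
    split_ifs <;> omega
  omega

namespace Scheme

variable (c : Scheme)

theorem u_pos : 0 < c.u := by unfold u; positivity

theorem eight_u : 8 * c.u = 2 ^ (c.v + 3) := by rw [u, pow_add]; ring

/-- The coefficients of Alice's chunk as a linear form. -/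
def coef (X p j : ℕ) : ℕ → ℕ
  | 0 => 1
  | 1 => p
  | i + 2 => c.sy X (j % c.len) i

/-- The constant coefficient `1` at bit `0` keeps the form nonzero whatever the input and the parity
are; this separates every counting chunk from both constant answers. -/
theorem wb_eq_dot (X p j a : ℕ) : c.wb X p j a = dot (c.v + 3) (c.coef X p j) a := by
  rw [wb, lin, dot]
  conv_rhs => rw [Finset.sum_range_succ', Finset.sum_range_succ']
  simp only [coef, mul_one]
  change _ = (∑ i ∈ Finset.range (c.v + 1), bit a (i + 2) * c.sy X (j % c.len) i + bit a 1 * p +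
    bit a 0) % 2
  omega

theorem wb_lt_two (X p j a : ℕ) : c.wb X p j a < 2 := Nat.mod_lt _ (by norm_num)

/-- The number of bits of Alice in block `j` that are erased in the view `w` of Bob. -/
def costA (w : ℕ → ℕ) (j : ℕ) : ℕ :=
  ({a ∈ Finset.range (8 * c.u) | w (j * (11 * c.u) + 3 * c.u + a) = 2} : Finset ℕ).card

/-- The number of bits of Bob in block `j` that are erased in the view `w` of Alice. -/
def costB (w : ℕ → ℕ) (j : ℕ) : ℕ :=
  ({y ∈ Finset.range (3 * c.u) | w (j * (11 * c.u) + y) = 2} : Finset ℕ).card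

variable {c} {w : ℕ → ℕ} {j : ℕ}

/-- The positions that arrive lie in `P`, so everything outside `P` has been erased. With `P` the
set where several consistent words agree, this turns distances into costs. -/
theorem le_costA_add {P : ℕ → Prop} [DecidablePred P]
    (h : ∀ a < 8 * c.u, w (j * (11 * c.u) + 3 * c.u + a) ≠ 2 → P a) :
    8 * c.u ≤ c.costA w j + ({a ∈ Finset.range (8 * c.u) | P a} : Finset ℕ).card := by
  have := Finset.card_filter_add_card_filter_not (s := Finset.range (8 * c.u))
    (fun a => w (j * (11 * c.u) + 3 * c.u + a) = 2)
  rw [Finset.card_range] at this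
  have h2 : ({a ∈ Finset.range (8 * c.u) | ¬ w (j * (11 * c.u) + 3 * c.u + a) = 2} :
      Finset ℕ).card ≤ ({a ∈ Finset.range (8 * c.u) | P a} : Finset ℕ).card := by
    refine Finset.card_le_card fun a ha => ?_
    simp only [Finset.mem_filter, Finset.mem_range] at ha ⊢
    exact ⟨ha.1, h a ha.1 ha.2⟩
  unfold costA
  omega

theorem costA_wb_wb {X p Y q : ℕ} (h1 : c.fits w j (c.wb X p j)) (h2 : c.fits w j (c.wb Y q j))
    (hne : ∃ i < c.v + 3, c.coef X p j i % 2 ≠ c.coef Y q j i % 2) : 4 * c.u ≤ c.costA w j := by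
  have := le_costA_add (c := c) (w := w) (j := j)
    (P := fun a => dot (c.v + 3) (c.coef X p j) a = dot (c.v + 3) (c.coef Y q j) a) (by
      intro a ha hw
      rw [← wb_eq_dot, ← wb_eq_dot, ← (h1 a ha).resolve_left hw, ← (h2 a ha).resolve_left hw])
  have h3 := card_dot_eq_dot hne
  rw [← eight_u] at h3
  omega

theorem costA_wb_const {X p β : ℕ} (h1 : c.fits w j (c.wb X p j)) (h2 : c.fits w j fun _ => β)
    (hβ : β < 2) : 4 * c.u ≤ c.costA w j := by
  have := le_costA_add (c := c) (w := w) (j := j)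
    (P := fun a => dot (c.v + 3) (c.coef X p j) a = β) (by
      intro a ha hw
      rw [← wb_eq_dot]
      exact ((h1 a ha).resolve_left hw).symm.trans ((h2 a ha).resolve_left hw))
  have h3 := card_dot_eq (L := c.v + 3) (d := c.coef X p j) ⟨0, by omega, rfl⟩ hβ
  rw [← eight_u] at h3
  omega

theorem costA_const_const {β β' : ℕ} (h1 : c.fits w j fun _ => β) (h2 : c.fits w j fun _ => β')
    (hβ : β ≠ β') : 8 * c.u ≤ c.costA w j := by
  have := le_costA_add (c := c) (w := w) (j := j) (P := fun _ => False) (by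
    intro a ha hw
    exact hβ (((h1 a ha).resolve_left hw).symm.trans ((h2 a ha).resolve_left hw)))
  simpa using this

theorem costA_wb_wb_wb {X p Y q Z r : ℕ} (h1 : c.fits w j (c.wb X p j))
    (h2 : c.fits w j (c.wb Y q j)) (h3 : c.fits w j (c.wb Z r j))
    (hXY : ∃ i < c.v + 3, c.coef X p j i % 2 ≠ c.coef Y q j i % 2)
    (hXZ : ∃ i < c.v + 3, c.coef X p j i % 2 ≠ c.coef Z r j i % 2)
    (hYZ : ∃ i < c.v + 3, c.coef Y q j i % 2 ≠ c.coef Z r j i % 2) : 6 * c.u ≤ c.costA w j := by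
  have := le_costA_add (c := c) (w := w) (j := j)
    (P := fun a => dot (c.v + 3) (c.coef X p j) a = dot (c.v + 3) (c.coef Y q j) a ∧
      dot (c.v + 3) (c.coef X p j) a = dot (c.v + 3) (c.coef Z r j) a) (by
      intro a ha hw
      rw [← wb_eq_dot, ← wb_eq_dot, ← wb_eq_dot, ← (h1 a ha).resolve_left hw,
        ← (h2 a ha).resolve_left hw, ← (h3 a ha).resolve_left hw]
      exact ⟨rfl, rfl⟩)
  have h4 := card_dot_eq_dot_eq_dot hXY hXZ hYZ
  rw [← eight_u] at h4
  omega

/-- Each group of three positions runs through the three nonzero linear forms on pairs of bits, and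
exactly one of them vanishes on the nonzero vector `z + z'`. -/
theorem card_had_eq {z z' : ℕ} (hz : z < 4) (hz' : z' < 4) (hne : z ≠ z') (k : ℕ) :
    ({y ∈ Finset.range (3 * k) | had (y % 3 + 1) z = had (y % 3 + 1) z'} : Finset ℕ).card = k := by
  rw [Finset.card_filter, mul_comm, sum_range_mul]
  have h : ∀ e ∈ Finset.range k, ∑ r ∈ Finset.range 3,
      (if had ((e * 3 + r) % 3 + 1) z = had ((e * 3 + r) % 3 + 1) z' then 1 else 0) = 1 := by
    intro e _
    have h2 : ∀ r ∈ Finset.range 3, (if had ((e * 3 + r) % 3 + 1) z = had ((e * 3 + r) % 3 + 1) z'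
        then 1 else 0) = if had (r + 1) z = had (r + 1) z' then 1 else 0 := by
      intro r hr
      rw [show (e * 3 + r) % 3 = r by have := Finset.mem_range.mp hr; omega]
    rw [Finset.sum_congr rfl h2]
    interval_cases z <;> interval_cases z' <;> first | exact absurd rfl hne | decide
  rw [Finset.sum_congr rfl h]
  simp

/-- Alice decodes Bob's symbol correctly if fewer than two thirds of it are erased. -/
theorem unique_of_costB {z : ℕ} (hz : z < 4) (h : c.bobFits w j z) (hc : c.costB w j < 2 * c.u) :
    c.Unique w j := by
  have key : ∀ z' < 4, c.bobFits w j z' → z' = z := by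
    intro z' hz' h'
    by_contra hne
    have h1 := Finset.card_filter_add_card_filter_not (s := Finset.range (3 * c.u))
      (fun y => w (j * (11 * c.u) + y) = 2)
    rw [Finset.card_range] at h1
    have h2 : ({y ∈ Finset.range (3 * c.u) | ¬ w (j * (11 * c.u) + y) = 2} : Finset ℕ).card ≤
        ({y ∈ Finset.range (3 * c.u) | had (y % 3 + 1) z = had (y % 3 + 1) z'} : Finset ℕ).card := by
      refine Finset.card_le_card fun y hy => ?_
      simp only [Finset.mem_filter, Finset.mem_range] at hy ⊢
      exact ⟨hy.1, ((h y hy.1).resolve_left hy.2).symm.trans ((h' y hy.1).resolve_left hy.2)⟩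
    rw [card_had_eq hz hz' (Ne.symm hne)] at h2
    unfold costB at hc
    omega
  have hd := (search_spec (p := c.bobFits w j) ⟨z, hz, h⟩)
  intro z' hz' h'
  exact (key z' hz' h').trans (key _ hd.1 hd.2).symm

/-- The true symbol always fits an erased word, so Alice either decodes it or finds an ambiguity.
She never acts on a wrong symbol, and an ambiguity costs `2 * u`. -/
theorem aStep_cases {X S z : ℕ} (hz : z < 4) (h : c.bobFits w j z) (hS : S / 2 % 2 = 0) :
    c.aStep X w j S = react X z S ∨ (c.aStep X w j S = S ∧ 2 * c.u ≤ c.costB w j) := by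
  unfold aStep
  by_cases hu : c.Unique w j
  · left
    rw [if_pos ⟨hS, hu⟩, ← hu z hz h]
  · right
    rw [if_neg fun h => hu h.2]
    refine ⟨rfl, ?_⟩
    by_contra hc
    exact hu (unique_of_costB hz h (by omega))

end Scheme

end RAM

/-! ## Narrowing the input down to two candidates -/

namespace RAM

theorem sum_digits_lt {B : ℕ} {g : ℕ → ℕ} {k : ℕ} (hg : ∀ i < k, g i < B) :
    ∑ i ∈ Finset.range k, g i * B ^ i < B ^ k := by
  induction k with
  | zero => simp
  | succ k ih =>
    rw [Finset.sum_range_succ, pow_succ]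
    have h1 := ih fun i hi => hg i (by omega)
    have h2 := Nat.mul_le_mul_right (B ^ k) (Nat.succ_le_of_lt (hg k (by omega)))
    rw [Nat.succ_mul] at h2
    rw [mul_comm (B ^ k) B]
    omega

theorem sum_digits_div_mod {B : ℕ} {g : ℕ → ℕ} {k l : ℕ} (hg : ∀ i < k, g i < B) (hl : l < k) :
    (∑ i ∈ Finset.range k, g i * B ^ i) / B ^ l % B = g l := by
  have hB : 0 < B := by have := hg l hl; omega
  induction k with
  | zero => omega
  | succ k ih =>
    rw [Finset.sum_range_succ]
    rcases Nat.lt_succ_iff_lt_or_eq.mp hl with h | rfl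
    · obtain ⟨r, rfl⟩ : ∃ r, k = l + 1 + r := ⟨k - l - 1, by omega⟩
      rw [show g (l + 1 + r) * B ^ (l + 1 + r) = B ^ l * (B * (g (l + 1 + r) * B ^ r)) by ring,
        Nat.add_mul_div_left _ _ (by positivity), Nat.add_mul_mod_self_left]
      exact ih (fun i hi => hg i (by omega)) h
    · rw [Nat.add_mul_div_right _ _ (by positivity),
        Nat.div_eq_of_lt (sum_digits_lt fun i hi => hg i (by omega)), zero_add,
        Nat.mod_eq_of_lt (hg l hl)]

/-- The sum, over the two-element field, of those `f i` with `t i = 1`. -/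
def comb (t f : ℕ → ℕ) : ℕ → ℕ
  | 0 => 0
  | k + 1 => comb t f k ^^^ (if t k = 1 then f k else 0)

theorem comb_congr {t f g : ℕ → ℕ} : ∀ {k : ℕ}, (∀ i < k, f i = g i) → comb t f k = comb t g k
  | 0, _ => rfl
  | k + 1, h => by
    rw [comb, comb, comb_congr (k := k) fun i hi => h i (by omega), h k (by omega)]

theorem comb_bit {X n : ℕ} (hX : X < 2 ^ n) : comb (bit X) (fun i => 2 ^ i) n = X := by
  have h : ∀ k b, bit (comb (bit X) (fun i => 2 ^ i) k) b = if b < k then bit X b else 0 := by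
    intro k b
    induction k with
    | zero => simp [comb, bit]
    | succ k ih =>
      rw [comb, bit_xor, ih]
      have := bit_lt_two X b
      by_cases hb : b = k
      · subst hb
        by_cases h1 : bit X b = 1
        · simp [h1, bit_two_pow]
        · have : bit X b = 0 := by omega
          rw [if_neg (by omega), if_neg (by omega), if_pos (by omega), this]
          simp [bit]
      · have h2 : bit (if bit X k = 1 then 2 ^ k else 0) b = 0 := by
          split_ifs
          · simp [bit_two_pow, hb]
          · simp [bit]
        rw [h2]
        by_cases h3 : b < k
        · rw [if_pos h3, if_pos (by omega)]; omega
        · rw [if_neg h3, if_neg (by omega)]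
  refine Nat.eq_of_testBit_eq fun i => ?_
  have h1 := h n i
  have h2 : bit X i = if i < n then bit X i else 0 := by
    split_ifs with hi
    · rfl
    · exact bit_of_lt hX (by omega)
  rw [← h2, bit_eq_testBit, bit_eq_testBit] at h1
  cases hx : (comb (bit X) (fun i => 2 ^ i) n).testBit i <;> cases hy : X.testBit i <;> simp_all

theorem comb_of_single {t f : ℕ → ℕ} {k l : ℕ} (h : ∀ i < k, i ≠ l → f i = 0) :
    comb t f k = if l < k ∧ t l = 1 then f l else 0 := by
  induction k with
  | zero => simp [comb]
  | succ k ih =>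
    rw [comb, ih fun i hi => h i (by omega)]
    by_cases hk : k = l
    · subst hk
      simp
    · rw [h k (by omega) hk]
      have : (l < k + 1) ↔ (l < k) := by omega
      simp [this]

namespace Scheme

/-- The encoder is linear, and nonzero codewords have at most `zm` vanishing symbols. -/
structure Valid (c : Scheme) (zm : ℕ) : Prop where
  sy_xor : ∀ X Y j i, c.sy (X ^^^ Y) j i = (c.sy X j i + c.sy Y j i) % 2
  card_zeros_le : ∀ X < 2 ^ c.n, X ≠ 0 →
    ({j ∈ Finset.range c.len | ∀ i < c.v + 1, c.sy X j i = 0} : Finset ℕ).card ≤ zm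
  len_pos : 0 < c.len

variable {c : Scheme} {zm : ℕ}

theorem vec_lt (B i : ℕ) : c.vec B i < 2 ^ c.n := Nat.mod_lt _ (by positivity)

theorem vec_pack {g : ℕ → ℕ} (hg : ∀ i < c.n + 1, g i < 2 ^ c.n) {i : ℕ} (hi : i < c.n + 1) :
    c.vec (c.pack g) i = g i := by
  unfold vec pack
  simp only [pow_mul]
  exact sum_digits_div_mod hg hi

theorem lin_lt_two (X j a : ℕ) : c.lin X j a < 2 := Nat.mod_lt _ (by norm_num)

theorem lin_xor (hc : c.Valid zm) (X Y j a : ℕ) :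
    c.lin (X ^^^ Y) j a = (c.lin X j a + c.lin Y j a) % 2 := by
  unfold lin
  simp only [hc.sy_xor]
  generalize c.v + 1 = k
  induction k with
  | zero => simp
  | succ k ih =>
    rw [Finset.sum_range_succ, Finset.sum_range_succ, Finset.sum_range_succ]
    have := bit_lt_two a (k + 2)
    generalize bit a (k + 2) = x at *
    interval_cases x <;> simp <;> omega

theorem lin_zero (hc : c.Valid zm) (j a : ℕ) : c.lin 0 j a = 0 := by
  have := lin_xor hc 0 0 j a
  rw [Nat.xor_self] at this
  omega

/-- Adding `V` to every vector on which the functional is one adds `V` to the combination once for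
each such vector selected, that is, according to the value of the functional on the combination. -/
theorem comb_update (hc : c.Valid zm) (t f : ℕ → ℕ) (V j a k : ℕ) :
    comb t (fun i => if c.lin (f i) j a = 1 then f i ^^^ V else f i) k =
      comb t f k ^^^ (if c.lin (comb t f k) j a = 1 then V else 0) := by
  induction k with
  | zero => simp [comb, lin_zero hc]
  | succ k ih =>
    rw [comb, comb, ih]
    have h1 := lin_lt_two (c := c) (f k) j a
    have h2 := lin_lt_two (c := c) (comb t f k) j a
    by_cases ht : t k = 1
    · simp only [ht, if_true, lin_xor hc]
      generalize comb t f k = x at *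
      generalize f k = y at *
      by_cases h3 : c.lin y j a = 1 <;> by_cases h4 : c.lin x j a = 1
      · simp only [h3, h4, if_true]
        rw [if_neg (by norm_num), Nat.xor_zero, Nat.xor_comm y V, ← Nat.xor_assoc,
          Nat.xor_assoc x V V, Nat.xor_self, Nat.xor_zero]
      · have h5 : c.lin x j a = 0 := by omega
        simp [h3, h5, Nat.xor_assoc]
      · have h5 : c.lin y j a = 0 := by omega
        simp only [h4, h5, if_true]
        simp only [Nat.zero_ne_one, if_false]
        rw [Nat.xor_assoc, Nat.xor_comm V y, ← Nat.xor_assoc]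
      · have h5 : c.lin y j a = 0 := by omega
        have h6 : c.lin x j a = 0 := by omega
        simp [h5, h6]
    · simp [ht]

/-- What the stored affine space satisfies after `τ` received symbols, if the input is `X`. -/
structure SpaceInv (c : Scheme) (w : ℕ → ℕ) (ι X τ B : ℕ) : Prop where
  repr : X = c.vec B c.n ^^^ comb (bit X) (c.vec B) c.n
  live : ∀ i < c.n, ∀ l < c.n, c.vec B i ≠ 0 → c.vec B l ≠ 0 →
    bit (c.vec B l) i = if i = l then 1 else 0
  zero : ∀ τ' < τ,
    w ((ι * c.len + τ' / (8 * c.u)) * (11 * c.u) + 3 * c.u + τ' % (8 * c.u)) ≠ 2 →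
    ∀ i < c.n, c.lin (c.vec B i) (ι * c.len + τ' / (8 * c.u)) (τ' % (8 * c.u)) = 0

theorem newVec_lt (B j a r i : ℕ) : c.newVec B j a r i < 2 ^ c.n := by
  unfold newVec
  split_ifs
  · exact Nat.xor_lt_two_pow (vec_lt _ _) (vec_lt _ _)
  · exact vec_lt _ _

theorem newVec_of_lt {B j a r i : ℕ} (hi : i < c.n) : c.newVec B j a r i =
    if c.lin (c.vec B i) j a = 1 then c.vec B i ^^^ c.vec B (c.pivot B j a) else c.vec B i := by
  simp [newVec, hi]

theorem newVec_top (B j a r : ℕ) : c.newVec B j a r c.n =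
    if c.lin (c.vec B c.n) j a ≠ (r + bit a 0) % 2 then
      c.vec B c.n ^^^ c.vec B (c.pivot B j a) else c.vec B c.n := by
  simp [newVec]

/-- One step of Gaussian elimination. The vectors are kept so that the coefficient of vector number
`i` in the representation of `X` is always the `i`-th bit of `X` itself; no bookkeeping of
coefficients is needed, and the pivot simply becomes zero. -/
theorem spaceInv_step (hc : c.Valid zm) {w : ℕ → ℕ} {ι X τ B : ℕ} (h : SpaceInv c w ι X τ B)
    (hw : w ((ι * c.len + τ / (8 * c.u)) * (11 * c.u) + 3 * c.u + τ % (8 * c.u)) ≠ 2 →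
      w ((ι * c.len + τ / (8 * c.u)) * (11 * c.u) + 3 * c.u + τ % (8 * c.u)) =
        c.wb X 0 (ι * c.len + τ / (8 * c.u)) (τ % (8 * c.u))) :
    SpaceInv c w ι X (τ + 1) (c.basStep w ι τ B) := by
  unfold basStep
  set j := ι * c.len + τ / (8 * c.u) with hj
  set a := τ % (8 * c.u) with ha
  split_ifs with h2
  · refine ⟨h.repr, h.live, fun τ' hτ' hw' => ?_⟩
    rcases Nat.lt_succ_iff_lt_or_eq.mp hτ' with h3 | rfl
    · exact h.zero τ' h3 hw'
    · exact absurd h2 hw'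
  specialize hw h2
  set r := w (j * (11 * c.u) + 3 * c.u + a) with hr
  have hv : ∀ i < c.n + 1, c.vec (c.pack (c.newVec B j a r)) i = c.newVec B j a r i := fun i hi =>
    vec_pack (fun _ _ => newVec_lt _ _ _ _ _) hi
  have hv' : ∀ i < c.n, c.vec (c.pack (c.newVec B j a r)) i =
      if c.lin (c.vec B i) j a = 1 then c.vec B i ^^^ c.vec B (c.pivot B j a) else c.vec B i :=
    fun i hi => by rw [hv i (by omega), newVec_of_lt hi]
  have hpiv : ∀ i < c.n, c.lin (c.vec B i) j a = 1 →
      c.pivot B j a < c.n ∧ c.lin (c.vec B (c.pivot B j a)) j a = 1 := fun i hi h1 =>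
    search_spec (p := fun i => c.lin (c.vec B i) j a = 1) ⟨i, hi, h1⟩
  refine ⟨?_, ?_, ?_⟩
  -- As `X` satisfies the new equation, the point and the combination of the vectors violate it
  -- together or not at all. So both or neither change by the pivot, and their sum stays `X`.
  · rw [hv c.n (by omega), newVec_top, comb_congr hv', comb_update hc]
    have hl := lin_xor hc (c.vec B c.n) (comb (bit X) (c.vec B) c.n) j a
    rw [← h.repr] at hl
    have h3 : (r + bit a 0) % 2 = c.lin X j a := by
      rw [hw, wb]
      have := lin_lt_two (c := c) X j a
      omega
    rw [h3]
    have h4 := lin_lt_two (c := c) (c.vec B c.n) j a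
    have h5 := lin_lt_two (c := c) (comb (bit X) (c.vec B) c.n) j a
    by_cases h6 : c.lin (comb (bit X) (c.vec B) c.n) j a = 1
    · rw [if_pos (by omega), if_pos h6]
      nth_rewrite 1 [h.repr]
      rw [Nat.xor_assoc, Nat.xor_comm (c.vec B (c.pivot B j a)), Nat.xor_assoc, Nat.xor_self,
        Nat.xor_zero]
    · rw [if_neg (by omega), if_neg h6, Nat.xor_zero]
      exact h.repr
  · intro i hi l hl hin hln
    -- Once there is a violating vector, the pivot is cleared, so no surviving index is the pivot.
    -- The pivot therefore has bit `0` at all surviving indices, and adding it does not disturb the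
    -- unit pattern there.
    have key : ∀ i < c.n, c.vec (c.pack (c.newVec B j a r)) i ≠ 0 → c.vec B i ≠ 0 ∧
        (∀ l < c.n, c.lin (c.vec B l) j a = 1 → i ≠ c.pivot B j a) := by
      intro i hi hne
      rw [hv' i hi] at hne
      refine ⟨fun h0 => ?_, fun l hl hl1 he => ?_⟩
      · rw [h0, lin_zero hc] at hne
        simp at hne
      · rw [he, if_pos (hpiv l hl hl1).2, Nat.xor_self] at hne
        exact hne rfl
    have h3 := key i hi hin
    have h4 := key l hl hln
    rw [hv' l hl]
    by_cases h5 : c.lin (c.vec B l) j a = 1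
    · have h6 := hpiv l hl h5
      have h7 : c.vec B (c.pivot B j a) ≠ 0 := fun h0 => by
        rw [h0, lin_zero hc] at h6
        omega
      rw [if_pos h5, bit_xor, h.live i hi l hl h3.1 h4.1, h.live i hi _ h6.1 h3.1 h7,
        if_neg (h3.2 l hl h5)]
      split_ifs <;> rfl
    · rw [if_neg h5, h.live i hi l hl h3.1 h4.1]
  · intro τ' hτ' hw' i hi
    rw [hv' i hi]
    rcases Nat.lt_succ_iff_lt_or_eq.mp hτ' with h3 | rfl
    · have h4 := h.zero τ' h3 hw'
      split_ifs with h5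
      · rw [lin_xor hc, h4 i hi, h4 _ (hpiv i hi h5).1]
      · exact h4 i hi
    · rw [← hj, ← ha]
      split_ifs with h5
      · rw [lin_xor hc, h5, (hpiv i hi h5).2]
      · have := lin_lt_two (c := c) (c.vec B i) j a
        omega

theorem spaceInv_bas (hc : c.Valid zm) {w : ℕ → ℕ} {ι X : ℕ} (hX : X < 2 ^ c.n)
    (hw : ∀ j < c.len, c.fits w (ι * c.len + j) (c.wb X 0 (ι * c.len + j))) :
    SpaceInv c w ι X (c.len * (8 * c.u)) (c.bas w ι) := by
  have hu := c.u_pos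
  have h : ∀ τ ≤ c.len * (8 * c.u), SpaceInv c w ι X τ
      (iter (c.basStep w ι) (c.pack fun i => if i < c.n then 2 ^ i else 0) τ) := by
    intro τ
    induction τ with
    | zero =>
      intro _
      have hv : ∀ i < c.n + 1, c.vec (c.pack fun i => if i < c.n then 2 ^ i else 0) i =
          if i < c.n then 2 ^ i else 0 := fun i hi => vec_pack (fun i _ => by
        split_ifs with hi
        · exact Nat.pow_lt_pow_right (by norm_num) hi
        · positivity) hi
      have hv' : ∀ i < c.n, c.vec (c.pack fun i => if i < c.n then 2 ^ i else 0) i = 2 ^ i :=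
        fun i hi => by rw [hv i (by omega), if_pos hi]
      refine ⟨?_, ?_, fun τ' h => by omega⟩
      · rw [iter, hv c.n (by omega), if_neg (by omega), Nat.zero_xor, comb_congr hv', comb_bit hX]
      · intro i hi l hl _ _
        rw [iter, hv' l hl, bit_two_pow]
    | succ τ ih =>
      intro hτ
      refine spaceInv_step hc (ih (by omega)) fun hne => ?_
      have hj : τ / (8 * c.u) < c.len := (Nat.div_lt_iff_lt_mul (by omega)).mpr (by omega)
      exact (hw _ hj _ (Nat.mod_lt _ (by omega))).resolve_left hne
  exact h _ le_rfl

/-- With at most one nonzero direction the combination has at most one term: `X` is the point or the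
point plus that direction. -/
theorem cand_of_narrow (hc : c.Valid zm) {w : ℕ → ℕ} {ι X : ℕ} (hX : X < 2 ^ c.n)
    (hw : ∀ j < c.len, c.fits w (ι * c.len + j) (c.wb X 0 (ι * c.len + j)))
    (hn : c.Narrow w ι) : X = c.cand w ι 0 ∨ X = c.cand w ι 1 := by
  have h := spaceInv_bas hc hX hw
  set B := c.bas w ι with hB
  set l := search (fun i => c.vec B i ≠ 0) c.n with hl
  have hz : ∀ i < c.n, i ≠ l → c.vec B i = 0 := by
    intro i hi hil
    by_contra hne
    have hls : l < c.n ∧ c.vec B l ≠ 0 := search_spec (p := fun i => c.vec B i ≠ 0) ⟨i, hi, hne⟩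
    have h2 : 2 ≤ ∑ i ∈ Finset.range c.n, (if c.vec B i ≠ 0 then 1 else 0) := by
      have h3 : ({i, l} : Finset ℕ) ⊆ Finset.range c.n := by
        intro q hq
        simp only [Finset.mem_insert, Finset.mem_singleton] at hq
        rcases hq with rfl | rfl
        · exact Finset.mem_range.mpr hi
        · exact Finset.mem_range.mpr hls.1
      refine le_trans ?_ (Finset.sum_le_sum_of_subset h3)
      rw [Finset.sum_pair hil, if_pos hne, if_pos hls.2]
    unfold Narrow at hn
    rw [← hB] at hn
    omega
  have h4 := h.repr
  rw [comb_of_single hz] at h4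
  split_ifs at h4 with h5
  · right
    rw [cand, if_neg one_ne_zero]
    exact h4
  · left
    rw [cand, if_pos rfl]
    simpa using h4

theorem cand_lt (w : ℕ → ℕ) (ι k : ℕ) : c.cand w ι k < 2 ^ c.n := by
  unfold cand
  split_ifs
  · exact vec_lt _ _
  · exact Nat.xor_lt_two_pow (vec_lt _ _) (vec_lt _ _)

theorem coef_ne {X Y p q j : ℕ} (hc : c.Valid zm)
    (h : ¬ ∀ i < c.v + 1, c.sy (X ^^^ Y) (j % c.len) i = 0) :
    ∃ i < c.v + 3, c.coef X p j i % 2 ≠ c.coef Y q j i % 2 := by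
  push Not at h
  obtain ⟨i, hi, h⟩ := h
  refine ⟨i + 2, by omega, ?_⟩
  rw [hc.sy_xor] at h
  simp only [coef]
  omega

/-- A direction on which all received homogeneous equations vanish leads from a consistent input to
another consistent input. -/
theorem fits_xor (hc : c.Valid zm) {w : ℕ → ℕ} {X Y p j : ℕ} (h : c.fits w j (c.wb X p j))
    (hY : ∀ a < 8 * c.u, w (j * (11 * c.u) + 3 * c.u + a) ≠ 2 → c.lin Y j a = 0) :
    c.fits w j (c.wb (X ^^^ Y) p j) := by
  intro a ha
  by_cases h2 : w (j * (11 * c.u) + 3 * c.u + a) = 2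
  · exact Or.inl h2
  · right
    rw [(h a ha).resolve_left h2, wb, wb, lin_xor hc, hY a ha h2]
    omega

/-- A repetition of the code that leaves three inputs has cost at least three quarters of Alice's
bits, up to the blocks in which two of the three codewords agree. -/
theorem cost_of_not_narrow (hc : c.Valid zm) {w : ℕ → ℕ} {ι X : ℕ} (hX : X < 2 ^ c.n)
    (hw : ∀ j < c.len, c.fits w (ι * c.len + j) (c.wb X 0 (ι * c.len + j)))
    (hn : ¬ c.Narrow w ι) :
    6 * c.u * c.len ≤ ∑ j ∈ Finset.range c.len, c.costA w (ι * c.len + j) + 6 * c.u * (3 * zm) := by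
  classical
  have hu := c.u_pos
  have h := spaceInv_bas hc hX hw
  set B := c.bas w ι with hB
  obtain ⟨i, hi, l, hl, hil, hi0, hl0⟩ : ∃ i < c.n, ∃ l < c.n, i ≠ l ∧ c.vec B i ≠ 0 ∧
      c.vec B l ≠ 0 := by
    by_contra hcon
    push Not at hcon
    refine hn ?_
    unfold Narrow
    rw [← hB, ← Finset.card_filter, Finset.card_le_one]
    intro a ha b hb
    simp only [Finset.mem_filter, Finset.mem_range] at ha hb
    by_contra hab
    exact hb.2 (hcon a ha.1 b hb.1 hab ha.2)
  -- The two directions differ in bit `i`, which is one in vector `i` and zero in vector `l`.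
  have hne : c.vec B i ^^^ c.vec B l ≠ 0 := by
    intro h0
    have h1 := bit_xor (c.vec B i) (c.vec B l) i
    rw [h0, h.live i hi i hi hi0 hi0, h.live i hi l hl hi0 hl0, if_pos rfl, if_neg hil] at h1
    simp [bit] at h1
  have hfit : ∀ q < c.n, ∀ j < c.len,
      c.fits w (ι * c.len + j) (c.wb (X ^^^ c.vec B q) 0 (ι * c.len + j)) := by
    intro q hq j hj
    refine fits_xor hc (hw j hj) fun a ha h2 => ?_
    have hτ : j * (8 * c.u) + a < c.len * (8 * c.u) := by
      have := Nat.mul_le_mul_right (8 * c.u) (Nat.succ_le_of_lt hj)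
      rw [Nat.succ_mul] at this
      omega
    have e1 : (j * (8 * c.u) + a) / (8 * c.u) = j := by
      rw [mul_comm, Nat.mul_add_div (by omega), Nat.div_eq_of_lt ha, add_zero]
    have e2 : (j * (8 * c.u) + a) % (8 * c.u) = a := by
      rw [mul_comm, Nat.mul_add_mod, Nat.mod_eq_of_lt ha]
    have := h.zero _ hτ (by rw [e1, e2]; exact h2) q hq
    rwa [e1, e2] at this
  let bad : ℕ → ℕ → ℕ := fun Y j => if ∀ i < c.v + 1, c.sy Y j i = 0 then 1 else 0
  have hbad : ∀ Y < 2 ^ c.n, Y ≠ 0 → ∑ j ∈ Finset.range c.len, bad Y j ≤ zm := by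
    intro Y hY hY0
    simp only [bad]
    rw [← Finset.card_filter]
    exact hc.card_zeros_le Y hY hY0
  -- The inputs `X`, `X ^^^ vec B i` and `X ^^^ vec B l` all fit. A block is free only if one of
  -- their three differences has a vanishing symbol there, and this happens at most `3 * zm` times.
  have hblock : ∀ j ∈ Finset.range c.len, 6 * c.u ≤ c.costA w (ι * c.len + j) + 6 * c.u *
      (bad (c.vec B i) j + bad (c.vec B l) j + bad (c.vec B i ^^^ c.vec B l) j) := by
    intro j hj
    have hj := Finset.mem_range.mp hj
    have hmod : (ι * c.len + j) % c.len = j := by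
      rw [mul_comm, Nat.mul_add_mod, Nat.mod_eq_of_lt hj]
    have hone : 1 ≤ bad (c.vec B i) j + bad (c.vec B l) j + bad (c.vec B i ^^^ c.vec B l) j →
        6 * c.u ≤ c.costA w (ι * c.len + j) + 6 * c.u *
          (bad (c.vec B i) j + bad (c.vec B l) j + bad (c.vec B i ^^^ c.vec B l) j) := fun h1 =>
      (Nat.le_mul_of_pos_right _ h1).trans (Nat.le_add_left _ _)
    by_cases b1 : ∀ q < c.v + 1, c.sy (c.vec B i) j q = 0
    · exact hone (by simp only [bad, if_pos b1]; omega)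
    by_cases b2 : ∀ q < c.v + 1, c.sy (c.vec B l) j q = 0
    · exact hone (by simp only [bad, if_pos b2]; omega)
    by_cases b3 : ∀ q < c.v + 1, c.sy (c.vec B i ^^^ c.vec B l) j q = 0
    · exact hone (by simp only [bad, if_pos b3]; omega)
    have hx : ∀ a b : ℕ, X ^^^ a ^^^ (X ^^^ b) = a ^^^ b := by
      intro a b
      rw [Nat.xor_comm X a, Nat.xor_assoc, ← Nat.xor_assoc X X b, Nat.xor_self, Nat.zero_xor]
    have hx' : ∀ a : ℕ, X ^^^ (X ^^^ a) = a := by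
      intro a
      rw [← Nat.xor_assoc, Nat.xor_self, Nat.zero_xor]
    have := costA_wb_wb_wb (hw j hj) (hfit i hi j hj) (hfit l hl j hj)
      (coef_ne hc (by rw [hmod, hx']; exact b1)) (coef_ne hc (by rw [hmod, hx']; exact b2))
      (coef_ne hc (by rw [hmod, hx]; exact b3))
    omega
  have hsum := Finset.sum_le_sum hblock
  rw [Finset.sum_const, Finset.card_range, smul_eq_mul, Finset.sum_add_distrib, ← Finset.mul_sum,
    Finset.sum_add_distrib, Finset.sum_add_distrib] at hsum
  have h1 := hbad _ (vec_lt B i) hi0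
  have h2 := hbad _ (vec_lt B l) hl0
  have h3 := hbad _ (Nat.xor_lt_two_pow (vec_lt B i) (vec_lt B l)) hne
  have h4 : 6 * c.u * (∑ j ∈ Finset.range c.len, bad (c.vec B i) j +
      ∑ j ∈ Finset.range c.len, bad (c.vec B l) j +
      ∑ j ∈ Finset.range c.len, bad (c.vec B i ^^^ c.vec B l) j) ≤ 6 * c.u * (3 * zm) :=
    Nat.mul_le_mul_left _ (by omega)
  rw [mul_comm] at hsum
  omega

end Scheme

end RAM

/-! ## Two candidates -/

namespace RAM

namespace Scheme

variable {c : Scheme} {zm : ℕ} {w : ℕ → ℕ} {ι : ℕ}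

theorem par_lt_two (S k : ℕ) : par S k < 2 := by
  unfold par
  split_ifs <;> omega

theorem answer_lt_two (S k : ℕ) : c.answer w ι S k < 2 := by
  unfold answer
  split_ifs
  · exact par_lt_two _ _
  · exact bit_lt_two _ _

theorem idx_spec (h : c.cand w ι 0 ≠ c.cand w ι 1) : c.idx w ι < c.n ∧
    bit (c.cand w ι 0) (c.idx w ι) ≠ bit (c.cand w ι 1) (c.idx w ι) := by
  refine search_spec (p := fun i => bit (c.cand w ι 0) i ≠ bit (c.cand w ι 1) i) ?_
  by_contra hcon
  push Not at hcon
  exact h (eq_of_bit (cand_lt _ _ _) (cand_lt _ _ _) hcon)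

theorem answer_ne (h : c.cand w ι 0 ≠ c.cand w ι 1) (S : ℕ) :
    c.answer w ι S 0 ≠ c.answer w ι S 1 := by
  unfold answer par
  by_cases h1 : S / 4 % 4 = 1
  · rw [if_pos h1, if_pos h1, if_pos h1, if_pos h1, if_pos rfl, if_neg one_ne_zero]
    omega
  · rw [if_neg h1, if_neg h1]
    exact (idx_spec h).2

theorem par_congr {S S' : ℕ} (h : S' / 2 = S / 2) (k : ℕ) : par S' k = par S k := by
  have h4 : S' / 4 = S / 4 := by omega
  have h16 : S' / 16 = S / 16 := by omega
  simp only [par, h, h4, h16]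

theorem asks_congr {S S' : ℕ} (h : S' / 2 = S / 2) : c.Asks w ι S' ↔ c.Asks w ι S := by
  have h4 : S' / 4 = S / 4 := by omega
  have h16 : S' / 16 = S / 16 := by omega
  simp only [Asks, h4, h16]

theorem answer_congr {S S' : ℕ} (h : S' / 2 = S / 2) (k : ℕ) :
    c.answer w ι S' k = c.answer w ι S k := by
  have h4 : S' / 4 = S / 4 := by omega
  simp only [answer, h4, par_congr h]

/-- The possible inputs differ in the symbol of block `j`. -/
def Good (c : Scheme) (w : ℕ → ℕ) (ι j : ℕ) : Prop :=
  ¬ ∀ i < c.v + 1, c.sy (c.cand w ι 0 ^^^ c.cand w ι 1) (j % c.len) i = 0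

theorem coef_ne_of_good (hc : c.Valid zm) {j k p q : ℕ} (hk : k = 0 ∨ k = 1)
    (hg : c.Good w ι j) :
    ∃ i < c.v + 3, c.coef (c.cand w ι k) p j i % 2 ≠ c.coef (c.cand w ι (1 - k)) q j i % 2 := by
  rcases hk with rfl | rfl
  · exact coef_ne hc hg
  · exact coef_ne hc (by rw [Nat.xor_comm]; exact hg)

theorem coef_ne_of_parity (X : ℕ) {p q j : ℕ} (h : p % 2 ≠ q % 2) :
    ∃ i < c.v + 3, c.coef X p j i % 2 ≠ c.coef X q j i % 2 := ⟨1, by omega, h⟩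

/-- Any chunk of one candidate differs from any chunk of the other in at least half of the
positions: by the code symbol if both count, by the leading coefficient if one counts and the other
answers, and everywhere if both answer. -/
theorem costA_of_both (hc : c.Valid zm) (hx : c.cand w ι 0 ≠ c.cand w ι 1) {S j k : ℕ}
    (hk : k = 0 ∨ k = 1) (hg : c.Good w ι j)
    (h1 : c.fits w j (c.wordU w ι S j k) ∨ c.fits w j (c.wordM w ι S j k))
    (h2 : c.fits w j (c.wordU w ι S j (1 - k)) ∨ c.fits w j (c.wordM w ι S j (1 - k))) :
    4 * c.u ≤ c.costA w j := by
  have hU : ∀ k, c.wordU w ι S j k = c.wb (c.cand w ι k) (par S k) j := fun k => rfl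
  by_cases ha : c.Asks w ι S
  · have hM : ∀ k, c.wordM w ι S j k = fun _ => c.answer w ι S k := fun k => by
      funext a
      exact if_pos ha
    rw [hU, hM] at h1 h2
    rcases h1 with h1 | h1 <;> rcases h2 with h2 | h2
    · exact costA_wb_wb h1 h2 (coef_ne_of_good hc hk hg)
    · exact costA_wb_const h1 h2 (answer_lt_two _ _)
    · exact costA_wb_const h2 h1 (answer_lt_two _ _)
    · refine le_trans (by omega) (costA_const_const h1 h2 ?_)
      rcases hk with rfl | rfl
      · exact answer_ne hx S
      · exact (answer_ne hx S).symm
  · have hM : ∀ k, c.wordM w ι S j k = c.wb (c.cand w ι k) ((S / 16 + 1) % 2) j := fun k => by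
      funext a
      exact if_neg ha
    rw [hU, hM] at h1 h2
    rcases h1 with h1 | h1 <;> rcases h2 with h2 | h2 <;>
      exact costA_wb_wb h1 h2 (coef_ne_of_good hc hk hg)

/-- While Bob counts, the four possible chunks are pairwise distinct: candidates differ in the code
symbol, and the two chunks of one candidate in the parity. The hypotheses say that at least three of
the four fit. -/
theorem costA_of_three (hc : c.Valid zm) {S j k : ℕ} (hk : k = 0 ∨ k = 1) (hg : c.Good w ι j)
    (hS : S / 4 % 4 = 0) (ha : ¬ c.Asks w ι S) (h1 : c.fits w j (c.wordM w ι S j k))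
    (h2 : c.fits w j (c.wordU w ι S j k) ∧
        (c.fits w j (c.wordU w ι S j (1 - k)) ∨ c.fits w j (c.wordM w ι S j (1 - k))) ∨
      c.fits w j (c.wordU w ι S j (1 - k)) ∧ c.fits w j (c.wordM w ι S j (1 - k))) :
    6 * c.u ≤ c.costA w j := by
  have hU : ∀ k, c.wordU w ι S j k = c.wb (c.cand w ι k) (S / 16 % 2) j := fun k => by
    funext a
    rw [wordU, par, if_neg (by omega)]
  have hM : ∀ k, c.wordM w ι S j k = c.wb (c.cand w ι k) ((S / 16 + 1) % 2) j := fun k => by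
    funext a
    exact if_neg ha
  rw [hU, hU, hM] at h2
  rw [hM] at h1
  have hpar : (S / 16 + 1) % 2 % 2 ≠ S / 16 % 2 % 2 := by omega
  rcases h2 with ⟨h2, h3 | h3⟩ | ⟨h2, h3⟩
  · exact costA_wb_wb_wb h1 h2 h3 (coef_ne_of_parity _ hpar) (coef_ne_of_good hc hk hg)
      (coef_ne_of_good hc hk hg)
  · exact costA_wb_wb_wb h1 h2 h3 (coef_ne_of_parity _ hpar) (coef_ne_of_good hc hk hg)
      (coef_ne_of_good hc hk hg)
  · exact costA_wb_wb_wb h1 h2 h3 (coef_ne_of_good hc hk hg) (coef_ne_of_good hc hk hg)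
      (coef_ne_of_parity _ hpar.symm)

/-- Bob's transition as seen by the true candidate `k`, of which some chunk always fits. The last
alternative is the one to fear: he stays although Alice may have moved, and then at least three
chunks fit. -/
theorem bNext_cases {j S k : ℕ} {U M : ℕ → Prop} [DecidablePred U] [DecidablePred M]
    (hS : S / 4 % 4 ≠ 2) (hk : k = 0 ∨ k = 1) (h : U k ∨ M k) :
    (c.bNext w ι j S U M = 16 * (S / 16) + 8 + 2 * k) ∨
    ((U (1 - k) ∨ M (1 - k)) ∧ c.Asks w ι S ∧
      c.bNext w ι j S U M = S - S % 2 + c.lastBit w j (S % 2)) ∨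
    ((U (1 - k) ∨ M (1 - k)) ∧ ¬ c.Asks w ι S ∧
      ((M k ∧ ¬ U k ∧ c.bNext w ι j S U M = 16 * (S / 16 + 1)) ∨
      (U k ∧ ¬ M k ∧ c.bNext w ι j S U M = 16 * (S / 16) + 4 + 2 * ((S / 16 + k) % 2)) ∨
      (M k ∧ ¬ U k ∧ c.bNext w ι j S U M = 16 * (S / 16) + 4 + 2 * ((S / 16 + 1 + k) % 2)) ∨
      (c.bNext w ι j S U M = S ∧
        (M k → U k ∧ (U (1 - k) ∨ M (1 - k)) ∨ U (1 - k) ∧ M (1 - k))))) := by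
  unfold bNext
  by_cases ha : c.Asks w ι S <;> rcases hk with rfl | rfl <;> by_cases u0 : U 0 <;>
    by_cases u1 : U 1 <;> by_cases m0 : M 0 <;> by_cases m1 : M 1 <;>
    (simp [ha, hS, u0, u1, m0, m1] at h ⊢; try omega)

/-- Every bit that arrives from a constant chunk carries the answer, so keeping Bob ignorant costs
all `8 * u` bits. -/
theorem lastBit_of_const {j β g : ℕ} (h : c.fits w j fun _ => β) :
    c.lastBit w j g = β ∨ (c.lastBit w j g = g ∧ c.costA w j = 8 * c.u) := by
  have key : ∀ k ≤ 8 * c.u, iter (fun a r => if w (j * (11 * c.u) + 3 * c.u + a) = 2 then r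
      else w (j * (11 * c.u) + 3 * c.u + a)) g k = β ∨
      (iter (fun a r => if w (j * (11 * c.u) + 3 * c.u + a) = 2 then r
      else w (j * (11 * c.u) + 3 * c.u + a)) g k = g ∧
      ∀ a < k, w (j * (11 * c.u) + 3 * c.u + a) = 2) := by
    intro k
    induction k with
    | zero => intro _; exact Or.inr ⟨rfl, fun a ha => by omega⟩
    | succ k ih =>
      intro hk
      rw [iter]
      split_ifs with h2
      · rcases ih (by omega) with h3 | ⟨h3, h4⟩
        · exact Or.inl h3
        · refine Or.inr ⟨h3, fun a ha => ?_⟩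
          rcases Nat.lt_succ_iff_lt_or_eq.mp ha with h5 | rfl
          · exact h4 a h5
          · exact h2
      · exact Or.inl ((h k (by omega)).resolve_left h2)
  rcases key _ le_rfl with h1 | ⟨h1, h2⟩
  · exact Or.inl h1
  · refine Or.inr ⟨h1, ?_⟩
    unfold costA
    rw [Finset.filter_true_of_mem fun a ha => h2 a (Finset.mem_range.mp ha), Finset.card_range]

theorem lastBit_lt_two {j g : ℕ} {f : ℕ → ℕ} (h : c.fits w j f) (hf : ∀ a, f a < 2) (hg : g < 2) :
    c.lastBit w j g < 2 := by
  have key : ∀ k ≤ 8 * c.u, iter (fun a r => if w (j * (11 * c.u) + 3 * c.u + a) = 2 then r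
      else w (j * (11 * c.u) + 3 * c.u + a)) g k < 2 := by
    intro k
    induction k with
    | zero => intro _; exact hg
    | succ k ih =>
      intro hk
      rw [iter]
      split_ifs with h2
      · exact ih (by omega)
      · rw [(h k (by omega)).resolve_left h2]
        exact hf k
  exact key _ le_rfl

/-- Bob's state `S` is in accordance with Alice's state `A` if her input is candidate `k`; the first
argument measures the progress that was made. -/
inductive Sync (c : Scheme) (w : ℕ → ℕ) (ι k : ℕ) : ℕ → ℕ → ℕ → Prop
  | count {t : ℕ} : t < c.idx w ι → Sync c w ι k (2 * t) (16 * t) (4 * t)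
  | counted {t : ℕ} : t < c.idx w ι → Sync c w ι k (2 * t + 1) (16 * t) (4 * (t + 1))
  | ask {S A : ℕ} : c.Asks w ι S → S / 4 % 4 < 2 → A / 2 % 2 = 0 → A / 4 % 2 = par S k →
      (S / 4 % 4 = 0 → A / 4 = c.idx w ι) → Sync c w ι k (2 * c.n + 2 * (S / 4 % 4)) S A
  | asked {S A : ℕ} : c.Asks w ι S → S / 4 % 4 < 2 → A / 2 % 2 = 1 → A % 2 = c.answer w ι S k →
      Sync c w ι k (2 * c.n + 2 * (S / 4 % 4) + 1) S A
  | answered {S A : ℕ} : c.Asks w ι S → S / 4 % 4 < 2 → A / 2 % 2 = 1 →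
      A % 2 = c.answer w ι S k → S % 2 = c.answer w ι S k → Sync c w ι k (2 * c.n + 4) S A
  | solved {S A : ℕ} : S / 4 % 4 = 2 → S / 2 % 2 = k → Sync c w ι k (2 * c.n + 4) S A

theorem bSym_lt (S : ℕ) : c.bSym w ι S < 4 := by
  unfold bSym
  split_ifs <;> omega

theorem aStep_of_settled {X A j : ℕ} (h : A / 2 % 2 = 1) : c.aStep X w j A = A := by
  unfold aStep
  rw [if_neg (by omega)]

theorem react_of_asks {S A k : ℕ} (ha : c.Asks w ι S) (hS : S / 4 % 4 < 2)
    (hp : A / 4 % 2 = par S k) (hA : S / 4 % 4 = 0 → A / 4 = c.idx w ι) :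
    react (c.cand w ι k) (c.bSym w ι S) A = 4 * (A / 4) + 2 + c.answer w ι S k := by
  unfold bSym react answer
  by_cases h1 : S / 4 % 4 = 1
  · simp [h1, hp]
  · have h0 : S / 4 % 4 = 0 := by omega
    rcases ha with h | h
    · omega
    · simp [h0, h, hA h0]

/-- The case of a block in which Bob asks for a bit and Alice has not yet reacted or has. -/
theorem sync_of_asks {S A j k : ℕ} (hk : k = 0 ∨ k = 1) (ha : c.Asks w ι S) (hS : S / 4 % 4 < 2)
    (hp : A / 2 % 2 = 0 → A / 4 % 2 = par S k ∧ (S / 4 % 4 = 0 → A / 4 = c.idx w ι))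
    (hA : A / 2 % 2 = 1 → A % 2 = c.answer w ι S k)
    (hf : c.fits w j (c.aWord (c.cand w ι k) A j)) :
    Sync c w ι k (2 * c.n + 4) (c.bStep w ι j S) A ∨
    ((c.fits w j (c.wordU w ι S j k) ∨ c.fits w j (c.wordM w ι S j k)) ∧
      (c.fits w j (c.wordU w ι S j (1 - k)) ∨ c.fits w j (c.wordM w ι S j (1 - k))) ∧
      c.bStep w ι j S = S - S % 2 + c.lastBit w j (S % 2) ∧
      Sync c w ι k (2 * c.n + 2 * (S / 4 % 4) + A / 2 % 2) (c.bStep w ι j S) A) := by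
  have hU : A / 2 % 2 = 0 → c.aWord (c.cand w ι k) A j = c.wordU w ι S j k := fun h => by
    funext a
    rw [aWord, if_neg (by omega), (hp h).1]
    rfl
  have hM : A / 2 % 2 = 1 → c.aWord (c.cand w ι k) A j = c.wordM w ι S j k := fun h => by
    funext a
    rw [aWord, if_pos h, wordM, if_pos ha, hA h]
  have hUM : c.fits w j (c.wordU w ι S j k) ∨ c.fits w j (c.wordM w ι S j k) := by
    rcases Nat.mod_two_eq_zero_or_one (A / 2) with h | h
    · exact Or.inl (hU h ▸ hf)
    · exact Or.inr (hM h ▸ hf)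
  have hlt : c.lastBit w j (S % 2) < 2 := by
    refine lastBit_lt_two hf (fun a => ?_) (Nat.mod_lt _ (by norm_num))
    unfold aWord
    split_ifs
    · exact Nat.mod_lt _ (by norm_num)
    · exact c.wb_lt_two _ _ _ _
  unfold bStep
  rcases bNext_cases (S := S) (U := fun k => c.fits w j (c.wordU w ι S j k))
      (M := fun k => c.fits w j (c.wordM w ι S j k)) (by omega) hk hUM with
    h | ⟨h1, -, h⟩ | ⟨-, h1, -⟩
  · left
    rw [h]
    exact .solved (by omega) (by omega)
  · right
    refine ⟨hUM, h1, h, ?_⟩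
    rw [h]
    set S' := S - S % 2 + c.lastBit w j (S % 2) with hS'
    have h2 : S' / 2 = S / 2 := by omega
    have h4 : S' / 4 = S / 4 := by omega
    rw [← h4]
    rcases Nat.mod_two_eq_zero_or_one (A / 2) with h | h
    · rw [h]
      exact .ask ((asks_congr h2).mpr ha) (by omega) h (by rw [par_congr h2]; exact (hp h).1)
        (by rw [h4]; exact (hp h).2)
    · rw [h]
      exact .asked ((asks_congr h2).mpr ha) (by omega) h (by rw [answer_congr h2]; exact hA h)
  · exact absurd ha h1

/-- The case of a block in which Bob counts. -/
theorem sync_of_count (hc : c.Valid zm) {t A j k : ℕ} (hk : k = 0 ∨ k = 1) (ht : t < c.idx w ι)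
    (hA : A = 4 * t ∨ A = 4 * (t + 1)) (hn : c.idx w ι < c.n)
    (hf : c.fits w j (c.aWord (c.cand w ι k) A j)) :
    Sync c w ι k (2 * c.n + 4) (c.bStep w ι j (16 * t)) A ∨
    ((c.fits w j (c.wordU w ι (16 * t) j k) ∨ c.fits w j (c.wordM w ι (16 * t) j k)) ∧
      (c.fits w j (c.wordU w ι (16 * t) j (1 - k)) ∨
        c.fits w j (c.wordM w ι (16 * t) j (1 - k))) ∧
      ∃ φ, Sync c w ι k φ (c.bStep w ι j (16 * t)) A ∧ (2 * t + 1 < φ ∨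
        φ = 2 * t ∧ A = 4 * t ∨
        φ = 2 * t + 1 ∧ A = 4 * (t + 1) ∧ (c.Good w ι j → 6 * c.u ≤ c.costA w j))) := by
  have hna : ¬ c.Asks w ι (16 * t) := by
    unfold Asks
    omega
  have hmode : 16 * t / 4 % 4 = 0 := by omega
  have hdiv : 16 * t / 16 = t := by omega
  have hU : A = 4 * t → c.fits w j (c.wordU w ι (16 * t) j k) := fun h => by
    convert hf using 1
    funext a
    rw [aWord, if_neg (by omega), wordU, par, if_neg (by omega), hdiv, h,
      show 4 * t / 4 = t by omega]
  have hM : A = 4 * (t + 1) → c.fits w j (c.wordM w ι (16 * t) j k) := fun h => by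
    convert hf using 1
    funext a
    rw [aWord, if_neg (by omega), wordM, if_neg hna, hdiv, h, show 4 * (t + 1) / 4 = t + 1 by omega]
  have hUM : c.fits w j (c.wordU w ι (16 * t) j k) ∨ c.fits w j (c.wordM w ι (16 * t) j k) :=
    hA.imp hU hM
  unfold bStep
  rcases bNext_cases (S := 16 * t) (U := fun k => c.fits w j (c.wordU w ι (16 * t) j k))
      (M := fun k => c.fits w j (c.wordM w ι (16 * t) j k)) (by omega) hk hUM with
    h | ⟨-, h, -⟩ | ⟨hO, -, h⟩
  · left
    rw [h]
    exact .solved (by omega) (by omega)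
  · exact absurd h hna
  right
  refine ⟨hUM, hO, ?_⟩
  rw [hdiv] at h
  rcases h with ⟨h1, h2, h⟩ | ⟨h1, h2, h⟩ | ⟨h1, h2, h⟩ | ⟨h, h1⟩
  · rw [h]
    -- An unmoved Alice would have sent the chunk `U k`, which has just been excluded; so Alice
    -- really has moved.
    have hA' : A = 4 * (t + 1) := hA.resolve_left fun h => h2 (hU h)
    subst hA'
    by_cases hlt : t + 1 < c.idx w ι
    · exact ⟨_, .count hlt, Or.inl (by omega)⟩
    · refine ⟨_, .ask (Or.inr (by omega)) (by omega) (by omega) ?_ (by omega), Or.inl (by omega)⟩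
      rw [par, if_neg (by omega)]
      omega
  · rw [h]
    have hA' : A = 4 * t := hA.resolve_right fun h => h2 (hM h)
    subst hA'
    refine ⟨_, .ask (Or.inl (by omega)) (by omega) (by omega) ?_ (by omega), Or.inl (by omega)⟩
    rw [par, if_pos (by omega)]
    rcases hk with rfl | rfl
    · rw [if_pos rfl]; omega
    · rw [if_neg one_ne_zero]; omega
  · rw [h]
    have hA' : A = 4 * (t + 1) := hA.resolve_left fun h => h2 (hU h)
    subst hA'
    refine ⟨_, .ask (Or.inl (by omega)) (by omega) (by omega) ?_ (by omega), Or.inl (by omega)⟩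
    rw [par, if_pos (by omega)]
    rcases hk with rfl | rfl
    · rw [if_pos rfl]; omega
    · rw [if_neg one_ne_zero]; omega
  · rw [h]
    rcases hA with rfl | rfl
    · exact ⟨_, .count ht, Or.inr (Or.inl ⟨rfl, rfl⟩)⟩
    · exact ⟨_, .counted ht, Or.inr (Or.inr ⟨rfl, rfl, fun hg =>
        costA_of_three hc hk hg hmode hna (hM rfl) (h1 (hM rfl))⟩)⟩

/-- Accounting for one block. Progress never decreases; if the symbols of the candidates differ in
this block, then it rises, is already complete, or the adversary pays `6 * u`, as `2 * u` for Bob's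
symbol and `4 * u` for Alice's chunk, or all of it for her chunk. -/
theorem sync_step (hc : c.Valid zm) (hx : c.cand w ι 0 ≠ c.cand w ι 1) {wA : ℕ → ℕ} {φ S A j k : ℕ}
    (hk : k = 0 ∨ k = 1) (h : Sync c w ι k φ S A) (hb : c.bobFits wA j (c.bSym w ι S))
    (hf : c.fits w j (c.aWord (c.cand w ι k) (c.aStep (c.cand w ι k) wA j A) j)) :
    ∃ φ', Sync c w ι k φ' (c.bStep w ι j S) (c.aStep (c.cand w ι k) wA j A) ∧ φ ≤ φ' ∧
      (c.Good w ι j → 6 * c.u ≤ c.costA w j + c.costB wA j ∨ φ < φ' ∨ φ = 2 * c.n + 4) := by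
  have hn := (idx_spec hx).1
  have hz := bSym_lt (c := c) (w := w) (ι := ι) S
  cases h with
  | @count t ht =>
    -- Bob's symbol is the parity of `t + 1`. An Alice who decodes it counts up, otherwise `2 * u`
    -- bits of Bob are erased; the `4 * u` for keeping both candidates come on top.
    have hs : c.bSym w ι (16 * t) = (t + 1) % 2 := by
      unfold bSym
      rw [if_neg (by omega), if_neg (by omega), if_neg (by omega), show 16 * t / 16 = t by omega]
    have hr : react (c.cand w ι k) (c.bSym w ι (16 * t)) (4 * t) = 4 * (t + 1) := by
      rw [hs, react, if_neg (by omega), if_neg (by omega), if_pos (by omega)]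
      ring
    have hcase := aStep_cases (X := c.cand w ι k) (S := 4 * t) hz hb (by omega)
    rw [hr] at hcase
    generalize c.aStep (c.cand w ι k) wA j (4 * t) = A' at *
    rcases sync_of_count hc hk ht (by omega) hn hf with h | ⟨h1, h2, φ', h, h3⟩
    · exact ⟨_, h, by omega, fun _ => by omega⟩
    · refine ⟨φ', h, by omega, fun hg => ?_⟩
      have := costA_of_both hc hx hk hg h1 h2
      omega
  | @counted t ht =>
    have hs : c.bSym w ι (16 * t) = (t + 1) % 2 := by
      unfold bSym
      rw [if_neg (by omega), if_neg (by omega), if_neg (by omega), show 16 * t / 16 = t by omega]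
    -- Alice's counter has the requested parity already, so hearing the symbol again does not push
    -- her beyond `t + 1`. Hence Bob's lag is never more than one.
    have hr : react (c.cand w ι k) (c.bSym w ι (16 * t)) (4 * (t + 1)) = 4 * (t + 1) := by
      rw [hs, react, if_neg (by omega), if_neg (by omega), if_neg (by omega)]
    have hcase : c.aStep (c.cand w ι k) wA j (4 * (t + 1)) = 4 * (t + 1) := by
      rcases aStep_cases (X := c.cand w ι k) (S := 4 * (t + 1)) hz hb (by omega) with h | h
      · exact h.trans hr
      · exact h.1
    rw [hcase] at hf ⊢
    rcases sync_of_count hc hk ht (by omega) hn hf with h | ⟨h1, h2, φ', h, h3⟩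
    · exact ⟨_, h, by omega, fun _ => by omega⟩
    · refine ⟨φ', h, by omega, fun hg => ?_⟩
      rcases h3 with h3 | h3 | h3
      · omega
      · omega
      · have := h3.2.2 hg
        omega
  | ask ha hS hA0 hp hA =>
    have hcase := aStep_cases (X := c.cand w ι k) hz hb hA0
    rw [react_of_asks ha hS hp hA] at hcase
    have hans := answer_lt_two (c := c) (w := w) (ι := ι) S k
    generalize c.aStep (c.cand w ι k) wA j A = A' at *
    have hstay : A' / 2 % 2 = 0 → A' = A := fun h => by omega
    rcases sync_of_asks hk ha hS (fun h => hstay h ▸ ⟨hp, hA⟩) (fun h => by omega) hf with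
      h | ⟨h1, h2, -, h⟩
    · exact ⟨_, h, by omega, fun _ => by omega⟩
    · refine ⟨_, h, by omega, fun hg => ?_⟩
      have := costA_of_both hc hx hk hg h1 h2
      omega
  | asked ha hS hA hans =>
    rw [aStep_of_settled hA] at hf ⊢
    rcases sync_of_asks hk ha hS (fun h => by omega) (fun _ => hans) hf with h | ⟨-, -, h1, h⟩
    · exact ⟨_, h, by omega, fun _ => by omega⟩
    · have hconst : c.fits w j fun _ => A % 2 := by
        convert hf using 1
        funext a
        rw [aWord, if_pos hA]
      rcases lastBit_of_const (g := S % 2) hconst with h2 | h2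
      -- Only the lowest bit of Bob's state, the last bit received, has changed, so the question and
      -- its answer are the same as before.
      · have h3 : c.bStep w ι j S / 2 = S / 2 := by omega
        refine ⟨_, .answered ((asks_congr h3).mpr ha) (by omega) hA ?_ ?_, by omega,
          fun _ => by omega⟩
        · rw [answer_congr h3, hans]
        · rw [answer_congr h3]; omega
      · exact ⟨_, h, by omega, fun _ => by omega⟩
  | answered ha hS hA hans hg =>
    rw [aStep_of_settled hA] at hf ⊢
    rcases sync_of_asks hk ha hS (fun h => by omega) (fun _ => hans) hf with h | ⟨-, -, h1, h⟩
    · exact ⟨_, h, le_rfl, fun _ => by omega⟩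
    · have hconst : c.fits w j fun _ => A % 2 := by
        convert hf using 1
        funext a
        rw [aWord, if_pos hA]
      -- All later bits repeat the same answer, and if none arrives the old bit is kept; the correct
      -- answer cannot be lost.
      have h2 : c.lastBit w j (S % 2) = A % 2 := by
        rcases lastBit_of_const (g := S % 2) hconst with h2 | h2 <;> omega
      have h3 : c.bStep w ι j S / 2 = S / 2 := by omega
      refine ⟨_, .answered ((asks_congr h3).mpr ha) (by omega) hA ?_ ?_, le_rfl,
        fun _ => by omega⟩
      · rw [answer_congr h3, hans]
      · rw [answer_congr h3]; omega
  | solved hS hk' =>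
    have : c.bStep w ι j S = S := by
      unfold bStep bNext
      rw [if_pos hS]
    rw [this]
    exact ⟨_, .solved hS hk', le_rfl, fun _ => by omega⟩

theorem verdict_of_sync (hx : c.cand w ι 0 ≠ c.cand w ι 1) {S A k : ℕ} (hk : k = 0 ∨ k = 1)
    (h : Sync c w ι k (2 * c.n + 4) S A) : c.verdict w ι S = k := by
  have hn := (idx_spec hx).1
  have hne := answer_ne hx S
  generalize hφ : 2 * c.n + 4 = φ at h
  unfold verdict
  cases h with
  | count => omega
  | counted => omega
  | ask => omega
  | asked => omega
  | answered ha hS hA hans hg =>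
    rw [if_neg (by omega), hg]
    rcases hk with rfl | rfl
    · rw [if_pos rfl]
    · rw [if_neg hne]
  | solved hS hk' => rw [if_pos hS, hk']

theorem sync_le (hn : c.idx w ι < c.n) {φ S A k : ℕ} (h : Sync c w ι k φ S A) :
    φ ≤ 2 * c.n + 4 := by
  cases h <;> omega

end Scheme

end RAM

/-! ## Resilience of the protocol -/

namespace RAM

namespace Scheme

/-- `wA` and `wB` are the views of Alice and Bob in an execution of the protocol on input `X`. -/
structure Run (c : Scheme) (X : ℕ) (wA wB : ℕ → ℕ) : Prop where
  lt : X < 2 ^ c.n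
  bob : ∀ j < c.blocks, c.bobFits wA j (c.bobSym wB j)
  alice : ∀ j < c.blocks, c.fits wB j (c.aWord X (c.aSt X wA (j + 1)) j)

variable {c : Scheme} {zm X : ℕ} {wA wB : ℕ → ℕ}

theorem block_lt {ι j : ℕ} (hι : ι < c.K) (hj : j < c.len) : ι * c.len + j < c.blocks := by
  have := Nat.mul_le_mul_right c.len (Nat.succ_le_of_lt hι)
  rw [Nat.succ_mul] at this
  unfold blocks
  omega

/-- Before Bob has narrowed down the input he sends the symbol `0`, which is the parity of Alice's
initial counter, so she stays at `0` whether or not she decodes it. Repetition `I` is included, as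
Bob consults only completed repetitions. -/
theorem Run.aSt_eq_zero (h : Run c X wA wB) {I : ℕ} (hI : I < c.K)
    (hn : ∀ ι < I, ¬ c.Narrow wB ι) {j : ℕ} (hj : j ≤ (I + 1) * c.len) : c.aSt X wA j = 0 := by
  induction j with
  | zero => rfl
  | succ j ih =>
    have h0 := ih (by omega)
    rw [aSt, iter]
    change c.aStep X wA j (c.aSt X wA j) = 0
    rw [h0]
    have hjb : j < c.blocks :=
      lt_of_lt_of_le hj (Nat.mul_le_mul_right c.len (Nat.succ_le_of_lt hI))
    have hb := h.bob j hjb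
    have hdiv : j / c.len ≤ I := by
      have hl : 0 < c.len := Nat.pos_of_ne_zero fun h => by simp [h] at hj
      exact Nat.lt_succ_iff.mp ((Nat.div_lt_iff_lt_mul hl).mpr
        (by rw [Nat.succ_eq_add_one]; omega))
    have hs : c.bobSym wB j = 0 := by
      unfold bobSym
      rw [if_neg]
      rintro ⟨ι, hι, h1⟩
      exact hn ι (by omega) h1
    rw [hs] at hb
    rcases aStep_cases (X := X) (S := 0) (by norm_num) hb (by norm_num) with h1 | h1
    · rw [h1]
      simp [react]
    · exact h1.1

theorem Run.fits_of_not_narrow (h : Run c X wA wB) {I : ℕ} (hI : I < c.K)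
    (hn : ∀ ι < I, ¬ c.Narrow wB ι) : ∀ j < c.len,
      c.fits wB (I * c.len + j) (c.wb X 0 (I * c.len + j)) := by
  intro j hj
  have h1 := h.alice _ (block_lt hI hj)
  rw [h.aSt_eq_zero hI hn (by rw [Nat.succ_mul]; omega)] at h1
  convert h1 using 1
  funext a
  simp [aWord]

theorem sel_eq {w : ℕ → ℕ} {ι b : ℕ} (h1 : c.Narrow w ι) (h2 : ∀ ι' < ι, ¬ c.Narrow w ι')
    (hb : ι < b) : c.sel w b = ι := by
  have h := search_spec (p := fun ι => c.Narrow w ι ∧ ∀ ι' < ι, ¬ c.Narrow w ι') ⟨ι, hb, h1, h2⟩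
  change c.sel w b < b ∧ _ at h
  rcases lt_trichotomy (c.sel w b) ι with h3 | h3 | h3
  · exact absurd h.2.1 (h2 _ h3)
  · exact h3
  · exact absurd h1 (h.2.2 ι h3)

/-- The cost of the first repetitions if none of them leaves at most two inputs. -/
theorem Run.cost_of_not_narrow (hc : c.Valid zm) (h : Run c X wA wB) {I : ℕ} (hI : I ≤ c.K)
    (hn : ∀ ι < I, ¬ c.Narrow wB ι) :
    6 * c.u * (I * c.len) ≤ ∑ j ∈ Finset.range (I * c.len), c.costA wB j +
      6 * c.u * (I * (3 * zm)) := by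
  rw [sum_range_mul]
  have := Finset.sum_le_sum fun ι (hι : ι ∈ Finset.range I) =>
    Scheme.cost_of_not_narrow hc h.lt (h.fits_of_not_narrow (by
      have := Finset.mem_range.mp hι; omega) fun ι' hι' => hn ι' (by
      have := Finset.mem_range.mp hι; omega)) (hn ι (Finset.mem_range.mp hι))
  rw [Finset.sum_add_distrib, Finset.sum_const, Finset.sum_const, Finset.card_range, smul_eq_mul,
    smul_eq_mul] at this
  calc 6 * c.u * (I * c.len) = I * (6 * c.u * c.len) := by ring
    _ ≤ _ := this
    _ = _ := by ring

/-- Summing `sync_step` over the blocks after repetition `ι`: until progress is complete, each block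
was paid for in full, raised the progress, or had coinciding symbols. -/
theorem Run.sync (hc : c.Valid zm) {ι k : ℕ} (hk : k = 0 ∨ k = 1)
    (h : Run c (c.cand wB ι k) wA wB) (hx : c.cand wB ι 0 ≠ c.cand wB ι 1) (hι : ι < c.K)
    (h1 : c.Narrow wB ι) (h2 : ∀ ι' < ι, ¬ c.Narrow wB ι') [DecidablePred (c.Good wB ι)] {d : ℕ}
    (hd : (ι + 1) * c.len + d ≤ c.blocks) :
    ∃ φ, Sync c wB ι k φ (c.bSt wB ι ((ι + 1) * c.len + d))
        (c.aSt (c.cand wB ι k) wA ((ι + 1) * c.len + d)) ∧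
      (φ = 2 * c.n + 4 ∨ 6 * c.u * d ≤ ∑ i ∈ Finset.range d, (c.costA wB ((ι + 1) * c.len + i) +
        c.costB wA ((ι + 1) * c.len + i)) + 6 * c.u * (φ +
        ∑ i ∈ Finset.range d, if c.Good wB ι ((ι + 1) * c.len + i) then 0 else 1)) := by
  induction d with
  | zero =>
    have hS : ∀ J ≤ (ι + 1) * c.len, c.bSt wB ι J = 0 := by
      intro J
      induction J with
      | zero => intro _; rfl
      | succ J ih =>
        intro hJ
        rw [bSt, iter, if_neg (by omega)]
        exact ih (by omega)
    rw [add_zero, hS _ le_rfl, h.aSt_eq_zero hι h2 le_rfl]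
    -- If the candidates differ in bit `0` there is nothing to count and Bob asks at once.
    by_cases h0 : c.idx wB ι = 0
    · exact ⟨_, .ask (Or.inr (by omega)) (by norm_num) rfl rfl (fun _ => by omega),
        Or.inr (by simp)⟩
    · exact ⟨_, .count (t := 0) (by omega), Or.inr (by simp)⟩
  | succ d ih =>
    obtain ⟨φ, hs, hφ⟩ := ih (by omega)
    set j := (ι + 1) * c.len + d with hj
    have hb := h.bob j (by omega)
    have ha := h.alice j (by omega)
    have hdiv : ι < j / c.len :=
      Nat.lt_of_succ_le ((Nat.le_div_iff_mul_le hc.len_pos).mpr (by rw [hj]; exact Nat.le_add_right _ _))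
    have hsym : c.bobSym wB j = c.bSym wB ι (c.bSt wB ι j) := by
      unfold bobSym
      rw [if_pos ⟨ι, hdiv, h1⟩, sel_eq h1 h2 hdiv]
    rw [hsym] at hb
    have eB : c.bSt wB ι (j + 1) = c.bStep wB ι j (c.bSt wB ι j) := by
      conv_lhs => rw [bSt, iter, if_pos (by omega)]
      rfl
    have eA : c.aSt (c.cand wB ι k) wA (j + 1) =
      c.aStep (c.cand wB ι k) wA j (c.aSt (c.cand wB ι k) wA j) := rfl
    rw [eA] at ha
    obtain ⟨φ', hs', hle, hg⟩ := sync_step hc hx hk hs hb ha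
    have hmax := sync_le (idx_spec hx).1 hs'
    refine ⟨φ', by rw [← add_assoc, ← hj, eB, eA]; exact hs', ?_⟩
    rcases hφ with hφ | hφ
    · left; omega
    by_cases hφ' : φ = 2 * c.n + 4
    · left; omega
    right
    rw [Finset.sum_range_succ, Finset.sum_range_succ, ← hj]
    have hmono : 6 * c.u * φ ≤ 6 * c.u * φ' := Nat.mul_le_mul_left _ hle
    by_cases hgood : c.Good wB ι j
    · rw [if_pos hgood]
      rcases hg hgood with h3 | h3 | h3
      · simp only [mul_add, mul_one, mul_zero] at *
        omega
      · have := Nat.mul_le_mul_left (6 * c.u) (Nat.succ_le_of_lt h3)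
        simp only [Nat.succ_eq_add_one, mul_add, mul_one, mul_zero] at *
        omega
      · exact absurd h3 hφ'
    · rw [if_neg hgood]
      simp only [mul_add, mul_one] at *
      omega

/-- An execution in which Bob is wrong has a cost of almost `6 / 11` of all bits. -/
theorem Run.cost_of_out_ne (hc : c.Valid zm) (h : Run c X wA wB) (hne : c.out wB ≠ X) :
    6 * c.u * c.blocks ≤ ∑ j ∈ Finset.range c.blocks, (c.costA wB j + c.costB wA j) +
      6 * c.u * (c.len + (2 * c.n + 4) + c.K * (4 * zm)) := by
  classical
  rw [Finset.sum_add_distrib]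
  by_cases hex : ∃ ι < c.K, c.Narrow wB ι
  · obtain ⟨ι, hι, h1, h2⟩ : ∃ ι < c.K, c.Narrow wB ι ∧ ∀ ι' < ι, ¬ c.Narrow wB ι' := by
      have hs := Nat.find_spec hex
      refine ⟨Nat.find hex, hs.1, hs.2, fun ι' hι' hn => Nat.find_min hex hι' ⟨by omega, hn⟩⟩
    have hout : c.out wB = c.cand wB ι (c.verdict wB ι (c.bSt wB ι c.blocks)) := by
      unfold out
      rw [if_pos hex, sel_eq h1 h2 hι]
    obtain ⟨k, hk, rfl⟩ : ∃ k, (k = 0 ∨ k = 1) ∧ X = c.cand wB ι k := by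
      rcases cand_of_narrow hc h.lt (h.fits_of_not_narrow hι h2) h1 with h3 | h3
      · exact ⟨0, Or.inl rfl, h3⟩
      · exact ⟨1, Or.inr rfl, h3⟩
    -- If the two candidates coincided, every verdict would give the right output.
    have hx : c.cand wB ι 0 ≠ c.cand wB ι 1 := by
      intro heq
      have hv : c.verdict wB ι (c.bSt wB ι c.blocks) = 0 ∨
          c.verdict wB ι (c.bSt wB ι c.blocks) = 1 := by
        unfold verdict
        split_ifs <;> omega
      apply hne
      rw [hout]
      rcases hv with hv | hv <;> rcases hk with rfl | rfl <;> rw [hv] <;> simp [heq]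
    obtain ⟨e, he⟩ : ∃ e, c.K = ι + 1 + e := ⟨c.K - ι - 1, by omega⟩
    have hbl : c.blocks = (ι + 1) * c.len + e * c.len := by
      unfold blocks
      rw [he]
      ring
    obtain ⟨φ, hs, hφ⟩ := h.sync hc hk hx hι h1 h2 (d := e * c.len) hbl.ge
    rw [← hbl] at hs
    have hmax := sync_le (idx_spec hx).1 hs
    rcases hφ with rfl | hφ
    · rw [hout, verdict_of_sync hx hk hs] at hne
      exact absurd rfl hne
    have hbad : ∑ i ∈ Finset.range (e * c.len),
        (if c.Good wB ι ((ι + 1) * c.len + i) then 0 else 1) ≤ e * zm := by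
      rw [sum_range_mul]
      refine (Finset.sum_le_sum (g := fun _ => zm) fun q _ => ?_).trans (by simp)
      have hX0 : c.cand wB ι 0 ^^^ c.cand wB ι 1 ≠ 0 := fun h0 => hx (Nat.xor_eq_zero_iff.mp h0)
      refine le_trans (le_of_eq ?_) (hc.card_zeros_le _
        (Nat.xor_lt_two_pow (cand_lt wB ι 0) (cand_lt wB ι 1)) hX0)
      rw [Finset.card_filter]
      refine Finset.sum_congr rfl fun r hr => ?_
      have hmod : ((ι + 1) * c.len + (q * c.len + r)) % c.len = r := by
        rw [← add_assoc, ← Nat.add_mul, mul_comm, Nat.mul_add_mod,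
          Nat.mod_eq_of_lt (Finset.mem_range.mp hr)]
      unfold Good
      rw [hmod]
      split_ifs <;> rfl
    have hfirst := h.cost_of_not_narrow hc hι.le h2
    -- The blocks of repetition `ι` itself are discarded: the adversary need not have paid for them,
    -- nor could Bob use what they revealed before their end. They are the term `c.len` of the
    -- bound.
    have hsplit : ∀ f : ℕ → ℕ, ∑ j ∈ Finset.range (ι * c.len), f j +
        ∑ i ∈ Finset.range (e * c.len), f ((ι + 1) * c.len + i) ≤
        ∑ j ∈ Finset.range c.blocks, f j := by
      intro f
      rw [hbl, Finset.sum_range_add]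
      refine Nat.add_le_add_right (Finset.sum_le_sum_of_subset ?_) _
      exact Finset.range_mono (Nat.mul_le_mul_right _ (by omega))
    have hsA := hsplit (c.costA wB)
    have hsB := hsplit (c.costB wA)
    rw [Finset.sum_add_distrib] at hφ
    have hlast : 6 * c.u * (φ + ∑ i ∈ Finset.range (e * c.len),
        (if c.Good wB ι ((ι + 1) * c.len + i) then 0 else 1)) + 6 * c.u * (ι * (3 * zm)) ≤
        6 * c.u * ((2 * c.n + 4) + c.K * (4 * zm)) := by
      rw [← mul_add]
      refine Nat.mul_le_mul_left _ ?_
      rw [he]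
      have e1 : (ι + 1 + e) * (4 * zm) = 3 * (ι * zm) + ι * zm + 4 * zm + 3 * (e * zm) + e * zm := by
        ring
      have e2 : ι * (3 * zm) = 3 * (ι * zm) := by ring
      omega
    have etot : 6 * c.u * c.blocks = 6 * c.u * (ι * c.len) + 6 * c.u * c.len +
        6 * c.u * (e * c.len) := by rw [hbl]; ring
    have eend : 6 * c.u * (c.len + (2 * c.n + 4) + c.K * (4 * zm)) =
        6 * c.u * c.len + 6 * c.u * ((2 * c.n + 4) + c.K * (4 * zm)) := by ring
    omega
  · push Not at hex
    have h1 := h.cost_of_not_narrow hc le_rfl hex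
    have h2 : 6 * c.u * (c.K * (3 * zm)) ≤
        6 * c.u * (c.len + (2 * c.n + 4) + c.K * (4 * zm)) := by
      refine Nat.mul_le_mul_left _ ?_
      have : c.K * (3 * zm) ≤ c.K * (4 * zm) := Nat.mul_le_mul_left _ (by omega)
      omega
    unfold blocks
    omega

end Scheme

end RAM

/-! ## Computing the code -/

namespace RAM

section

variable {D : Inp → (ℕ → ℕ) → Prop} {a b f : Inp → (ℕ → ℕ) → ℕ} {p q : Inp → (ℕ → ℕ) → Prop}

theorem PT.up {R : Inp → (ℕ → ℕ) → Prop} (h : PT D f) :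
    PT (fun I ρ => D I (tl ρ) ∧ R I ρ) (fun I ρ => f I (tl ρ)) := h.wk fun _ _ h => h.1

theorem PT.up2 {R : Inp → (ℕ → ℕ) → Prop} (h : PT D f) :
    PT (fun I ρ => D I (tl (tl ρ)) ∧ R I ρ) (fun I ρ => f I (tl (tl ρ))) :=
  PT.wk (D := fun I ρ => D I (tl ρ)) (h.wk fun _ _ h => h) fun _ _ h => h.1

theorem PT.restrict {R : Inp → (ℕ → ℕ) → Prop} (h : PT D f) : PT (fun I ρ => D I ρ ∧ R I ρ) f :=
  h.mono fun _ _ h => h.1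

/-- Conjunctions are evaluated lazily. -/
theorem PTp.and_then (hp : PTp D p) (hq : PTp (fun I ρ => D I ρ ∧ p I ρ) q) :
    PTp D (fun I ρ => p I ρ ∧ q I ρ) := by
  classical
  refine (PTp.ne_zero (PT.ite hp (PT.ite hq (PT.lit 1) (PT.lit 0)) (PT.lit 0))).congr fun I ρ _ => ?_
  by_cases h1 : p I ρ <;> by_cases h2 : q I ρ <;> simp [h1, h2]

theorem PT.shl (ha : PT D a) (hb : PT D b) (hN : ∀ I ρ, D I ρ → b I ρ ≤ I.N) :
    PT D (fun I ρ => a I ρ * 2 ^ b I ρ) := by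
  refine (PT.iter (g := fun _ _ _ r => r + r) hb hN ha ((PT.var 0).add (PT.var 0))).congr
    fun I ρ _ => ?_
  generalize b I ρ = k
  induction k with
  | zero => simp [RAM.iter]
  | succ k ih => rw [RAM.iter, ih, pow_succ]; ring

theorem PT.lit_mul (k : ℕ) (ha : PT D a) : PT D (fun I ρ => k * a I ρ) := by
  induction k with
  | zero => exact (PT.lit 0).congr fun I ρ _ => (Nat.zero_mul _).symm
  | succ k ih => exact (ih.add ha).congr fun I ρ _ => (Nat.succ_mul _ _).symm

theorem PT.mul_lit (ha : PT D a) (k : ℕ) : PT D (fun I ρ => a I ρ * k) :=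
  (PT.lit_mul k ha).congr fun _ _ _ => mul_comm _ _

theorem PT.div_two_pow (ha : PT D a) (k : ℕ) : PT D (fun I ρ => a I ρ / 2 ^ k) := by
  induction k with
  | zero => exact ha.congr fun _ _ _ => by simp
  | succ k ih => exact ih.half.congr fun I ρ _ => by rw [Nat.div_div_eq_div_mul, pow_succ]

theorem PT.div_four (ha : PT D a) : PT D (fun I ρ => a I ρ / 4) := ha.div_two_pow 2

theorem PT.div_sixteen (ha : PT D a) : PT D (fun I ρ => a I ρ / 16) := ha.div_two_pow 4

theorem PT.mod_four (ha : PT D a) : PT D (fun I ρ => a I ρ % 4) :=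
  (ha.sub (PT.lit_mul 4 ha.div_four)).congr fun I ρ _ => by omega

theorem div_mod_eq_ofBits (x A n : ℕ) : x / 2 ^ A % 2 ^ n = ofBits (fun r => bit x (A + r)) n := by
  refine eq_of_bit (Nat.mod_lt _ (by positivity)) (ofBits_lt _ _) fun i hi => ?_
  rw [bit_div_mod hi, bit_ofBits _ hi, Nat.mod_eq_of_lt (bit_lt_two _ _)]

end

/-- The constants of the protocol. -/
structure Params where
  v : ℕ
  s : ℕ
  K : ℕ
  m₀ : ℕ

namespace Params

variable (p : Params)

/-- The degree of the field extension for input length `n`. -/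
def deg (n : ℕ) : ℕ := iter (fun _ m => if n ≤ m * 2 ^ ((m - p.s) * p.v) then m else m + 1) p.m₀ n

/-- The protocol for input length `n`. -/
def cfg (n : ℕ) : Scheme where
  n := n
  v := p.v
  K := p.K
  len := 2 ^ ((p.deg n - 1) * p.v) * p.deg n
  sy := sym n p.v p.s (p.deg n) (primPoly (p.deg n))

/-- The loop bound `N` suffices for input length `n`. -/
structure Big (n N : ℕ) : Prop where
  sixteen_le : 16 ≤ N
  n_lt : n + 1 ≤ N
  sq_le : n * (n + 1) ≤ N
  v_le : p.v + 3 ≤ N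
  m_le : p.m₀ + n ≤ N
  mul_le : (p.m₀ + n) * p.v ≤ N
  pow_le : 2 ^ (p.deg n + 1) ≤ N
  expo_le : p.deg n + p.v * (2 ^ p.deg n * 2 ^ p.deg n) + 2 ^ p.deg n ≤ N
  len_le : (p.cfg n).len * (8 * 2 ^ p.v) ≤ N
  rounds_le : 11 * 2 ^ p.v * (p.cfg n).blocks ≤ N
  u_le : 11 * 2 ^ p.v ≤ N
  K_le : p.K ≤ N
  deg_pos : 0 < p.deg n

/-- On the domain `D` the loop bound suffices. -/
def Dom (D : Inp → (ℕ → ℕ) → Prop) : Prop := ∀ I ρ, D I ρ → p.Big I.n I.N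

variable {p} {D : Inp → (ℕ → ℕ) → Prop} {a b f X j : Inp → (ℕ → ℕ) → ℕ}

theorem Dom.up {R : Inp → (ℕ → ℕ) → Prop} (hD : p.Dom D) :
    p.Dom (fun I ρ => D I (tl ρ) ∧ R I ρ) := fun I _ h => hD I _ h.1

theorem Dom.up2 {R : Inp → (ℕ → ℕ) → Prop} (hD : p.Dom D) :
    p.Dom (fun I ρ => D I (tl (tl ρ)) ∧ R I ρ) := fun I _ h => hD I _ h.1

theorem Dom.restrict {R : Inp → (ℕ → ℕ) → Prop} (hD : p.Dom D) :
    p.Dom (fun I ρ => D I ρ ∧ R I ρ) := fun I _ h => hD I _ h.1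

theorem iter_deg_le (v s m₀ n k : ℕ) :
    iter (fun _ m => if n ≤ m * 2 ^ ((m - s) * v) then m else m + 1) m₀ k ≤ m₀ + k := by
  induction k with
  | zero => exact le_rfl
  | succ k ih =>
    rw [iter]
    split_ifs <;> omega

theorem deg_le (n : ℕ) : p.deg n ≤ p.m₀ + n := iter_deg_le _ _ _ _ _

theorem deg_mul_le {n N : ℕ} (h : p.Big n N) {k i : ℕ} (hk : k ≤ p.deg n) (hi : i ≤ p.v) :
    k * i ≤ N :=
  (Nat.mul_le_mul (hk.trans (deg_le n)) hi).trans h.mul_le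

theorem two_pow_deg_le {n N : ℕ} (h : p.Big n N) : 2 ^ p.deg n ≤ N := by
  have := h.pow_le
  rw [pow_succ] at this
  omega

theorem pt_deg (hD : p.Dom D) : PT D (fun I _ => p.deg I.n) := by
  refine PT.iter (g := fun I _ _ m => if I.n ≤ m * 2 ^ ((m - p.s) * p.v) then m else m + 1) PT.n
    (fun I ρ h => ?_) (PT.lit _) (PT.ite (PTp.le PT.n (PT.shl (PT.var 0)
      (((PT.var 0).sub (PT.lit _)).mul_lit _) ?_)) (PT.var 0) ((PT.var 0).add (PT.lit 1)))
  · have := (hD I ρ h).n_lt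
    omega
  · intro I ρ h
    have h1 := (hD I _ h.1).mul_le
    have h2 := iter_deg_le p.v p.s p.m₀ I.n (ρ 1)
    have h3 := h.2.2
    have h4 := h.2.1
    beta_reduce at h3 h4
    refine le_trans (Nat.mul_le_mul_right _ ?_) h1
    rw [h3]
    omega

theorem pt_lfsr (hD : p.Dom D) (ha : PT D a) (hb : PT D b) (h : ∀ I ρ, D I ρ →
    2 ^ p.deg I.n ≤ a I ρ ∧ a I ρ < 2 ^ (p.deg I.n + 1) ∧ b I ρ ≤ I.N) :
    PT D (fun I ρ => lfsr (p.deg I.n) (a I ρ) (b I ρ)) := by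
  have hm : PT D (fun I _ => p.deg I.n) := pt_deg hD
  have hlt : ∀ I : Inp, p.Big I.n I.N → p.deg I.n + 1 ≤ I.N := fun I hI => by
    have := hI.pow_le
    exact Nat.lt_two_pow_self.le.trans this
  refine PT.iter (g := fun I ρ _ W => lstep (p.deg I.n) (a I ρ) W) hb (fun I ρ hI => (h I ρ hI).2.2)
    (PT.lit 1) (PT.ite (PTp.le (PT.two_pow hm.up2 fun I ρ hI => ?_) (PT.lit_mul 2 (PT.var 0)))
      (PT.xor (PT.lit_mul 2 (PT.var 0)) ha.up2.restrict fun I ρ hI => ?_) (PT.lit_mul 2 (PT.var 0)))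
  · have := hlt I (hD I _ hI.1)
    omega
  · have hI' := hD I _ hI.1.1
    have h1 := h I _ hI.1.1
    have h2 := lfsr_lt hI'.deg_pos h1.1 h1.2.1 (ρ 1)
    have h3 : ρ 0 = lfsr (p.deg I.n) (a I (tl (tl ρ))) (ρ 1) := hI.1.2.2
    have h4 : 2 ^ (p.deg I.n + 1) ≤ 2 ^ I.N := Nat.pow_le_pow_right (by norm_num) (hlt I hI')
    refine ⟨?_, h1.2.1.trans_le h4⟩
    rw [h3]
    rw [pow_succ] at h4
    omega

/-- Brute force is affordable because `2 ^ (deg + 1)` is at most `N`. The conjunctions are tested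
lazily, since the bound on the register needs the top digit of the candidate. -/
theorem pt_primPoly (hD : p.Dom D) : PT D (fun I _ => primPoly (p.deg I.n)) := by
  have hm : ∀ {D}, p.Dom D → PT D (fun I _ => p.deg I.n) := fun hD => pt_deg hD
  have hlt : ∀ I : Inp, p.Big I.n I.N → p.deg I.n + 1 ≤ I.N := fun I hI => by
    have := hI.pow_le
    exact Nat.lt_two_pow_self.le.trans this
  have hq : ∀ {D}, p.Dom D → PT D (fun I _ => 2 ^ p.deg I.n) := fun hD =>
    PT.two_pow (hm hD) fun I ρ h => by
      have := hlt I (hD I ρ h)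
      omega
  have hpow : PT D (fun I _ => 2 ^ (p.deg I.n + 1)) :=
    PT.two_pow ((hm hD).add (PT.lit 1)) fun I ρ h => hlt I (hD I ρ h)
  refine PT.search (P := fun I _ P => IsPrimitive (p.deg I.n) P) hpow (fun I ρ h => (hD I ρ h).pow_le)
    (PTp.and_then (PTp.le (hq hD.up) (PT.var 0)) (PTp.and ?_ (PTp.ball ((hq hD.up.restrict).sub
      (PT.lit 1)) ?_ ?_)))
  · refine PTp.eq (pt_lfsr hD.up.restrict (PT.var 0) ((hq hD.up.restrict).sub (PT.lit 1))
      fun I ρ h => ⟨h.2, h.1.2, ?_⟩) (PT.lit 1)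
    have := two_pow_deg_le (hD I _ h.1.1)
    omega
  · intro I ρ h
    have := two_pow_deg_le (hD I _ h.1.1)
    omega
  · refine PTp.congr (PTp.or (PTp.lt (PT.var 0) (PT.lit 1)) (PTp.not (PTp.eq
      (pt_lfsr (fun I _ h => hD I _ h.1.1.1) (PT.var 1) (PT.var 0) fun I ρ h => ⟨h.1.2, h.1.1.2, ?_⟩)
      (PT.lit 1)))) fun I ρ h => ?_
    · have h1 := two_pow_deg_le (hD I _ h.1.1.1)
      have h2 := h.2
      beta_reduce at h2
      omega
    · by_cases h0 : ρ 0 = 0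
      · simp [h0]
      · simp only [show 0 < ρ 0 by omega, forall_const, ne_eq]
        constructor
        · rintro (h1 | h1)
          · omega
          · exact h1
        · exact Or.inr

theorem pt_dig {k x l : Inp → (ℕ → ℕ) → ℕ} (hk : PT D k) (hx : PT D x) (hl : PT D l)
    (h : ∀ I ρ, D I ρ → k I ρ ≤ I.N ∧ x I ρ ≤ I.N ∧ k I ρ * l I ρ ≤ I.N) :
    PT D (fun I ρ => dig (k I ρ) (x I ρ) (l I ρ)) :=
  PT.mod (PT.shr hx (PT.mul hk hl fun I ρ hI => (h I ρ hI).1) fun I ρ hI => (h I ρ hI).2.2)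
    (PT.two_pow hk fun I ρ hI => (h I ρ hI).1)
    (fun I ρ hI => (Nat.div_le_self _ _).trans (h I ρ hI).2.1) fun _ _ _ => by positivity

theorem pt_expo {x i : Inp → (ℕ → ℕ) → ℕ} (hD : p.Dom D) (hb : PT D b) (hx : PT D x) (hi : PT D i)
    (h : ∀ I ρ, D I ρ → b I ρ ≤ I.N ∧ x I ρ ≤ I.N) :
    PT D (fun I ρ => expo p.v p.s (p.deg I.n) (b I ρ) (x I ρ) (i I ρ)) := by
  have hm : ∀ {D}, p.Dom D → PT D (fun I _ => p.deg I.n) := fun hD => pt_deg hD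
  have hle : ∀ I : Inp, p.Big I.n I.N → p.deg I.n ≤ I.N := fun I hI => (deg_le _).trans hI.m_le
  refine PT.add (PT.add (PT.mod hb (hm hD) (fun I ρ hI => (h I ρ hI).1)
    fun I ρ hI => (hD I ρ hI).deg_pos) (PT.sum
      (g := fun I ρ l => dig (p.deg I.n - 1) (x I ρ) l * dig (p.deg I.n - p.s) (b I ρ / p.deg I.n) l)
      (PT.lit _) ?_ (PT.mul
      (pt_dig ((hm hD.up).sub (PT.lit 1)) hx.up (PT.var 0) ?_)
      (pt_dig ((hm hD.up).sub (PT.lit _)) (PT.div hb.up (hm hD.up) (fun I ρ hI => (h I _ hI.1).1)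
        fun I ρ hI => (hD I _ hI.1).deg_pos) (PT.var 0) ?_) ?_)))
    (PT.ite (PTp.lt hi (PT.lit _))
      (pt_dig ((hm hD.restrict).sub (PT.lit 1)) hx.restrict hi.restrict ?_) (PT.lit 0))
  · intro I ρ hI
    have := (hD I ρ hI).v_le
    omega
  · intro I ρ hI
    have h1 := hle I (hD I _ hI.1)
    refine ⟨by omega, (h I _ hI.1).2, deg_mul_le (hD I _ hI.1) (by omega) ?_⟩
    exact hI.2.le
  · intro I ρ hI
    have h1 := hle I (hD I _ hI.1)
    refine ⟨by omega, (Nat.div_le_self _ _).trans (h I _ hI.1).1,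
      deg_mul_le (hD I _ hI.1) (by omega) ?_⟩
    exact hI.2.le
  · intro I ρ hI
    refine (dig_lt _ _ _).le.trans (le_trans ?_ (two_pow_deg_le (hD I _ hI.1)))
    exact Nat.pow_le_pow_right (by norm_num) (by omega)
  · intro I ρ hI
    have h1 := hle I (hD I _ hI.1)
    refine ⟨by omega, (h I _ hI.1).2, deg_mul_le (hD I _ hI.1) (by omega) ?_⟩
    exact hI.2.le

theorem expo_le {n N : ℕ} (h : p.Big n N) (b x i : ℕ) : expo p.v p.s (p.deg n) b x i ≤ N := by
  refine le_trans ?_ h.expo_le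
  unfold expo
  have hd : ∀ k ≤ p.deg n, ∀ x l, dig k x l ≤ 2 ^ p.deg n := fun k hk x l =>
    (dig_lt _ _ _).le.trans (Nat.pow_le_pow_right (by norm_num) hk)
  have h1 : b % p.deg n ≤ p.deg n := (Nat.mod_lt _ h.deg_pos).le
  have h2 : ∑ l ∈ Finset.range p.v, dig (p.deg n - 1) x l * dig (p.deg n - p.s) (b / p.deg n) l ≤
      p.v * (2 ^ p.deg n * 2 ^ p.deg n) := by
    refine (Finset.sum_le_sum fun l _ => Nat.mul_le_mul (hd (p.deg n - 1) (by omega) x l)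
      (hd (p.deg n - p.s) (by omega) (b / p.deg n) l)).trans ?_
    simp
  have h3 : (if i < p.v then dig (p.deg n - 1) x i else 0) ≤ 2 ^ p.deg n := by
    split_ifs
    · exact hd _ (by omega) _ _
    · exact Nat.zero_le _
  omega

theorem pt_sy {i : Inp → (ℕ → ℕ) → ℕ} (hD : p.Dom D) (hX : PT D X) (hj : PT D j) (hi : PT D i)
    (h : ∀ I ρ, D I ρ → j I ρ ≤ I.N) :
    PT D (fun I ρ => (p.cfg I.n).sy (X I ρ) (j I ρ) (i I ρ)) := by
  have hm : ∀ {D}, p.Dom D → PT D (fun I _ => p.deg I.n) := fun hD => pt_deg hD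
  refine PT.mod_two (PT.sum (g := fun I ρ b => bit (X I ρ) b *
    gen p.v p.s (p.deg I.n) (primPoly (p.deg I.n)) b (j I ρ) (i I ρ)) PT.n ?_
    (PT.mul (PT.bit hX.up (PT.var 0) ?_) (PT.bit (pt_lfsr hD.up (pt_primPoly hD.up)
      (pt_expo hD.up (PT.var 0) (PT.div hj.up (hm hD.up) (fun I ρ hI => h I _ hI.1)
        fun I ρ hI => (hD I _ hI.1).deg_pos) hi.up fun I ρ hI => ⟨?_, ?_⟩) fun I ρ hI => ?_)
      (PT.mod hj.up (hm hD.up) (fun I ρ hI => h I _ hI.1) fun I ρ hI => (hD I _ hI.1).deg_pos) ?_) ?_))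
  · intro I ρ hI
    have := (hD I ρ hI).n_lt
    omega
  · intro I ρ hI
    have h1 := (hD I _ hI.1).n_lt
    have h2 := hI.2
    beta_reduce at h2
    omega
  · have h1 := (hD I _ hI.1).n_lt
    have h2 := hI.2
    beta_reduce at h2
    omega
  · exact (Nat.div_le_self _ _).trans (h I _ hI.1)
  · have h1 := primPoly_spec (hD I _ hI.1).deg_pos
    exact ⟨h1.2.1, h1.1, expo_le (hD I _ hI.1) _ _ _⟩
  · intro I ρ hI
    exact (Nat.mod_le _ _).trans (h I _ hI.1)
  · intro I ρ hI
    have h1 := (hD I _ hI.1).sixteen_le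
    have h2 := bit_lt_two (X I (tl ρ)) (ρ 0)
    omega

end Params

end RAM

/-! ## Computing the protocol -/

namespace RAM

theorem PT.cond {D : Inp → (ℕ → ℕ) → Prop} {a b : Inp → (ℕ → ℕ) → ℕ} {p : Inp → (ℕ → ℕ) → Prop}
    [∀ I ρ, Decidable (p I ρ)] (hp : PTp D p) (ha : PT D a) (hb : PT D b) :
    PT D (fun I ρ => if p I ρ then a I ρ else b I ρ) := PT.ite hp ha.restrict hb.restrict

namespace Scheme

theorem aStep_div_le (c : Scheme) (X : ℕ) (w : ℕ → ℕ) (j S : ℕ) : c.aStep X w j S / 4 ≤ S / 4 + 1 := by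
  unfold aStep react
  have := bit_lt_two X (S / 4)
  split_ifs <;> omega

/-- The counter is bounded by the number of blocks; this makes the shift in `bit X (S / 4)`
computable within `N` rounds. -/
theorem aSt_div_le (c : Scheme) (X : ℕ) (w : ℕ → ℕ) (J : ℕ) : c.aSt X w J / 4 ≤ J := by
  induction J with
  | zero => simp [aSt, iter]
  | succ J ih =>
    have := c.aStep_div_le X w J (c.aSt X w J)
    change c.aStep X w J (c.aSt X w J) / 4 ≤ J + 1
    omega

end Scheme

namespace Params

variable {p : Params} {D : Inp → (ℕ → ℕ) → Prop} {a b f i j k l r z B S X ι τ : Inp → (ℕ → ℕ) → ℕ}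

theorem len_pos {n N : ℕ} (h : p.Big n N) : 0 < (p.cfg n).len :=
  Nat.mul_pos (by positivity) h.deg_pos

theorem blocks_le {n N : ℕ} (h : p.Big n N) : (p.cfg n).blocks ≤ N :=
  (Nat.le_mul_of_pos_left _ (by positivity)).trans h.rounds_le

theorem len_le {n N : ℕ} (h : p.Big n N) : (p.cfg n).len ≤ N :=
  (Nat.le_mul_of_pos_right _ (by positivity)).trans h.len_le

theorem pt_u : PT D (fun I _ => (p.cfg I.n).u) := PT.lit (2 ^ p.v)

theorem pt_K : PT D (fun I _ => (p.cfg I.n).K) := PT.lit p.K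

theorem pt_n : PT D (fun I _ => (p.cfg I.n).n) := PT.n

theorem pt_len (hD : p.Dom D) : PT D (fun I _ => (p.cfg I.n).len) := by
  refine (PT.shl (pt_deg hD) (((pt_deg hD).sub (PT.lit 1)).mul_lit p.v) fun I ρ h => ?_).congr
    fun I ρ _ => mul_comm _ _
  exact deg_mul_le (hD I ρ h) (by omega) le_rfl

theorem u_le {n N : ℕ} (h : p.Big n N) : 11 * (p.cfg n).u ≤ N := h.u_le

/-- The number of a round, given its block and its position in the block. -/
theorem pt_round (hD : p.Dom D) (hj : PT D j) (ha : PT D a)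
    (h : ∀ I ρ, D I ρ → j I ρ < (p.cfg I.n).blocks) :
    PT D (fun I ρ => j I ρ * (11 * (p.cfg I.n).u) + a I ρ) :=
  (PT.mul hj (PT.lit_mul 11 pt_u) fun I ρ hI => (h I ρ hI).le.trans (blocks_le (hD I ρ hI))).add ha

theorem pt_aliceRound (hD : p.Dom D) (hj : PT D j) (ha : PT D a)
    (h : ∀ I ρ, D I ρ → j I ρ < (p.cfg I.n).blocks) :
    PT D (fun I ρ => j I ρ * (11 * (p.cfg I.n).u) + 3 * (p.cfg I.n).u + a I ρ) :=
  (pt_round hD hj (PT.lit_mul 3 pt_u) h).add ha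

theorem pt_lin (hD : p.Dom D) (hX : PT D X) (hj : PT D j) (ha : PT D a)
    (h : ∀ I ρ, D I ρ → j I ρ < (p.cfg I.n).blocks) :
    PT D (fun I ρ => (p.cfg I.n).lin (X I ρ) (j I ρ) (a I ρ)) := by
  have hle : ∀ I ρ, D I ρ → j I ρ ≤ I.N := fun I ρ hI => (h I ρ hI).le.trans (blocks_le (hD I ρ hI))
  refine PT.mod_two (PT.sum (g := fun I ρ i => bit (a I ρ) (i + 2) *
    (p.cfg I.n).sy (X I ρ) (j I ρ % (p.cfg I.n).len) i) (PT.lit (p.v + 1)) ?_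
    (PT.mul (PT.bit ha.up ((PT.var 0).add (PT.lit 2)) ?_) (pt_sy hD.up hX.up
      (PT.mod hj.up (pt_len hD.up) (fun I ρ hI => hle I _ hI.1) fun I ρ hI => len_pos (hD I _ hI.1))
      (PT.var 0) ?_) ?_))
  · intro I ρ hI
    exact (Nat.add_le_add_left (by norm_num) _).trans (hD I ρ hI).v_le
  · intro I ρ hI
    exact (Nat.add_le_add_right hI.2.le 2).trans (hD I _ hI.1).v_le
  · intro I ρ hI
    exact (Nat.mod_le _ _).trans (hle I _ hI.1)
  · intro I ρ hI
    have h1 := (hD I _ hI.1).sixteen_le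
    have h2 := bit_lt_two (a I (tl ρ)) (ρ 0 + 2)
    omega

theorem pt_wb (hD : p.Dom D) (hX : PT D X) (hb : PT D b) (hj : PT D j) (ha : PT D a)
    (h : ∀ I ρ, D I ρ → j I ρ < (p.cfg I.n).blocks) :
    PT D (fun I ρ => (p.cfg I.n).wb (X I ρ) (b I ρ) (j I ρ) (a I ρ)) := by
  have hN : ∀ I ρ, D I ρ → 16 ≤ I.N := fun I ρ hI => (hD I ρ hI).sixteen_le
  refine PT.mod_two (((PT.bit ha (PT.lit 0) fun I ρ hI => ?_).add (PT.mul
    (PT.bit ha (PT.lit 1) fun I ρ hI => ?_) hb fun I ρ hI => ?_)).add (pt_lin hD hX hj ha h))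
  · exact Nat.zero_le _
  · have := hN I ρ hI
    omega
  · have := hN I ρ hI
    have := bit_lt_two (a I ρ) 1
    omega

theorem pt_had (hD : p.Dom D) (ha : PT D a) (hz : PT D z) :
    PT D (fun I ρ => had (a I ρ) (z I ρ)) := by
  have hN : ∀ I ρ, D I ρ → 16 ≤ I.N := fun I ρ hI => (hD I ρ hI).sixteen_le
  have hbit : ∀ {f}, PT D f → ∀ i < 2, PT D (fun I ρ => bit (f I ρ) i) := fun hf i hi =>
    PT.bit hf (PT.lit i) fun I ρ hI => by
      have := hN I ρ hI
      omega
  refine PT.mod_two ((PT.mul (hbit ha 0 (by omega)) (hbit hz 0 (by omega)) fun I ρ hI => ?_).add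
    (PT.mul (hbit ha 1 (by omega)) (hbit hz 1 (by omega)) fun I ρ hI => ?_))
  · have := hN I ρ hI
    have := bit_lt_two (a I ρ) 0
    omega
  · have := hN I ρ hI
    have := bit_lt_two (a I ρ) 1
    omega

theorem pt_bobBit (hD : p.Dom D) (ha : PT D a) (hz : PT D z) (h : ∀ I ρ, D I ρ → a I ρ ≤ I.N) :
    PT D (fun I ρ => had (a I ρ % 3 + 1) (z I ρ)) :=
  pt_had hD ((PT.mod ha (PT.lit 3) h fun _ _ _ => by norm_num).add (PT.lit 1)) hz

theorem pt_bobFits (hD : p.Dom D) (hj : PT D j) (hz : PT D z)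
    (h : ∀ I ρ, D I ρ → j I ρ < (p.cfg I.n).blocks) :
    PTp D (fun I ρ => (p.cfg I.n).bobFits I.w (j I ρ) (z I ρ)) := by
  have hround := PT.loadw (pt_round (hD.up (R := fun I ρ => ρ 0 < 3 * (p.cfg I.n).u)) hj.up
    (PT.var 0) fun I ρ hI => h I _ hI.1)
  refine PTp.ball (P := fun I ρ y => I.w (j I ρ * (11 * (p.cfg I.n).u) + y) = 2 ∨
    I.w (j I ρ * (11 * (p.cfg I.n).u) + y) = had (y % 3 + 1) (z I ρ)) (PT.lit_mul 3 pt_u)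
    (fun I ρ hI => ?_) (PTp.or (PTp.eq hround (PT.lit 2)) (PTp.eq hround
      (pt_bobBit hD.up (PT.var 0) hz.up fun I ρ hI => ?_)))
  · have := u_le (hD I ρ hI)
    omega
  · have h1 := u_le (hD I _ hI.1)
    have h2 := hI.2
    beta_reduce at h2
    omega

theorem pt_fits {F : Inp → (ℕ → ℕ) → ℕ → ℕ} (hD : p.Dom D) (hj : PT D j)
    (h : ∀ I ρ, D I ρ → j I ρ < (p.cfg I.n).blocks)
    (hF : PT (fun I ρ => D I (tl ρ) ∧ ρ 0 < 8 * (p.cfg I.n).u) (fun I ρ => F I (tl ρ) (ρ 0))) :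
    PTp D (fun I ρ => (p.cfg I.n).fits I.w (j I ρ) (F I ρ)) := by
  have hround := PT.loadw (pt_aliceRound (hD.up (R := fun I ρ => ρ 0 < 8 * (p.cfg I.n).u)) hj.up
    (PT.var 0) fun I ρ hI => h I _ hI.1)
  refine PTp.ball (P := fun I ρ a => I.w (j I ρ * (11 * (p.cfg I.n).u) + 3 * (p.cfg I.n).u + a) = 2 ∨
    I.w (j I ρ * (11 * (p.cfg I.n).u) + 3 * (p.cfg I.n).u + a) = F I ρ a) (PT.lit_mul 8 pt_u)
    (fun I ρ hI => ?_) (PTp.or (PTp.eq hround (PT.lit 2)) (PTp.eq hround hF))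
  have := u_le (hD I ρ hI)
  omega

theorem pt_decode (hD : p.Dom D) (hj : PT D j) (h : ∀ I ρ, D I ρ → j I ρ < (p.cfg I.n).blocks) :
    PT D (fun I ρ => (p.cfg I.n).decode I.w (j I ρ)) := by
  refine PT.search (P := fun I ρ z => (p.cfg I.n).bobFits I.w (j I ρ) z) (PT.lit 4) (fun I ρ hI => ?_)
    (pt_bobFits hD.up hj.up (PT.var 0) fun I ρ hI => h I _ hI.1)
  have := (hD I ρ hI).sixteen_le
  omega

theorem pt_unique (hD : p.Dom D) (hj : PT D j) (h : ∀ I ρ, D I ρ → j I ρ < (p.cfg I.n).blocks) :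
    PTp D (fun I ρ => (p.cfg I.n).Unique I.w (j I ρ)) := by
  refine PTp.ball (P := fun I ρ z => (p.cfg I.n).bobFits I.w (j I ρ) z →
      z = (p.cfg I.n).decode I.w (j I ρ)) (PT.lit 4) (fun I ρ hI => ?_)
    (((pt_bobFits hD.up hj.up (PT.var 0) fun I ρ hI => h I _ hI.1).not.or
      (PTp.eq (PT.var 0) (pt_decode hD.up hj.up fun I ρ hI => h I _ hI.1))).congr
      fun I ρ hI => Decidable.imp_iff_not_or.symm)
  have := (hD I ρ hI).sixteen_le
  omega

theorem pt_react (hX : PT D X) (hz : PT D z) (hS : PT D S) (h : ∀ I ρ, D I ρ → S I ρ / 4 ≤ I.N) :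
    PT D (fun I ρ => react (X I ρ) (z I ρ) (S I ρ)) :=
  PT.cond (PTp.eq hz (PT.lit 2))
    (((PT.lit_mul 4 hS.div_four).add (PT.lit 2)).add (PT.bit hX hS.div_four h))
    (PT.cond (PTp.eq hz (PT.lit 3))
      (((PT.lit_mul 4 hS.div_four).add (PT.lit 2)).add hS.div_four.mod_two)
      (PT.cond (PTp.eq hS.div_four.mod_two hz).not (hS.add (PT.lit 4)) hS))

theorem pt_aSt (hD : p.Dom D) (hX : PT D X) (hj : PT D j)
    (h : ∀ I ρ, D I ρ → j I ρ ≤ (p.cfg I.n).blocks) :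
    PT D (fun I ρ => (p.cfg I.n).aSt (X I ρ) I.w (j I ρ)) := by
  have hlt : ∀ I ρ, D I (tl (tl ρ)) ∧ ρ 1 < j I (tl (tl ρ)) ∧ ρ 0 =
      iter ((p.cfg I.n).aStep (X I (tl (tl ρ))) I.w) 0 (ρ 1) → ρ 1 < (p.cfg I.n).blocks :=
    fun I ρ hI => hI.2.1.trans_le (h I _ hI.1)
  refine PT.iter (g := fun I ρ => (p.cfg I.n).aStep (X I ρ) I.w) hj
    (fun I ρ hI => (h I ρ hI).trans (blocks_le (hD I ρ hI))) (PT.lit 0)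
    (PT.cond ((PTp.eq (PT.var 0).half.mod_two (PT.lit 0)).and (pt_unique hD.up2 (PT.var 1) hlt))
      (pt_react hX.up2 (pt_decode hD.up2 (PT.var 1) hlt) (PT.var 0) fun I ρ hI => ?_) (PT.var 0))
  have h1 := (p.cfg I.n).aSt_div_le (X I (tl (tl ρ))) I.w (ρ 1)
  have h2 := (hlt I ρ hI).le.trans (blocks_le (hD I _ hI.1))
  have h3 : ρ 0 = (p.cfg I.n).aSt (X I (tl (tl ρ))) I.w (ρ 1) := hI.2.2
  rw [← h3] at h1
  omega

theorem pt_aWord (hD : p.Dom D) (hX : PT D X) (hS : PT D S) (hj : PT D j) (ha : PT D a)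
    (h : ∀ I ρ, D I ρ → j I ρ < (p.cfg I.n).blocks) :
    PT D (fun I ρ => (p.cfg I.n).aWord (X I ρ) (S I ρ) (j I ρ) (a I ρ)) :=
  PT.cond (PTp.eq hS.half.mod_two (PT.lit 1)) hS.mod_two
    (pt_wb hD hX hS.div_four.mod_two hj ha h)

/-- The stored list is far larger than `N`, so `PT.mod` does not apply to it. The vector is
assembled from single digits instead, whose positions are at most `n * (n + 1)`. -/
theorem pt_vec (hD : p.Dom D) (hB : PT D B) (hi : PT D i) (h : ∀ I ρ, D I ρ → i I ρ ≤ I.n) :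
    PT D (fun I ρ => (p.cfg I.n).vec (B I ρ) (i I ρ)) := by
  have hn : ∀ I : Inp, p.Big I.n I.N → I.n ≤ I.N := fun I hI => by
    have := hI.n_lt
    omega
  refine (PT.ofBits (g := fun I ρ r => bit (B I ρ) (I.n * i I ρ + r)) PT.n
    (fun I ρ hI => hn I (hD I ρ hI)) (PT.bit hB.up ((PT.mul PT.n hi.up fun I ρ hI => ?_).add (PT.var 0))
      fun I ρ hI => ?_)).congr fun I ρ hI => (div_mod_eq_ofBits _ _ _).symm
  · exact hn I (hD I _ hI.1)
  · have h1 := (hD I _ hI.1).sq_le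
    have h2 : I.n * i I (tl ρ) ≤ I.n * I.n := Nat.mul_le_mul_left _ (h I _ hI.1)
    have h3 := hI.2
    rw [mul_add, mul_one] at h1
    omega

theorem pt_pack {g : Inp → (ℕ → ℕ) → ℕ → ℕ} (hD : p.Dom D)
    (hg : PT (fun I ρ => D I (tl ρ) ∧ ρ 0 < I.n + 1) (fun I ρ => g I (tl ρ) (ρ 0))) :
    PT D (fun I ρ => (p.cfg I.n).pack (g I ρ)) := by
  refine PT.sum (g := fun I ρ i => g I ρ i * 2 ^ (I.n * i)) (PT.n.add (PT.lit 1))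
    (fun I ρ hI => (hD I ρ hI).n_lt) (PT.shl hg (PT.mul PT.n (PT.var 0) fun I ρ hI => ?_)
      fun I ρ hI => ?_)
  · have := (hD I _ hI.1).n_lt
    omega
  · have h1 := (hD I _ hI.1).sq_le
    have h2 : I.n * ρ 0 ≤ I.n * (I.n + 1) := Nat.mul_le_mul_left _ hI.2.le
    exact h2.trans h1

theorem pt_pivot (hD : p.Dom D) (hB : PT D B) (hj : PT D j) (ha : PT D a)
    (h : ∀ I ρ, D I ρ → j I ρ < (p.cfg I.n).blocks) :
    PT D (fun I ρ => (p.cfg I.n).pivot (B I ρ) (j I ρ) (a I ρ)) := by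
  refine PT.search (P := fun I ρ i => (p.cfg I.n).lin ((p.cfg I.n).vec (B I ρ) i) (j I ρ) (a I ρ) = 1)
    pt_n (fun I ρ hI => ?_) (PTp.eq (pt_lin hD.up (pt_vec hD.up hB.up (PT.var 0) fun I ρ hI => hI.2.le)
      hj.up ha.up fun I ρ hI => h I _ hI.1) (PT.lit 1))
  exact (Nat.le_succ _).trans (hD I ρ hI).n_lt

theorem pt_newVec (hD : p.Dom D) (hB : PT D B) (hj : PT D j) (ha : PT D a) (hr : PT D r)
    (hi : PT D i) (h : ∀ I ρ, D I ρ → j I ρ < (p.cfg I.n).blocks)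
    (h' : ∀ I ρ, D I ρ → i I ρ ≤ I.n) :
    PT D (fun I ρ => (p.cfg I.n).newVec (B I ρ) (j I ρ) (a I ρ) (r I ρ) (i I ρ)) := by
  have hvec := pt_vec hD hB hi h'
  have hlin := pt_lin hD hvec hj ha h
  refine PT.cond (PTp.or (PTp.and (PTp.lt hi pt_n) (PTp.eq hlin (PT.lit 1)))
    (PTp.and (PTp.lt hi pt_n).not (PTp.eq hlin (PT.mod_two (hr.add (PT.bit ha (PT.lit 0)
      fun I ρ hI => Nat.zero_le _)))).not)) (PT.xor hvec (pt_vec hD hB (pt_pivot hD hB hj ha h) ?_) ?_)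
    hvec
  · exact fun I ρ hI => search_le _ _
  · intro I ρ hI
    have h1 := (hD I ρ hI).n_lt
    have h2 : 2 ^ (p.cfg I.n).n ≤ 2 ^ I.N :=
      Nat.pow_le_pow_right (by norm_num) ((Nat.le_succ _).trans h1)
    exact ⟨(Scheme.vec_lt _ _).trans_le h2, (Scheme.vec_lt _ _).trans_le h2⟩

theorem pt_basStep (hD : p.Dom D) (hι : PT D ι) (hτ : PT D τ) (hB : PT D B)
    (h : ∀ I ρ, D I ρ → ι I ρ < (p.cfg I.n).K ∧ τ I ρ < (p.cfg I.n).len * (8 * (p.cfg I.n).u)) :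
    PT D (fun I ρ => (p.cfg I.n).basStep I.w (ι I ρ) (τ I ρ) (B I ρ)) := by
  have hu : PT D (fun I _ => 8 * (p.cfg I.n).u) := PT.lit_mul 8 pt_u
  have hτN : ∀ I ρ, D I ρ → τ I ρ ≤ I.N := fun I ρ hI => (h I ρ hI).2.le.trans (hD I ρ hI).len_le
  have hpos : ∀ I ρ, D I ρ → 0 < 8 * (p.cfg I.n).u := fun I ρ _ => by
    have := (p.cfg I.n).u_pos
    omega
  have hj : PT D (fun I ρ => ι I ρ * (p.cfg I.n).len + τ I ρ / (8 * (p.cfg I.n).u)) :=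
    PT.add (PT.mul hι (pt_len hD) fun I ρ hI => (h I ρ hI).1.le.trans (hD I ρ hI).K_le)
      (PT.div hτ hu hτN hpos)
  have ha : PT D (fun I ρ => τ I ρ % (8 * (p.cfg I.n).u)) := PT.mod hτ hu hτN hpos
  have hb : ∀ I ρ, D I ρ → ι I ρ * (p.cfg I.n).len + τ I ρ / (8 * (p.cfg I.n).u) <
      (p.cfg I.n).blocks := fun I ρ hI => Scheme.block_lt (h I ρ hI).1
        ((Nat.div_lt_iff_lt_mul (hpos I ρ hI)).mpr (h I ρ hI).2)
  have hw := PT.loadw (pt_aliceRound hD hj ha hb)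
  exact PT.cond (PTp.eq hw (PT.lit 2)) hB (pt_pack
    (g := fun I ρ => (p.cfg I.n).newVec (B I ρ)
      (ι I ρ * (p.cfg I.n).len + τ I ρ / (8 * (p.cfg I.n).u)) (τ I ρ % (8 * (p.cfg I.n).u))
      (I.w ((ι I ρ * (p.cfg I.n).len + τ I ρ / (8 * (p.cfg I.n).u)) * (11 * (p.cfg I.n).u) +
        3 * (p.cfg I.n).u + τ I ρ % (8 * (p.cfg I.n).u)))) hD
    (pt_newVec hD.up hB.up hj.up ha.up hw.up (PT.var 0) (fun I ρ hI => hb I _ hI.1)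
      fun I ρ hI => Nat.lt_succ_iff.mp hI.2))

theorem pt_bas (hD : p.Dom D) (hι : PT D ι) (h : ∀ I ρ, D I ρ → ι I ρ < (p.cfg I.n).K) :
    PT D (fun I ρ => (p.cfg I.n).bas I.w (ι I ρ)) := by
  refine PT.iter (g := fun I ρ => (p.cfg I.n).basStep I.w (ι I ρ))
    (PT.mul (pt_len hD) (PT.lit_mul 8 pt_u) fun I ρ hI => len_le (hD I ρ hI))
    (fun I ρ hI => (hD I ρ hI).len_le)
    (pt_pack (g := fun I _ i => if i < (p.cfg I.n).n then 2 ^ i else 0) hD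
      (PT.cond (PTp.lt (PT.var 0) pt_n) (PT.two_pow (PT.var 0) fun I ρ hI => ?_) (PT.lit 0)))
    (pt_basStep hD.up2 hι.up2 (PT.var 1) (PT.var 0) fun I ρ hI => ⟨h I _ hI.1, hI.2.1⟩)
  exact hI.2.le.trans (hD I _ hI.1).n_lt

theorem pt_narrow (hD : p.Dom D) (hι : PT D ι) (h : ∀ I ρ, D I ρ → ι I ρ < (p.cfg I.n).K) :
    PTp D (fun I ρ => (p.cfg I.n).Narrow I.w (ι I ρ)) := by
  refine PTp.le (PT.sum (g := fun I ρ i => if (p.cfg I.n).vec ((p.cfg I.n).bas I.w (ι I ρ)) i ≠ 0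
    then 1 else 0) pt_n (fun I ρ hI => ?_) (PT.cond (PTp.ne_zero (pt_vec hD.up (pt_bas hD hι h).up
      (PT.var 0) fun I ρ hI => hI.2.le)) (PT.lit 1) (PT.lit 0))) (PT.lit 1)
  exact (Nat.le_succ _).trans (hD I ρ hI).n_lt

theorem pt_cand (hD : p.Dom D) (hι : PT D ι) (hk : PT D k)
    (h : ∀ I ρ, D I ρ → ι I ρ < (p.cfg I.n).K) :
    PT D (fun I ρ => (p.cfg I.n).cand I.w (ι I ρ) (k I ρ)) := by
  have hB := pt_bas hD hι h
  have hn := pt_vec hD hB PT.n fun I ρ hI => le_rfl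
  refine PT.cond (PTp.eq hk (PT.lit 0)) hn (PT.xor hn (pt_vec hD hB (PT.search
    (P := fun I ρ i => (p.cfg I.n).vec ((p.cfg I.n).bas I.w (ι I ρ)) i ≠ 0) pt_n (fun I ρ hI => ?_)
    (PTp.ne_zero (pt_vec hD.up hB.up (PT.var 0) fun I ρ hI => hI.2.le))) fun I ρ hI => search_le _ _)
    fun I ρ hI => ?_)
  · exact (Nat.le_succ _).trans (hD I ρ hI).n_lt
  · have h1 := (hD I ρ hI).n_lt
    have h2 : 2 ^ (p.cfg I.n).n ≤ 2 ^ I.N :=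
      Nat.pow_le_pow_right (by norm_num) ((Nat.le_succ _).trans h1)
    exact ⟨(Scheme.vec_lt _ _).trans_le h2, (Scheme.vec_lt _ _).trans_le h2⟩

theorem pt_idx (hD : p.Dom D) (hι : PT D ι) (h : ∀ I ρ, D I ρ → ι I ρ < (p.cfg I.n).K) :
    PT D (fun I ρ => (p.cfg I.n).idx I.w (ι I ρ)) := by
  have hN : ∀ I ρ, D I ρ → (p.cfg I.n).n ≤ I.N := fun I ρ hI =>
    (Nat.le_succ _).trans (hD I ρ hI).n_lt
  refine PT.search (P := fun I ρ i => bit ((p.cfg I.n).cand I.w (ι I ρ) 0) i ≠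
    bit ((p.cfg I.n).cand I.w (ι I ρ) 1) i) pt_n hN (PTp.not (PTp.eq
      (PT.bit (pt_cand hD hι (PT.lit 0) h).up (PT.var 0) fun I ρ hI => hI.2.le.trans (hN I _ hI.1))
      (PT.bit (pt_cand hD hι (PT.lit 1) h).up (PT.var 0) fun I ρ hI => hI.2.le.trans (hN I _ hI.1))))

theorem pt_par (hS : PT D S) (hk : PT D k) : PT D (fun I ρ => Scheme.par (S I ρ) (k I ρ)) :=
  PT.cond (PTp.eq hS.div_four.mod_four (PT.lit 1)) (PT.cond (PTp.eq hk (PT.lit 0)) hS.half.mod_two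
    ((PT.lit 1).sub hS.half.mod_two)) hS.div_sixteen.mod_two

theorem pt_asks (hD : p.Dom D) (hι : PT D ι) (hS : PT D S)
    (h : ∀ I ρ, D I ρ → ι I ρ < (p.cfg I.n).K) :
    PTp D (fun I ρ => (p.cfg I.n).Asks I.w (ι I ρ) (S I ρ)) :=
  PTp.or (PTp.eq hS.div_four.mod_four (PT.lit 1)) (PTp.eq hS.div_sixteen (pt_idx hD hι h))

theorem pt_answer (hD : p.Dom D) (hι : PT D ι) (hS : PT D S) (hk : PT D k)
    (h : ∀ I ρ, D I ρ → ι I ρ < (p.cfg I.n).K) :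
    PT D (fun I ρ => (p.cfg I.n).answer I.w (ι I ρ) (S I ρ) (k I ρ)) :=
  PT.cond (PTp.eq hS.div_four.mod_four (PT.lit 1)) (pt_par hS hk)
    (PT.bit (pt_cand hD hι hk h) (pt_idx hD hι h) fun I ρ hI =>
      (search_le _ _).trans ((Nat.le_succ _).trans (hD I ρ hI).n_lt))

theorem pt_wordU (hD : p.Dom D) (hι : PT D ι) (hS : PT D S) (hj : PT D j) (hk : PT D k) (ha : PT D a)
    (h : ∀ I ρ, D I ρ → ι I ρ < (p.cfg I.n).K) (h' : ∀ I ρ, D I ρ → j I ρ < (p.cfg I.n).blocks) :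
    PT D (fun I ρ => (p.cfg I.n).wordU I.w (ι I ρ) (S I ρ) (j I ρ) (k I ρ) (a I ρ)) :=
  pt_wb hD (pt_cand hD hι hk h) (pt_par hS hk) hj ha h'

theorem pt_wordM (hD : p.Dom D) (hι : PT D ι) (hS : PT D S) (hj : PT D j) (hk : PT D k) (ha : PT D a)
    (h : ∀ I ρ, D I ρ → ι I ρ < (p.cfg I.n).K) (h' : ∀ I ρ, D I ρ → j I ρ < (p.cfg I.n).blocks) :
    PT D (fun I ρ => (p.cfg I.n).wordM I.w (ι I ρ) (S I ρ) (j I ρ) (k I ρ) (a I ρ)) :=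
  PT.cond (pt_asks hD hι hS h) (pt_answer hD hι hS hk h)
    (pt_wb hD (pt_cand hD hι hk h) (hS.div_sixteen.add (PT.lit 1)).mod_two hj ha h')

theorem pt_lastBit (hD : p.Dom D) (hj : PT D j) (hr : PT D r)
    (h : ∀ I ρ, D I ρ → j I ρ < (p.cfg I.n).blocks) :
    PT D (fun I ρ => (p.cfg I.n).lastBit I.w (j I ρ) (r I ρ)) := by
  refine PT.iter (g := fun I ρ a r => if I.w (j I ρ * (11 * (p.cfg I.n).u) + 3 * (p.cfg I.n).u + a) = 2
    then r else I.w (j I ρ * (11 * (p.cfg I.n).u) + 3 * (p.cfg I.n).u + a)) (PT.lit_mul 8 pt_u)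
    (fun I ρ hI => ?_) hr (PT.cond (PTp.eq (PT.loadw (pt_aliceRound hD.up2 hj.up2 (PT.var 1)
      fun I ρ hI => h I _ hI.1)) (PT.lit 2)) (PT.var 0) (PT.loadw (pt_aliceRound hD.up2 hj.up2
      (PT.var 1) fun I ρ hI => h I _ hI.1)))
  have := u_le (hD I ρ hI)
  omega

theorem pt_bNext {U M : Inp → (ℕ → ℕ) → ℕ → Prop} [∀ I ρ, DecidablePred (U I ρ)]
    [∀ I ρ, DecidablePred (M I ρ)] (hD : p.Dom D) (hι : PT D ι) (hj : PT D j) (hS : PT D S)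
    (hU : ∀ k, PTp D (fun I ρ => U I ρ k)) (hM : ∀ k, PTp D (fun I ρ => M I ρ k))
    (h : ∀ I ρ, D I ρ → ι I ρ < (p.cfg I.n).K) (h' : ∀ I ρ, D I ρ → j I ρ < (p.cfg I.n).blocks) :
    PT D (fun I ρ => (p.cfg I.n).bNext I.w (ι I ρ) (j I ρ) (S I ρ) (U I ρ) (M I ρ)) := by
  have h16 : PT D (fun I ρ => 16 * (S I ρ / 16)) := PT.lit_mul 16 hS.div_sixteen
  have hor : ∀ k, PTp D (fun I ρ => U I ρ k ∨ M I ρ k) := fun k => (hU k).or (hM k)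
  exact PT.cond (PTp.eq hS.div_four.mod_four (PT.lit 2)) hS
    (PT.cond ((hor 0).and (hor 1).not) (h16.add (PT.lit 8))
    (PT.cond ((hor 1).and (hor 0).not) (h16.add (PT.lit 10))
    (PT.cond (pt_asks hD hι hS h) ((hS.sub hS.mod_two).add (pt_lastBit hD hj hS.mod_two h'))
    (PT.cond (((hM 0).and (hM 1)).and ((hU 0).or (hU 1)).not)
      (PT.lit_mul 16 (hS.div_sixteen.add (PT.lit 1)))
    (PT.cond (((hU 0).and (hM 1)).and ((hM 0).or (hU 1)).not)
      ((h16.add (PT.lit 4)).add (PT.lit_mul 2 hS.div_sixteen.mod_two))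
    (PT.cond (((hM 0).and (hU 1)).and ((hU 0).or (hM 1)).not)
      ((h16.add (PT.lit 4)).add (PT.lit_mul 2 (hS.div_sixteen.add (PT.lit 1)).mod_two)) hS))))))

theorem pt_bStep (hD : p.Dom D) (hι : PT D ι) (hj : PT D j) (hS : PT D S)
    (h : ∀ I ρ, D I ρ → ι I ρ < (p.cfg I.n).K) (h' : ∀ I ρ, D I ρ → j I ρ < (p.cfg I.n).blocks) :
    PT D (fun I ρ => (p.cfg I.n).bStep I.w (ι I ρ) (j I ρ) (S I ρ)) :=
  pt_bNext
    (U := fun I ρ k => (p.cfg I.n).fits I.w (j I ρ) ((p.cfg I.n).wordU I.w (ι I ρ) (S I ρ) (j I ρ) k))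
    (M := fun I ρ k => (p.cfg I.n).fits I.w (j I ρ) ((p.cfg I.n).wordM I.w (ι I ρ) (S I ρ) (j I ρ) k))
    hD hι hj hS
    (fun k => pt_fits (F := fun I ρ => (p.cfg I.n).wordU I.w (ι I ρ) (S I ρ) (j I ρ) k) hD hj h'
      (pt_wordU hD.up hι.up hS.up hj.up (PT.lit k) (PT.var 0) (fun I _ hI => h I _ hI.1)
        fun I _ hI => h' I _ hI.1))
    (fun k => pt_fits (F := fun I ρ => (p.cfg I.n).wordM I.w (ι I ρ) (S I ρ) (j I ρ) k) hD hj h'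
      (pt_wordM hD.up hι.up hS.up hj.up (PT.lit k) (PT.var 0) (fun I _ hI => h I _ hI.1)
        fun I _ hI => h' I _ hI.1)) h h'

theorem pt_bSt (hD : p.Dom D) (hι : PT D ι) (hj : PT D j) (h : ∀ I ρ, D I ρ → ι I ρ < (p.cfg I.n).K)
    (h' : ∀ I ρ, D I ρ → j I ρ ≤ (p.cfg I.n).blocks) :
    PT D (fun I ρ => (p.cfg I.n).bSt I.w (ι I ρ) (j I ρ)) := by
  refine PT.iter (g := fun I ρ j S => if (ι I ρ + 1) * (p.cfg I.n).len ≤ j then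
    (p.cfg I.n).bStep I.w (ι I ρ) j S else S) hj
    (fun I ρ hI => (h' I ρ hI).trans (blocks_le (hD I ρ hI))) (PT.lit 0)
    (PT.cond (PTp.le (PT.mul (hι.up2.add (PT.lit 1)) (pt_len hD.up2) fun I ρ hI => ?_) (PT.var 1))
      (pt_bStep hD.up2 hι.up2 (PT.var 1) (PT.var 0) (fun I ρ hI => h I _ hI.1)
        fun I ρ hI => hI.2.1.trans_le (h' I _ hI.1)) (PT.var 0))
  exact (Nat.succ_le_of_lt (h I _ hI.1)).trans (hD I _ hI.1).K_le

theorem pt_bSym (hD : p.Dom D) (hι : PT D ι) (hS : PT D S)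
    (h : ∀ I ρ, D I ρ → ι I ρ < (p.cfg I.n).K) :
    PT D (fun I ρ => (p.cfg I.n).bSym I.w (ι I ρ) (S I ρ)) :=
  PT.cond (PTp.eq hS.div_four.mod_four (PT.lit 1)) (PT.lit 3)
    (PT.cond (PTp.eq hS.div_four.mod_four (PT.lit 2)) (PT.lit 0)
      (PT.cond (PTp.eq hS.div_sixteen (pt_idx hD hι h)) (PT.lit 2)
        (hS.div_sixteen.add (PT.lit 1)).mod_two))

theorem pt_sel (hD : p.Dom D) (hb : PT D b) (h : ∀ I ρ, D I ρ → b I ρ ≤ (p.cfg I.n).K) :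
    PT D (fun I ρ => (p.cfg I.n).sel I.w (b I ρ)) := by
  have hlt : ∀ I ρ, D I (tl ρ) ∧ ρ 0 < b I (tl ρ) → ρ 0 < (p.cfg I.n).K := fun I ρ hI =>
    hI.2.trans_le (h I _ hI.1)
  refine PT.search (P := fun I _ ι => (p.cfg I.n).Narrow I.w ι ∧
    ∀ ι' < ι, ¬ (p.cfg I.n).Narrow I.w ι') hb (fun I ρ hI => (h I ρ hI).trans (hD I ρ hI).K_le)
    (PTp.and (pt_narrow hD.up (PT.var 0) hlt) (PTp.ball
      (P := fun I _ ι' => ¬ (p.cfg I.n).Narrow I.w ι') (PT.var 0) (fun I ρ hI => ?_)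
      (pt_narrow (fun I _ h => hD I _ h.1.1) (PT.var 0) fun I ρ hI => ?_).not))
  · exact (hlt I ρ hI).le.trans (hD I _ hI.1).K_le
  · exact hI.2.trans (hlt I (tl ρ) hI.1)

theorem sel_lt {c : Scheme} {w : ℕ → ℕ} {b : ℕ} (h : ∃ ι < b, c.Narrow w ι) : c.sel w b < b := by
  refine (search_spec (p := fun ι => c.Narrow w ι ∧ ∀ ι' < ι, ¬ c.Narrow w ι') ?_).1
  have hs := Nat.find_spec h
  exact ⟨Nat.find h, hs.1, hs.2, fun ι' hι' hn => Nat.find_min h hι' ⟨hι'.trans hs.1, hn⟩⟩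

theorem pt_bobSym (hD : p.Dom D) (hj : PT D j) (h : ∀ I ρ, D I ρ → j I ρ < (p.cfg I.n).blocks) :
    PT D (fun I ρ => (p.cfg I.n).bobSym I.w (j I ρ)) := by
  have hdiv : PT D (fun I ρ => j I ρ / (p.cfg I.n).len) := PT.div hj (pt_len hD)
    (fun I ρ hI => (h I ρ hI).le.trans (blocks_le (hD I ρ hI))) fun I ρ hI => len_pos (hD I ρ hI)
  have hK : ∀ I ρ, D I ρ → j I ρ / (p.cfg I.n).len ≤ (p.cfg I.n).K := fun I ρ hI =>
    ((Nat.div_lt_iff_lt_mul (len_pos (hD I ρ hI))).mpr (h I ρ hI)).le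
  have hsel := (pt_sel hD hdiv hK).restrict
    (R := fun I ρ => ∃ ι < j I ρ / (p.cfg I.n).len, (p.cfg I.n).Narrow I.w ι)
  have hlt : ∀ I ρ, (D I ρ ∧ ∃ ι < j I ρ / (p.cfg I.n).len, (p.cfg I.n).Narrow I.w ι) →
      (p.cfg I.n).sel I.w (j I ρ / (p.cfg I.n).len) < (p.cfg I.n).K := fun I ρ hI =>
    (sel_lt hI.2).trans_le (hK I ρ hI.1)
  exact PT.ite (PTp.bex (P := fun I _ ι => (p.cfg I.n).Narrow I.w ι) hdiv
      (fun I ρ hI => (hK I ρ hI).trans (hD I ρ hI).K_le)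
      (pt_narrow hD.up (PT.var 0) fun I ρ hI => hI.2.trans_le (hK I _ hI.1)))
    (pt_bSym hD.restrict hsel (pt_bSt hD.restrict hsel hj.restrict hlt fun I ρ hI => (h I ρ hI.1).le)
      hlt) (PT.lit 0)

theorem pt_verdict (hD : p.Dom D) (hι : PT D ι) (hS : PT D S)
    (h : ∀ I ρ, D I ρ → ι I ρ < (p.cfg I.n).K) :
    PT D (fun I ρ => (p.cfg I.n).verdict I.w (ι I ρ) (S I ρ)) :=
  PT.cond (PTp.eq hS.div_four.mod_four (PT.lit 2)) hS.half.mod_two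
    (PT.cond (PTp.eq (pt_answer hD hι hS (PT.lit 0) h) hS.mod_two) (PT.lit 0) (PT.lit 1))

theorem pt_blocks (hD : p.Dom D) : PT D (fun I _ => (p.cfg I.n).blocks) :=
  PT.mul pt_K (pt_len hD) fun I ρ hI => (hD I ρ hI).K_le

theorem pt_out (hD : p.Dom D) : PT D (fun I _ => (p.cfg I.n).out I.w) := by
  have hsel := (pt_sel hD pt_K fun I ρ hI => le_rfl).restrict
    (R := fun I _ => ∃ ι < (p.cfg I.n).K, (p.cfg I.n).Narrow I.w ι)
  have hlt : ∀ I ρ, (D I ρ ∧ ∃ ι < (p.cfg I.n).K, (p.cfg I.n).Narrow I.w ι) →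
      (p.cfg I.n).sel I.w (p.cfg I.n).K < (p.cfg I.n).K := fun I ρ hI => sel_lt hI.2
  exact PT.ite (PTp.bex (P := fun I _ ι => (p.cfg I.n).Narrow I.w ι) pt_K
      (fun I ρ hI => (hD I ρ hI).K_le) (pt_narrow hD.up (PT.var 0) fun I ρ hI => hI.2))
    (pt_cand hD.restrict hsel (pt_verdict hD.restrict hsel (pt_bSt hD.restrict hsel
      (pt_blocks hD).restrict hlt fun I ρ hI => le_rfl) hlt) hlt) (PT.lit 0)

end Params

end RAM

/-! ## The interactive code -/

namespace RAM

namespace Scheme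

/-! ### Causality: each party uses only what it has already seen. -/

variable {c : Scheme} {w w' : ℕ → ℕ} {ι j J : ℕ}

theorem round_lt {y : ℕ} (hj : j < J) (hy : y < 11 * c.u) : j * (11 * c.u) + y < J * (11 * c.u) := by
  have := Nat.mul_le_mul_right (11 * c.u) (Nat.succ_le_of_lt hj)
  rw [Nat.succ_mul] at this
  omega

theorem round_div {y : ℕ} (hy : y < 11 * c.u) : (j * (11 * c.u) + y) / (11 * c.u) = j := by
  rw [mul_comm j, Nat.mul_add_div (by omega), Nat.div_eq_of_lt hy, add_zero]

theorem round_mod {y : ℕ} (hy : y < 11 * c.u) : (j * (11 * c.u) + y) % (11 * c.u) = y := by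
  rw [mul_comm j, Nat.mul_add_mod, Nat.mod_eq_of_lt hy]

theorem aliceRound_eq (h : ∀ i < J * (11 * c.u), w i = w' i) (hj : j < J) {a : ℕ}
    (ha : a < 8 * c.u) :
    w (j * (11 * c.u) + 3 * c.u + a) = w' (j * (11 * c.u) + 3 * c.u + a) := by
  rw [add_assoc]
  exact h _ (round_lt hj (by omega))

theorem fits_congr (h : ∀ i < J * (11 * c.u), w i = w' i) (hj : j < J) (f : ℕ → ℕ) :
    c.fits w j f ↔ c.fits w' j f :=
  forall₂_congr fun a ha => by rw [aliceRound_eq h hj ha]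

theorem bas_congr (h : ∀ i < J * (11 * c.u), w i = w' i) (hι : (ι + 1) * c.len ≤ J) :
    c.bas w ι = c.bas w' ι := by
  have hu := c.u_pos
  refine iter_congr fun τ hτ B => ?_
  have hj : ι * c.len + τ / (8 * c.u) < J := by
    have := (Nat.div_lt_iff_lt_mul (by omega)).mpr hτ
    rw [Nat.succ_mul] at hι
    omega
  unfold basStep
  rw [aliceRound_eq h hj (Nat.mod_lt _ (by omega))]

theorem narrow_congr (h : c.bas w ι = c.bas w' ι) : c.Narrow w ι ↔ c.Narrow w' ι := by
  unfold Narrow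
  rw [h]

theorem cand_congr (h : c.bas w ι = c.bas w' ι) (k : ℕ) : c.cand w ι k = c.cand w' ι k := by
  unfold cand
  rw [h]

theorem idx_congr (h : c.bas w ι = c.bas w' ι) : c.idx w ι = c.idx w' ι :=
  search_congr fun i _ => by rw [cand_congr h, cand_congr h]

theorem bNext_congr (h : c.idx w ι = c.idx w' ι) {S : ℕ} {U M U' M' : ℕ → Prop} [DecidablePred U]
    [DecidablePred M] [DecidablePred U'] [DecidablePred M'] (hU : ∀ k, U k ↔ U' k)
    (hM : ∀ k, M k ↔ M' k) (hl : c.lastBit w j (S % 2) = c.lastBit w' j (S % 2)) :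
    c.bNext w ι j S U M = c.bNext w' ι j S U' M' := by
  simp only [bNext, hU, hM, hl, Asks, h]

theorem bStep_congr (h : ∀ i < J * (11 * c.u), w i = w' i) (hι : (ι + 1) * c.len ≤ J) (hj : j < J)
    (S : ℕ) : c.bStep w ι j S = c.bStep w' ι j S := by
  have hb := bas_congr h hι
  refine bNext_congr (idx_congr hb) (fun k => ?_) (fun k => ?_) ?_
  · rw [fits_congr h hj]
    have : c.wordU w ι S j k = c.wordU w' ι S j k := by
      funext a
      rw [wordU, wordU, cand_congr hb]
    rw [this]
  · rw [fits_congr h hj]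
    have : c.wordM w ι S j k = c.wordM w' ι S j k := by
      funext a
      simp only [wordM, answer, Asks, cand_congr hb, idx_congr hb]
    rw [this]
  · exact iter_congr fun a ha r => by rw [aliceRound_eq h hj ha]

theorem bSt_congr (h : ∀ i < J * (11 * c.u), w i = w' i) (hι : (ι + 1) * c.len ≤ J) :
    c.bSt w ι J = c.bSt w' ι J :=
  iter_congr fun j hj S => by rw [bStep_congr h hι hj]

/-- Bob consults only repetitions completed before block `j` and then only blocks before `j`, so his
symbol depends on the rounds before this block. -/
theorem bobSym_congr (h : ∀ i < j * (11 * c.u), w i = w' i) :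
    c.bobSym w j = c.bobSym w' j := by
  have hle : ∀ ι < j / c.len, (ι + 1) * c.len ≤ j := fun ι hι =>
    (Nat.mul_le_mul_right _ (Nat.succ_le_of_lt hι)).trans (Nat.div_mul_le_self _ _)
  have hn : ∀ ι < j / c.len, (c.Narrow w ι ↔ c.Narrow w' ι) := fun ι hι =>
    narrow_congr (bas_congr h (hle ι hι))
  have hex : (∃ ι < j / c.len, c.Narrow w ι) ↔ ∃ ι < j / c.len, c.Narrow w' ι :=
    exists_congr fun ι => and_congr_right fun hι => hn ι hι
  have hsel : c.sel w (j / c.len) = c.sel w' (j / c.len) := search_congr fun ι hι =>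
    and_congr (hn ι hι) (forall₂_congr fun ι' hι' => not_congr (hn ι' (hι'.trans hι)))
  unfold bobSym
  by_cases hx : ∃ ι < j / c.len, c.Narrow w' ι
  · rw [if_pos hx, if_pos (hex.mpr hx), hsel]
    have hlt := hle _ (Params.sel_lt hx)
    rw [bSt_congr h hlt]
    simp only [bSym, idx_congr (bas_congr h hlt)]
  · rw [if_neg hx, if_neg (mt hex.mp hx)]

theorem bobFits_congr (h : ∀ i < j * (11 * c.u) + 3 * c.u, w i = w' i) (z : ℕ) :
    c.bobFits w j z ↔ c.bobFits w' j z :=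
  forall₂_congr fun y hy => by rw [h _ (by omega)]

/-- Bob speaks first in each block, so Alice may use his part of block `j` in her own part of it. -/
theorem aSt_congr (h : ∀ i < j * (11 * c.u) + 3 * c.u, w i = w' i) (X : ℕ) :
    c.aSt X w (j + 1) = c.aSt X w' (j + 1) := by
  refine iter_congr fun l hl S => ?_
  have h1 : ∀ z, c.bobFits w l z ↔ c.bobFits w' l z := fun z => bobFits_congr (fun i hi => h i (by
    have := Nat.mul_le_mul_right (11 * c.u) (Nat.lt_succ_iff.mp hl)
    omega)) z
  have h2 : c.decode w l = c.decode w' l := search_congr fun z _ => h1 z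
  have h3 : c.Unique w l ↔ c.Unique w' l := by
    unfold Unique
    simp only [h1, h2]
  simp only [aStep, h2, h3]

theorem aWord_lt_two (X S j a : ℕ) : c.aWord X S j a < 2 := by
  unfold aWord
  split_ifs
  · exact Nat.mod_lt _ (by norm_num)
  · exact c.wb_lt_two _ _ _ _

end Scheme

/-- The contents of the array for a view. -/
def codes (view : List RecvSym) (i : ℕ) : ℕ := (view.map RecvSym.code).getD i 0

/-- Alice's input as a number. -/
def number {n : ℕ} (x : Fin n → Bool) : ℕ :=
  ofBits (fun i => (List.ofFn fun k => (x k).toNat).getD i 0) n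

theorem bit_number {n : ℕ} (x : Fin n → Bool) (k : Fin n) : bit (number x) k = (x k).toNat := by
  rw [number, bit_ofBits _ k.2, List.getD_eq_getElem _ _ (by simp)]
  cases h : x k <;> simp [h]

theorem number_lt {n : ℕ} (x : Fin n → Bool) : number x < 2 ^ n := ofBits_lt _ _

namespace Params

variable (p : Params)

/-- The interactive code with parameters `p`. -/
def code : IECC where
  rounds n := (p.cfg n).blocks * (11 * (p.cfg n).u)
  aliceSpeaks n i := decide (3 * (p.cfg n).u ≤ i % (11 * (p.cfg n).u))
  aliceMsg n x view := decide ((p.cfg n).aWord (number x)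
    ((p.cfg n).aSt (number x) (codes view) (view.length / (11 * (p.cfg n).u) + 1))
    (view.length / (11 * (p.cfg n).u))
    (view.length % (11 * (p.cfg n).u) - 3 * (p.cfg n).u) = 1)
  bobMsg n view := decide (had (view.length % (11 * (p.cfg n).u) % 3 + 1)
    ((p.cfg n).bobSym (codes view) (view.length / (11 * (p.cfg n).u))) = 1)
  bobOut n view k := decide (bit ((p.cfg n).out (codes view)) k = 1)

theorem toNat_decide_eq_one {a : ℕ} (h : a < 2) : (decide (a = 1)).toNat = a := by
  interval_cases a <;> rfl

end Params

end RAM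

namespace IECC

/-! ### Transcripts and views of an arbitrary protocol. -/

variable (π : IECC) {n : ℕ} (x : Fin n → Bool) (att : Attack)

/-- The bit that is sent in round `i`. -/
def sent (i : ℕ) : Bool :=
  if π.aliceSpeaks n i then π.aliceMsg n x (π.aliceView n (π.transcript x att i))
    else π.bobMsg n (π.bobView n (π.transcript x att i))

/-- Whether the bit of round `i` is erased. -/
def erased (i : ℕ) : Bool := att (π.transcript x att i) (π.sent x att i)

theorem transcript_eq (m : ℕ) :
    π.transcript x att m = (List.range m).map fun i => (π.sent x att i, π.erased x att i) := by
  induction m with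
  | zero => rfl
  | succ m ih =>
    rw [List.range_succ, List.map_append, ← ih]
    rfl

theorem erasures_transcript (m : ℕ) : erasures (π.transcript x att m) =
    ∑ i ∈ Finset.range m, if π.erased x att i then 1 else 0 := by
  induction m with
  | zero => rfl
  | succ m ih =>
    rw [Finset.sum_range_succ, ← ih]
    change List.countP _ (π.transcript x att m ++ [(π.sent x att m, π.erased x att m)]) = _
    rw [List.countP_append, List.countP_singleton]
    rfl

theorem length_partyView (own : ℕ → Bool) (T : Transcript) : (partyView own T).length = T.length :=
  List.length_mapIdx

theorem codes_partyView (own : ℕ → Bool) {m i : ℕ} (hi : i < m) :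
    RAM.codes (partyView own (π.transcript x att m)) i =
      if own i || !π.erased x att i then (π.sent x att i).toNat else 2 := by
  have h : i < (partyView own (π.transcript x att m)).length := by
    simpa [length_partyView, transcript_eq] using hi
  unfold RAM.codes
  rw [List.getD_eq_getElem _ _ (by simpa using h), List.getElem_map]
  simp only [partyView, List.getElem_mapIdx, transcript_eq, List.getElem_map, List.getElem_range]
  split_ifs <;> rfl

end IECC

namespace RAM

namespace Params

variable {p : Params} {n zm : ℕ}

theorem aliceSpeaks_eq_true {j a : ℕ} (ha : a < 8 * (p.cfg n).u) :
    p.code.aliceSpeaks n (j * (11 * (p.cfg n).u) + 3 * (p.cfg n).u + a) = true := by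
  simp only [code, decide_eq_true_eq]
  rw [add_assoc, Scheme.round_mod (by omega)]
  omega

theorem aliceSpeaks_eq_false {j y : ℕ} (hy : y < 3 * (p.cfg n).u) :
    p.code.aliceSpeaks n (j * (11 * (p.cfg n).u) + y) = false := by
  simp only [code, decide_eq_false_iff_not]
  rw [Scheme.round_mod (by omega)]
  omega

section

variable (p) (x : Fin n → Bool) (att : IECC.Attack)

/-- Alice's view of the whole execution. -/
def viewA : ℕ → ℕ := codes (p.code.aliceView n (p.code.transcript x att (p.code.rounds n)))

/-- Bob's view of the whole execution. -/
def viewB : ℕ → ℕ := codes (p.code.bobView n (p.code.transcript x att (p.code.rounds n)))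

variable {x att}

theorem viewA_eq {i : ℕ} (hi : i < p.code.rounds n) : p.viewA x att i =
    if p.code.aliceSpeaks n i || !p.code.erased x att i then (p.code.sent x att i).toNat else 2 :=
  p.code.codes_partyView x att _ hi

theorem viewB_eq {i : ℕ} (hi : i < p.code.rounds n) : p.viewB x att i =
    if !p.code.aliceSpeaks n i || !p.code.erased x att i then (p.code.sent x att i).toNat else 2 :=
  p.code.codes_partyView x att _ hi

theorem codes_aliceView {m i : ℕ} (hm : m ≤ p.code.rounds n) (hi : i < m) :
    codes (p.code.aliceView n (p.code.transcript x att m)) i = p.viewA x att i :=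
  (p.code.codes_partyView x att _ hi).trans (p.viewA_eq (hi.trans_le hm)).symm

theorem codes_bobView {m i : ℕ} (hm : m ≤ p.code.rounds n) (hi : i < m) :
    codes (p.code.bobView n (p.code.transcript x att m)) i = p.viewB x att i :=
  (p.code.codes_partyView x att _ hi).trans (p.viewB_eq (hi.trans_le hm)).symm

end

theorem had_lt_two (y z : ℕ) : had y z < 2 := Nat.mod_lt _ (by norm_num)

theorem toNat_aliceMsg (x : Fin n → Bool) (view : List RecvSym) :
    (p.code.aliceMsg n x view).toNat = (p.cfg n).aWord (number x)
      ((p.cfg n).aSt (number x) (codes view) (view.length / (11 * (p.cfg n).u) + 1))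
      (view.length / (11 * (p.cfg n).u)) (view.length % (11 * (p.cfg n).u) - 3 * (p.cfg n).u) :=
  toNat_decide_eq_one (Scheme.aWord_lt_two _ _ _ _)

theorem toNat_bobMsg (view : List RecvSym) :
    (p.code.bobMsg n view).toNat = had (view.length % (11 * (p.cfg n).u) % 3 + 1)
      ((p.cfg n).bobSym (codes view) (view.length / (11 * (p.cfg n).u))) :=
  toNat_decide_eq_one (had_lt_two _ _)

/-- The conditions speak of the views of the whole execution, whereas a bit is computed from the
view up to its round. The two agree on the past, and by causality nothing else is used. -/
theorem run (x : Fin n → Bool) (att : IECC.Attack) :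
    (p.cfg n).Run (number x) (p.viewA x att) (p.viewB x att) := by
  have hlenA : ∀ m, (p.code.aliceView n (p.code.transcript x att m)).length = m := fun m => by
    rw [IECC.aliceView, IECC.length_partyView, IECC.transcript_eq]
    simp
  have hlenB : ∀ m, (p.code.bobView n (p.code.transcript x att m)).length = m := fun m => by
    rw [IECC.bobView, IECC.length_partyView, IECC.transcript_eq]
    simp
  refine ⟨number_lt x, fun j hj y hy => ?_, fun j hj a ha => ?_⟩
  · have hr : j * (11 * (p.cfg n).u) + y < p.code.rounds n := Scheme.round_lt hj (by omega)
    rw [p.viewA_eq hr, aliceSpeaks_eq_false hy]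
    by_cases he : p.code.erased x att (j * (11 * (p.cfg n).u) + y)
    · left
      simp [he]
    · right
      simp only [he, Bool.false_or, Bool.not_false, if_true]
      rw [IECC.sent, aliceSpeaks_eq_false hy, if_neg Bool.false_ne_true, toNat_bobMsg, hlenB,
        Scheme.round_mod (by omega), Scheme.round_div (by omega)]
      congr 1
      exact Scheme.bobSym_congr fun i hi => p.codes_bobView hr.le (by omega)
  · have hr : j * (11 * (p.cfg n).u) + 3 * (p.cfg n).u + a < p.code.rounds n := by
      rw [add_assoc]
      exact Scheme.round_lt hj (by omega)
    rw [p.viewB_eq hr, aliceSpeaks_eq_true ha]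
    by_cases he : p.code.erased x att (j * (11 * (p.cfg n).u) + 3 * (p.cfg n).u + a)
    · left
      simp [he]
    · right
      simp only [he, Bool.not_true, Bool.false_or, Bool.not_false, if_true]
      rw [IECC.sent, aliceSpeaks_eq_true ha, if_pos rfl, toNat_aliceMsg, hlenA, add_assoc,
        Scheme.round_div (by omega), Scheme.round_mod (by omega), Nat.add_sub_cancel_left]
      rw [Scheme.aSt_congr fun i hi => p.codes_aliceView (by omega) (by omega)]

/-- Bits have codes `0` and `1` and a party always knows its own bits, so the code `2` occurs in the
receiver's view exactly at the erased rounds. -/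
theorem erasures_eq (x : Fin n → Bool) (att : IECC.Attack) :
    IECC.erasures (p.code.transcript x att (p.code.rounds n)) =
      ∑ j ∈ Finset.range (p.cfg n).blocks,
        ((p.cfg n).costA (p.viewB x att) j + (p.cfg n).costB (p.viewA x att) j) := by
  rw [IECC.erasures_transcript]
  change ∑ i ∈ Finset.range ((p.cfg n).blocks * (11 * (p.cfg n).u)), _ = _
  rw [sum_range_mul]
  refine Finset.sum_congr rfl fun j hj => ?_
  rw [show 11 * (p.cfg n).u = 3 * (p.cfg n).u + 8 * (p.cfg n).u by ring, Finset.sum_range_add, add_comm]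
  rw [show 3 * (p.cfg n).u + 8 * (p.cfg n).u = 11 * (p.cfg n).u by ring]
  unfold Scheme.costA Scheme.costB
  rw [Finset.card_filter, Finset.card_filter]
  have hne : ∀ b : Bool, b.toNat ≠ 2 := fun b => by cases b <;> decide
  congr 1
  · refine Finset.sum_congr rfl fun a ha => ?_
    have ha := Finset.mem_range.mp ha
    rw [← add_assoc, p.viewB_eq (by
      rw [add_assoc]; exact Scheme.round_lt (Finset.mem_range.mp hj) (by omega)),
      aliceSpeaks_eq_true ha]
    by_cases he : p.code.erased x att (j * (11 * (p.cfg n).u) + 3 * (p.cfg n).u + a) <;>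
      simp [he, hne]
  · refine Finset.sum_congr rfl fun y hy => ?_
    have hy := Finset.mem_range.mp hy
    rw [p.viewA_eq (Scheme.round_lt (Finset.mem_range.mp hj) (by omega)), aliceSpeaks_eq_false hy]
    by_cases he : p.code.erased x att (j * (11 * (p.cfg n).u) + y) <;> simp [he, hne]

theorem bobOut_eq (x : Fin n → Bool) (att : IECC.Attack)
    (h : (p.cfg n).out (p.viewB x att) = number x) :
    p.code.bobOut n (p.code.bobView n (p.code.transcript x att (p.code.rounds n))) = x := by
  funext k
  change decide (bit ((p.cfg n).out (p.viewB x att)) k = 1) = x k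
  rw [h, bit_number]
  cases x k <;> rfl

end Params

end RAM

/-! ## Choice of the parameters -/

namespace RAM

theorem HaltsWithin.mono {c : Prog} {s : Memory} {T T' : ℕ} {Q Q' : Memory → Prop}
    (h : HaltsWithin c s T Q) (hT : T ≤ T') (hQ : ∀ s, Q s → Q' s) : HaltsWithin c s T' Q' := by
  obtain ⟨t, s', he, ht, hq⟩ := h
  exact ⟨t, s', he, ht.trans hT, hQ _ hq⟩

namespace Params

/-- The constants are large enough. -/
structure Admissible (p : Params) : Prop where
  K_pos : 0 < p.K
  v_ge : 9 * p.K ≤ p.v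
  s_pos : 1 ≤ p.s
  s_ge : 3 * p.K * p.v ≤ 2 ^ (p.s - 1)
  m_ge : p.s ≤ p.m₀
  pow_ge : 3 * p.K * 2 ^ p.v ≤ 2 ^ p.m₀

/-- The constants are chosen in the order `v`, `s`, `m₀`; the exponential requirements hold because
`k < 2 ^ k`. -/
theorem exists_admissible {K : ℕ} (hK : 0 < K) : ∃ p : Params, p.K = K ∧ p.Admissible := by
  refine ⟨⟨9 * K, 3 * K * (9 * K) + 1, K, 3 * K * (9 * K) + 1 + 3 * K * 2 ^ (9 * K)⟩, rfl, hK, le_rfl,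
    by simp, ?_, by simp, ?_⟩
  · exact Nat.lt_two_pow_self.le
  · refine Nat.lt_two_pow_self.le.trans (Nat.pow_le_pow_right (by norm_num) ?_)
    simp

variable {p : Params}

theorem le_deg (n : ℕ) : p.m₀ ≤ p.deg n := by
  unfold deg
  have : ∀ k, p.m₀ ≤ iter (fun _ m => if n ≤ m * 2 ^ ((m - p.s) * p.v) then m else m + 1) p.m₀ k := by
    intro k
    induction k with
    | zero => exact le_rfl
    | succ k ih =>
      rw [iter]
      split_ifs <;> omega
  exact this n

/-- The loop stops at the least sufficient degree from `m₀` on. Its `n` iterations are enough,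
because degree `m₀ + n` certainly suffices, and minimality is what keeps the code length linear. -/
theorem deg_spec (n : ℕ) : n ≤ p.deg n * 2 ^ ((p.deg n - p.s) * p.v) ∧
    (p.deg n = p.m₀ ∨ (p.deg n - 1) * 2 ^ ((p.deg n - 1 - p.s) * p.v) < n) := by
  have key : ∀ k, (n ≤ iter (fun _ m => if n ≤ m * 2 ^ ((m - p.s) * p.v) then m else m + 1) p.m₀ k *
      2 ^ ((iter (fun _ m => if n ≤ m * 2 ^ ((m - p.s) * p.v) then m else m + 1) p.m₀ k - p.s) * p.v) ∨
      iter (fun _ m => if n ≤ m * 2 ^ ((m - p.s) * p.v) then m else m + 1) p.m₀ k = p.m₀ + k) ∧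
      (iter (fun _ m => if n ≤ m * 2 ^ ((m - p.s) * p.v) then m else m + 1) p.m₀ k = p.m₀ ∨
      (iter (fun _ m => if n ≤ m * 2 ^ ((m - p.s) * p.v) then m else m + 1) p.m₀ k - 1) *
        2 ^ ((iter (fun _ m => if n ≤ m * 2 ^ ((m - p.s) * p.v) then m else m + 1) p.m₀ k - 1 -
          p.s) * p.v) < n) := by
    intro k
    induction k with
    | zero => exact ⟨Or.inr rfl, Or.inl rfl⟩
    | succ k ih =>
      rw [iter]
      set m := iter (fun _ m => if n ≤ m * 2 ^ ((m - p.s) * p.v) then m else m + 1) p.m₀ k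
      split_ifs with h
      · exact ⟨Or.inl h, ih.2⟩
      · refine ⟨Or.inr ?_, Or.inr ?_⟩
        · have := ih.1.resolve_left h
          omega
        · rw [Nat.add_sub_cancel]
          omega
  obtain ⟨h1, h2⟩ := key n
  change (_ ≤ p.deg n * 2 ^ ((p.deg n - p.s) * p.v) ∨ p.deg n = _) at h1
  refine ⟨h1.elim id fun h => ?_, h2⟩
  exact le_trans (by omega) (Nat.le_mul_of_pos_right _ (by positivity))

theorem Admissible.deg_pos (hp : p.Admissible) (n : ℕ) : 0 < p.deg n := by
  have h1 := hp.s_pos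
  have h2 := hp.m_ge
  have h3 := le_deg (p := p) n
  omega

theorem Admissible.len_pos (hp : p.Admissible) (n : ℕ) : 0 < (p.cfg n).len :=
  Nat.mul_pos (by positivity) (hp.deg_pos n)

theorem Admissible.le_len (hp : p.Admissible) (n : ℕ) : n ≤ (p.cfg n).len := by
  have h := (deg_spec (p := p) n).1
  rw [mul_comm] at h
  refine h.trans (Nat.mul_le_mul_right _ (Nat.pow_le_pow_right (by norm_num) ?_))
  have := hp.s_pos
  exact Nat.mul_le_mul_right _ (by omega)

/-- The length of the code is linear in the input length. -/
theorem Admissible.len_le (hp : p.Admissible) : ∃ C, 0 < C ∧ ∀ n, (p.cfg n).len ≤ C * (n + 1) := by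
  refine ⟨2 ^ (p.s * p.v + 1) + 2 ^ ((p.m₀ - 1) * p.v) * p.m₀, by positivity, fun n => ?_⟩
  change 2 ^ ((p.deg n - 1) * p.v) * p.deg n ≤ _
  rcases (deg_spec (p := p) n).2 with h | h
  · rw [h]
    refine (Nat.le_add_left _ _).trans (Nat.le_mul_of_pos_right _ (Nat.succ_pos n))
  · by_cases hm : p.deg n = p.m₀
    · rw [hm]
      exact (Nat.le_add_left _ _).trans (Nat.le_mul_of_pos_right _ (Nat.succ_pos n))
    have h1 := le_deg (p := p) n
    have h2 := hp.m_ge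
    have h3 := hp.s_pos
    obtain ⟨d, hd⟩ : ∃ d, p.deg n = p.s + d + 1 := ⟨p.deg n - p.s - 1, by omega⟩
    rw [hd] at h ⊢
    rw [show p.s + d + 1 - 1 = p.s + d by omega] at *
    rw [show p.s + d - p.s = d by omega] at h
    calc 2 ^ ((p.s + d) * p.v) * (p.s + d + 1)
        -- The preceding degree was too small, so its capacity `(s + d) * 2 ^ (d * v)` is below `n`;
        -- code length and capacity differ by a constant factor only.
        ≤ 2 ^ ((p.s + d) * p.v) * (2 * (p.s + d)) := Nat.mul_le_mul_left _ (by omega)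
      _ = 2 ^ (p.s * p.v + 1) * ((p.s + d) * 2 ^ (d * p.v)) := by
          rw [add_mul p.s d p.v, pow_add, pow_succ]; ring
      _ ≤ 2 ^ (p.s * p.v + 1) * (n + 1) := Nat.mul_le_mul_left _ (by omega)
      _ ≤ _ := Nat.mul_le_mul_right _ (Nat.le_add_right _ _)

theorem Admissible.two_pow_deg_le (hp : p.Admissible) (n : ℕ) : 2 ^ p.deg n ≤ 2 * (p.cfg n).len := by
  have h1 := hp.deg_pos n
  have h2 : 1 ≤ p.v := by
    have := hp.v_ge
    have := hp.K_pos
    omega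
  obtain ⟨d, hd⟩ : ∃ d, p.deg n = d + 1 := ⟨p.deg n - 1, by omega⟩
  change _ ≤ 2 * (2 ^ ((p.deg n - 1) * p.v) * p.deg n)
  rw [hd, Nat.add_sub_cancel, pow_succ, mul_comm]
  refine Nat.mul_le_mul_left _ ((Nat.pow_le_pow_right (by norm_num) ?_).trans
    (Nat.le_mul_of_pos_right _ (Nat.succ_pos d)))
  exact Nat.le_mul_of_pos_right _ h2

/-- A polynomial loop bound suffices. -/
theorem Admissible.big (hp : p.Admissible) : ∃ E, ∀ n, p.Big n ((n + E) ^ 3) := by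
  obtain ⟨C, hC, hlen⟩ := hp.len_le
  -- The sum of the coefficients of all required bounds. These bounds are at most quadratic in `n +
  -- 1`, and one more factor absorbs the coefficient, whence the cube.
  set E := 16 + (p.v + 3) + (p.m₀ + 1) * (p.v + 1) + 4 * C + (p.v + 2) * (2 * C * (2 * C)) +
    C * (8 * 2 ^ p.v) + 11 * 2 ^ p.v * (p.K * C) + 11 * 2 ^ p.v + p.K with hE
  refine ⟨E, fun n => ?_⟩
  have h3 : E * ((n + 1) * (n + 1)) ≤ (n + E) ^ 3 := by
    have : n + 1 ≤ n + E := by omega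
    calc E * ((n + 1) * (n + 1)) ≤ (n + E) * ((n + E) * (n + E)) :=
          Nat.mul_le_mul (by omega) (Nat.mul_le_mul this this)
      _ = (n + E) ^ 3 := by ring
  have h2 : ∀ {x e : ℕ}, x ≤ e * ((n + 1) * (n + 1)) → e ≤ E → x ≤ (n + E) ^ 3 := fun hx he =>
    hx.trans ((Nat.mul_le_mul_right _ he).trans h3)
  have h1 : ∀ {x e : ℕ}, x ≤ e * (n + 1) → e ≤ E → x ≤ (n + E) ^ 3 := fun hx he =>
    h2 (hx.trans (Nat.mul_le_mul_left _ (Nat.le_mul_of_pos_left _ (Nat.succ_pos n)))) he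
  have h0 : ∀ {e : ℕ}, e ≤ E → e ≤ (n + E) ^ 3 := fun he =>
    h1 (Nat.le_mul_of_pos_right _ (Nat.succ_pos n)) he
  have hq : 2 ^ p.deg n ≤ 2 * C * (n + 1) := by
    have e1 := hp.two_pow_deg_le n
    have e2 := hlen n
    rw [mul_assoc]
    omega
  have hm : p.m₀ + n ≤ (p.m₀ + 1) * (n + 1) := by
    have : (p.m₀ + 1) * (n + 1) = p.m₀ * n + p.m₀ + n + 1 := by ring
    omega
  refine ⟨h0 (by omega), h1 (e := 1) (by omega) (by omega), h2 (e := 1) ?_ (by omega), h0 (by omega),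
    h1 hm ?_, h1 (e := (p.m₀ + 1) * p.v) ?_ ?_, h1 (e := 4 * C) ?_ (by omega),
    h2 (e := (p.v + 2) * (2 * C * (2 * C))) ?_ (by omega), h1 (e := C * (8 * 2 ^ p.v)) ?_ (by omega),
    h1 (e := 11 * 2 ^ p.v * (p.K * C)) ?_ (by omega), h0 (by omega), h0 (by omega), hp.deg_pos n⟩
  · rw [one_mul]
    exact Nat.mul_le_mul_right _ (Nat.le_succ n)
  · have : (p.m₀ + 1) ≤ (p.m₀ + 1) * (p.v + 1) := Nat.le_mul_of_pos_right _ (Nat.succ_pos _)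
    omega
  · calc (p.m₀ + n) * p.v ≤ (p.m₀ + 1) * (n + 1) * p.v := Nat.mul_le_mul_right _ hm
      _ = _ := by ring
  · have : (p.m₀ + 1) * p.v ≤ (p.m₀ + 1) * (p.v + 1) := Nat.mul_le_mul_left _ (Nat.le_succ _)
    omega
  · rw [pow_succ]
    have : 4 * C * (n + 1) = 2 * C * (n + 1) * 2 := by ring
    omega
  · have e1 : 2 ^ p.deg n ≤ 2 ^ p.deg n * 2 ^ p.deg n := Nat.le_mul_of_pos_left _ (by positivity)
    have e2 : p.deg n ≤ 2 ^ p.deg n := Nat.lt_two_pow_self.le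
    calc p.deg n + p.v * (2 ^ p.deg n * 2 ^ p.deg n) + 2 ^ p.deg n
        ≤ (p.v + 2) * (2 ^ p.deg n * 2 ^ p.deg n) := by rw [add_mul p.v 2]; omega
      _ ≤ (p.v + 2) * (2 * C * (n + 1) * (2 * C * (n + 1))) :=
          Nat.mul_le_mul_left _ (Nat.mul_le_mul hq hq)
      _ = _ := by ring
  · calc (p.cfg n).len * (8 * 2 ^ p.v) ≤ C * (n + 1) * (8 * 2 ^ p.v) :=
          Nat.mul_le_mul_right _ (hlen n)
      _ = _ := by ring
  · calc 11 * 2 ^ p.v * (p.K * (p.cfg n).len) ≤ 11 * 2 ^ p.v * (p.K * (C * (n + 1))) :=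
          Nat.mul_le_mul_left _ (Nat.mul_le_mul_left _ (hlen n))
      _ = _ := by ring

theorem Admissible.linearCommunication (hp : p.Admissible) : p.code.LinearCommunication := by
  obtain ⟨C, hC, hlen⟩ := hp.len_le
  refine IsBigO.of_bound ((p.K * (C * 2) * (11 * 2 ^ p.v) : ℕ) : ℝ) ?_
  filter_upwards [eventually_ge_atTop 1] with n hn
  rw [Real.norm_natCast, Real.norm_natCast, ← Nat.cast_mul, Nat.cast_le]
  calc p.K * (p.cfg n).len * (11 * 2 ^ p.v) ≤ p.K * (C * (n + 1)) * (11 * 2 ^ p.v) :=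
        Nat.mul_le_mul_right _ (Nat.mul_le_mul_left _ (hlen n))
    _ ≤ p.K * (C * (2 * n)) * (11 * 2 ^ p.v) :=
        Nat.mul_le_mul_right _ (Nat.mul_le_mul_left _ (Nat.mul_le_mul_left _ (by omega)))
    _ = _ := by ring

theorem sym_xor (n v s m P X Y j i : ℕ) :
    sym n v s m P (X ^^^ Y) j i = (sym n v s m P X j i + sym n v s m P Y j i) % 2 := by
  unfold sym
  simp only [bit_xor]
  induction n with
  | zero => simp
  | succ n ih =>
    rw [Finset.sum_range_succ, Finset.sum_range_succ, Finset.sum_range_succ]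
    have h1 := bit_lt_two X n
    have h2 := bit_lt_two Y n
    generalize bit X n = x at *
    generalize bit Y n = y at *
    interval_cases x <;> interval_cases y <;> simp <;> omega

theorem Admissible.valid (hp : p.Admissible) (n : ℕ) : (p.cfg n).Valid ((p.cfg n).len / p.K) where
  sy_xor _ _ _ _ := sym_xor _ _ _ _ _ _ _ _ _
  card_zeros_le X hX hX0 := by
    have hle := le_deg (p := p) n
    have hP := primPoly_spec (hp.deg_pos n)
    rw [Nat.le_div_iff_mul_le hp.K_pos, mul_comm]
    refine card_zero_symbols_le hp.K_pos hp.v_ge hp.s_pos hp.s_ge (hp.m_ge.trans hle)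
      (hp.pow_ge.trans (Nat.pow_le_pow_right (by norm_num) hle)) hP.1 hP.2 ?_ hX hX0
    rw [mul_comm]
    exact (deg_spec n).1
  len_pos := hp.len_pos n

theorem Admissible.erasureResilient (hp : p.Admissible) {ε : ℝ} (hε : 48 < 11 * ε * p.K) :
    p.code.ErasureResilient (6 / 11 - ε) := by
  -- For `n > 4` one has `2 * n + 4 ≤ 3 * n ≤ 3 * len`.
  refine ⟨4, fun n hn x att he => bobOut_eq x att ?_⟩
  by_contra hne
  have hcost := (run x att).cost_of_out_ne (hp.valid n) hne
  rw [← erasures_eq] at hcost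
  have hrounds : p.code.rounds n = p.K * (p.cfg n).len * (11 * (p.cfg n).u) := rfl
  have hblocks : (p.cfg n).blocks = p.K * (p.cfg n).len := rfl
  have hlen := hp.le_len n
  have hlpos := hp.len_pos n
  have hupos := (p.cfg n).u_pos
  rw [hblocks] at hcost
  generalize IECC.erasures (p.code.transcript x att (p.code.rounds n)) = e at *
  rw [hrounds] at he
  -- The total loss in blocks: `1 + 3 + 4` times `len`, where the last term comes from coinciding
  -- symbols with `zm = len / K`. Weighted by `6 * u` bits per block, this gives the constant `48`
  -- in `hε`.
  have hN : (p.cfg n).len + (2 * n + 4) + p.K * (4 * ((p.cfg n).len / p.K)) ≤ 8 * (p.cfg n).len := by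
    have h1 := Nat.mul_div_le (p.cfg n).len p.K
    have h2 : p.K * (4 * ((p.cfg n).len / p.K)) = 4 * (p.K * ((p.cfg n).len / p.K)) := by ring
    omega
  have hcost' : 6 * (p.cfg n).u * (p.K * (p.cfg n).len) ≤
      e + 6 * (p.cfg n).u * (8 * (p.cfg n).len) :=
    hcost.trans (Nat.add_le_add_left (Nat.mul_le_mul_left _ hN) _)
  have hreal : (6 * (p.cfg n).u * (p.K * (p.cfg n).len) : ℝ) ≤
      e + 6 * (p.cfg n).u * (8 * (p.cfg n).len) := by exact_mod_cast hcost'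
  push_cast at he
  have hpos : (0 : ℝ) < (p.cfg n).u * (p.cfg n).len := by positivity
  nlinarith

theorem Admissible.polyTime (hp : p.Admissible) : p.code.PolyTime := by
  obtain ⟨E, hbig⟩ := hp.big
  have hu : ∀ n, 0 < 11 * (p.cfg n).u := fun n => by
    have := (p.cfg n).u_pos
    omega
  have hpt_u : ∀ {D : Inp → (ℕ → ℕ) → Prop}, PT D (fun I _ => 11 * (p.cfg I.n).u) :=
    PT.lit_mul 11 pt_u
  have hR : ∀ I : Inp, p.Big I.n I.N → p.code.rounds I.n ≤ I.N := fun I h => by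
    have := h.rounds_le
    rwa [mul_comm] at this
  let D₀ : Inp → (ℕ → ℕ) → Prop := fun I _ => p.Big I.n I.N
  let D₁ : Inp → (ℕ → ℕ) → Prop := fun I ρ => p.Big I.n I.N ∧ ρ 0 < p.code.rounds I.n
  let D₂ : Inp → (ℕ → ℕ) → Prop := fun I _ => p.Big I.n I.N ∧ I.len < p.code.rounds I.n
  -- Variable `0` is the index of the table entry being written: a round in `D₁`, an output bit
  -- here. For the messages, `D₂` instead restricts the length of the view.
  let D₃ : Inp → (ℕ → ℕ) → Prop := fun I ρ => p.Big I.n I.N ∧ ρ 0 < I.n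
  have hD₀ : p.Dom D₀ := fun I _ h => h
  have hD₁ : p.Dom D₁ := fun I _ h => h.1
  have hD₂ : p.Dom D₂ := fun I _ h => h.1
  have hD₃ : p.Dom D₃ := fun I _ h => h.1
  have hle₂ : ∀ I ρ, D₂ I ρ → I.len ≤ I.N := fun I _ h => h.2.le.trans (hR I h.1)
  have hdiv : PT D₂ (fun I _ => I.len / (11 * (p.cfg I.n).u)) :=
    PT.div PT.len hpt_u hle₂ fun I _ _ => hu I.n
  have hmod : PT D₂ (fun I _ => I.len % (11 * (p.cfg I.n).u)) :=
    PT.mod PT.len hpt_u hle₂ fun I _ _ => hu I.n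
  have hblock : ∀ I ρ, D₂ I ρ → I.len / (11 * (p.cfg I.n).u) < (p.cfg I.n).blocks :=
    fun I _ h => (Nat.div_lt_iff_lt_mul (hu I.n)).mpr h.2
  obtain ⟨eR, heR⟩ : PT D₀ (fun I _ => p.code.rounds I.n) :=
    PT.mul (pt_blocks hD₀) hpt_u fun I ρ h => blocks_le h
  obtain ⟨eS, heS⟩ : PT D₁ (fun I ρ => if 3 * (p.cfg I.n).u ≤ ρ 0 % (11 * (p.cfg I.n).u) then 1 else 0) :=
    PT.cond (PTp.le (PT.lit_mul 3 pt_u) (PT.mod (PT.var 0) hpt_u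
      (fun I ρ h => h.2.le.trans (hR I h.1)) fun I _ _ => hu I.n)) (PT.lit 1) (PT.lit 0)
  have hX : PT D₂ (fun I _ => ofBits I.v I.n) := PT.ofBits (g := fun I _ => I.v) PT.n
    (fun I _ h => (Nat.le_succ _).trans h.1.n_lt) (PT.loadv (PT.var 0))
  obtain ⟨eA, heA⟩ := pt_aWord hD₂ hX (pt_aSt hD₂ hX (hdiv.add (PT.lit 1)) fun I ρ h => hblock I ρ h)
    hdiv (hmod.sub (PT.lit_mul 3 pt_u)) hblock
  obtain ⟨eB, heB⟩ := pt_bobBit hD₂ hmod (pt_bobSym hD₂ hdiv hblock)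
    fun I ρ h => (Nat.mod_le _ _).trans (hle₂ I ρ h)
  obtain ⟨eO, heO⟩ := PT.bit (pt_out hD₃) (PT.var 0)
    fun I ρ h => h.2.le.trans ((Nat.le_succ _).trans h.1.n_lt)
  refine ⟨tableProg E 3 eR eS, evalProg E 3 eA, evalProg E 3 eB, tableProg E 3 (.glob 0) eO,
    tableCost E 3 eR eS ((Polynomial.X + Polynomial.C E) ^ 3) + evalCost E 3 eA + evalCost E 3 eB +
      tableCost E 3 (.glob 0) eO Polynomial.X, fun n => ⟨?_, ?_, ?_, ?_⟩⟩
  · have hb : eR.eval (inpOf n ((n + E) ^ 3) [] []) (fun _ => 0) = p.code.rounds n :=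
      heR (inpOf n ((n + E) ^ 3) [] []) _ (hbig n)
    refine (tableProg_correct E 3 eR eS n [] ((Polynomial.X + Polynomial.C E) ^ 3) ?_
      (fun i => (p.code.aliceSpeaks n i).toNat) ?_).mono ?_ ?_
    · rw [hb]
      simp only [Polynomial.eval_pow, Polynomial.eval_add, Polynomial.eval_X, Polynomial.eval_C]
      exact hR (inpOf n ((n + E) ^ 3) [] []) (hbig n)
    · intro v i hi
      rw [hb] at hi
      rw [heS _ _ ⟨hbig n, hi⟩]
      change (if 3 * (p.cfg n).u ≤ i % (11 * (p.cfg n).u) then 1 else 0) =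
        (decide (3 * (p.cfg n).u ≤ i % (11 * (p.cfg n).u))).toNat
      split_ifs with h <;> simp [h]
    · simp only [Polynomial.eval_add]
      omega
    · rw [hb]
      exact fun s hs => hs
  · intro x v hv
    refine (evalProg_correct E 3 eA n (List.ofFn fun k => (x k).toNat) (v.map RecvSym.code)).mono
      ?_ fun s hs => ?_
    · simp only [Polynomial.eval_add]
      omega
    · rw [hs, heA _ _ ⟨hbig n, by simpa [inpOf] using hv⟩, toNat_aliceMsg]
      simp only [inpOf, List.length_map]
      rfl
  · intro v hv
    refine (evalProg_correct E 3 eB n [] (v.map RecvSym.code)).mono ?_ fun s hs => ?_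
    · simp only [Polynomial.eval_add]
      omega
    · rw [hs, heB _ _ ⟨hbig n, by simpa [inpOf] using hv⟩, toNat_bobMsg]
      simp only [inpOf, List.length_map]
      rfl
  · intro v hv
    refine (tableProg_correct E 3 (.glob 0) eO n (v.map RecvSym.code) Polynomial.X ?_
      (fun i => bit ((p.cfg n).out (codes v)) i) ?_).mono ?_ fun s hs k => ?_
    · simp [Ex.eval, inpOf]
    · intro v' i hi
      exact heO _ _ ⟨hbig n, hi⟩
    · simp only [Polynomial.eval_add]
      omega
    · rw [hs.2 k k.2]
      exact (toNat_decide_eq_one (bit_lt_two _ _)).symm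

end Params

end RAM

theorem theorem1p1 (ε : ℝ) (hε : 0 < ε) :
    ∃ π : IECC, π.ErasureResilient (6 / 11 - ε) ∧ π.LinearCommunication ∧ π.PolyTime := by
  obtain ⟨K, hK⟩ := exists_nat_gt (48 / (11 * ε))
  rw [div_lt_iff₀ (by positivity)] at hK
  have hK0 : 0 < K := by
    rcases Nat.eq_zero_or_pos K with rfl | h
    · norm_num at hK
    · exact h
  obtain ⟨p, rfl, hp⟩ := RAM.Params.exists_admissible hK0
  exact ⟨p.code, hp.erasureResilient (by linarith), hp.linearCommunication, hp.polyTime⟩
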